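/- Let $D>0$, let $u_-\neq u_+$ be real numbers, and let $F:\mathbb R\to\mathbb R$ be $\mathcal C^2$ with bounded $F'$ and $F''$, and $\mathcal C^\infty$ in a neighbourhood of every point of the closed interval with end points $u_\pm$. Put $\gamma=\frac{F(u_+)-F(u_-)}{u_+-u_-}$ and suppose that $(u_+-u_-)\big(F(u)-F(u_-)-\gamma(u-u_-)\big)>0$ for all $u$ strictly between $u_-$ and $u_+$ (for $u_-<u_+$ this is the Oleinik condition $F(u)-F(u_-)>\gamma(u-u_-)$), and that $F'(u_+)<\gamma<F'(u_-)$. Let $U$ be a travelling wave profile, i.e. $D\,U_x=F(U)-F(u_-)-\gamma(U-u_-)$ on $\mathbb R$ and $U(x)\to u_\pm$ as $x\to\pm\infty$. For $T>0$ let $\mathcal E^1$ be the set of paths $u=(u(t,x))_{t\in[0,T],\,x\in\mathbb R}$ with $u-U\in\mathcal C([0,T],H^1(\mathbb R))$. For a kernel $\Phi$ on $\mathbb R\times\mathbb R$, write $\Phi f(x)=\int\Phi(x,x')f(x')\,dx'$, and for $h\in L^2([0,T],L^2(\mathbb R))$ write $u=\mathcal H[h]$ if $u\in\mathcal E^1$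 is a mild solution of $u_t+F(u)_x=Du_{xx}+\Phi h$, $u(0,\cdot)=U$, i.e. $u(t)=S(t)U-\int_0^tS(t-s)\,F(u(s))_x\,ds+\int_0^tS(t-s)\,\Phi h(s)\,ds$, where $S(t)$ is the semigroup generated by $D\partial_x^2$. Let $$I(u)=\inf_{h:\,u=\mathcal H[h]}\ \frac12\int_0^T\|h(t,\cdot)\|_{L^2}^2\,dt\quad(\inf\emptyset=\infty),\qquad \mathcal J(A)=\inf_{u\in A}I(u),$$ $$A=\{u\in\mathcal E^1:\ u(0,x)=U(x),\ u(T,x)=U(x-\gamma T-x_0)\}.$$ There is a constant $C_0>0$, depending only on $D,F,u_\pm,U$, such that the following holds for all $\sigma>0$ and all $\phi_0,\phi_1\in L^1\cap H^1(\mathbb R)$, real-valued, such that: $\phi_0(0)=\hat\phi_1(0)=1$; $\phi_0$ is $\mathcal C^\infty$ and positive, nondecreasing on $(-\infty,-1)$, nonincreasing on $(1,\infty)$ and identically $1$ on $[-1,1]$; $1/\phi_0$ and each of its derivatives have at most polynomial growth; $\hat\phi_1$ has no zero and $1/\hat\phi_1$ has at most polynomial growth. For $T>0$ and $x_0\in\mathbb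 R$ with $x_0+\gamma T\ge0$, and $l_c>0$, take the kernel $$\Phi^{l_c}_{L_0}(x,x')=\sigma\,\phi_0\Big(\frac{x}{L_0}\Big)\frac1{l_c}\phi_1\Big(\frac{x-x'}{l_c}\Big),\qquad L_0=\gamma T+x_0+C_0,$$ and let $\mathcal J(A)$ be the resulting cost. Write $\mathcal J(A)\overset{l_c\to0}{=}\Theta(r)$ with constants $C_1,C_2>0$ if $C_1r\le\mathcal J(A)\le C_2r$ for all sufficiently small $l_c>0$ (how small may depend on $x_0$ and $T$). Then, always for $x_0+\gamma T\ge0$: 1. for every $T>0$ there are $\delta,C_1,C_2>0$ such that $\mathcal J(A)\overset{l_c\to0}{=}\Theta(x_0^2)$ with constants $C_1,C_2$ for all $|x_0|<\delta$; 2. there are $\delta,\tau,C_1,C_2>0$ such that $\mathcal J(A)\overset{l_c\to0}{=}\Theta(x_0^2/T)$ with constants $C_1,C_2$ for all $|x_0|<\delta$ and $0<T<\tau$; 3. for every $T>0$ there are $R,C_1,C_2>0$ such that $\mathcal J(A)\overset{l_c\to0}{=}\Theta(|x_0|)$ with constants $C_1,C_2$ for all $|x_0|>R$; 4. there are $R,\tau,C_1,C_2>0$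 such that $\mathcal J(A)\overset{l_c\to0}{=}\Theta(|x_0|/T)$ with constants $C_1,C_2$ for all $|x_0|>R$ and $0<T<\tau$; 5. for every $x_0\ne0$ there are $\tau,C_1,C_2>0$ such that $\mathcal J(A)\overset{l_c\to0}{=}\Theta(1/T)$ with constants $C_1,C_2$ for all $0<T<\tau$. -/

import Mathlib

open MeasureTheory Set Filter Topology FourierTransform
open scoped ENNReal ContDiff

noncomputable section

namespace WaveDisplacement

/-! ### Flux and travelling wave -/

/-- The Rankine–Hugoniot wave speed `γ`; `uM`, `uP` are the states at `-∞`, `+∞`. -/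
def waveSpeed (F : ℝ → ℝ) (uM uP : ℝ) : ℝ := (F uP - F uM) / (uP - uM)

/-- Conditions on the flux: `F` is `C²` on `ℝ` with bounded first and second derivative, smooth
near every point of the closed interval between the two end states, and satisfies the Oleinik and
Lax entropy conditions.  The factor `uP - uM` in the Oleinik condition gives the sign that is
needed in each of the two cases `uM < uP` and `uP < uM`; for `uM < uP` the condition says
`F u - F uM > γ (u - uM)` for all `u` strictly between the two states. -/
structure IsAdmissibleFlux (F : ℝ → ℝ) (uM uP : ℝ) : Prop where
  contDiff : ContDiff ℝ 2 F
  bounded : ∃ C : ℝ, ∀ u, |deriv F u| ≤ C ∧ |deriv (deriv F) u| ≤ C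
  smooth : ∀ u ∈ uIcc uM uP, ContDiffAt ℝ ∞ F u
  ne : uM ≠ uP
  oleinik : ∀ u ∈ uIoo uM uP,
    0 < (uP - uM) * (F u - F uM - waveSpeed F uM uP * (u - uM))
  lax_right : deriv F uP < waveSpeed F uM uP
  lax_left : waveSpeed F uM uP < deriv F uM

/-- `U` is a travelling wave profile of `u_t + F(u)_x = (D u_x)_x` joining `uM` to `uP`. -/
structure IsWaveProfile (D : ℝ) (F : ℝ → ℝ) (uM uP : ℝ) (U : ℝ → ℝ) : Prop where
  ode : ∀ x, HasDerivAt U ((F (U x) - F uM - waveSpeed F uM uP * (U x - uM)) / D) x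
  tendsto_left : Tendsto U atBot (𝓝 uM)
  tendsto_right : Tendsto U atTop (𝓝 uP)

/-! ### Weak derivatives, `H¹(ℝ)` and the path space -/

/-- `g` is the weak (distributional) derivative of `f` on `ℝ`. -/
structure HasWeakDeriv (f g : ℝ → ℝ) : Prop where
  locallyIntegrable : LocallyIntegrable f
  locallyIntegrable_deriv : LocallyIntegrable g
  integral_eq : ∀ φ : ℝ → ℝ, ContDiff ℝ ∞ φ → HasCompactSupport φ →
    ∫ x, f x * deriv φ x = -∫ x, g x * φ x

/-- Membership in the Sobolev space `H¹(ℝ)`. -/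
def MemH1 (f : ℝ → ℝ) : Prop :=
  MemLp f 2 ∧ ∃ g : ℝ → ℝ, MemLp g 2 ∧ HasWeakDeriv f g

/-- The path space `𝓔¹`: the paths `u(t,x)` with `u - U ∈ C([0,T], H¹(ℝ))`.  Here `z t` is the weak
`x`-derivative of `u(t,·) - U`, and continuity is continuity of `u(t,·) - U` and of its weak
derivative in `L²(ℝ)`.  Only the times `t ∈ [0,T]` matter. -/
def PathSpace (U : ℝ → ℝ) (T : ℝ) : Set (ℝ → ℝ → ℝ) :=
  {u | ∃ z : ℝ → ℝ → ℝ,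
    (∀ t ∈ Icc 0 T, MemLp (fun x => u t x - U x) 2 ∧ MemLp (z t) 2 ∧
      HasWeakDeriv (fun x => u t x - U x) (z t)) ∧
    ∀ t ∈ Icc 0 T, Tendsto
      (fun s => eLpNorm (fun x => u s x - u t x) 2 volume
        + eLpNorm (fun x => z s x - z t x) 2 volume) (𝓝[Icc 0 T] t) (𝓝 0)}

/-! ### The control problem and the rate function -/

/-- The heat kernel of `∂_t - D ∂_x²`. -/
def heatKernel (D t x : ℝ) : ℝ :=
  1 / Real.sqrt (4 * Real.pi * D * t) * Real.exp (-x ^ 2 / (4 * D * t))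

/-- The heat semigroup `S(t)`, for `t > 0`. -/
def heatSemigroup (D t : ℝ) (f : ℝ → ℝ) (x : ℝ) : ℝ := ∫ y, heatKernel D t (x - y) * f y

/-- The integral operator with kernel `K`. -/
def kernelOp (K : ℝ → ℝ → ℝ) (f : ℝ → ℝ) (x : ℝ) : ℝ := ∫ x', K x x' * f x'

/-- The controls: `h ∈ L²([0,T], L²(ℝ))`. -/
def IsControl (T : ℝ) (h : ℝ → ℝ → ℝ) : Prop :=
  MemLp (Function.uncurry h) 2 ((volume.restrict (Icc 0 T)).prod volume)

/-- `u` is a mild solution on `[0,T]` of `u_t + F(u)_x = (D u_x)_x + Φ h`, `u(0,·) = U`, that is,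
`u(t) = S(t) U - ∫₀ᵗ S(t-s) N(u(s)) ds + ∫₀ᵗ S(t-s) Φ h(s) ds`, where `N(u) = F(u)_x`. -/
def IsMildSolution (D : ℝ) (F U : ℝ → ℝ) (Φ : ℝ → ℝ → ℝ) (T : ℝ) (h u : ℝ → ℝ → ℝ) : Prop :=
  u 0 =ᵐ[volume] U ∧
  ∃ N : ℝ → ℝ → ℝ, (∀ t ∈ Icc 0 T, HasWeakDeriv (fun x => F (u t x)) (N t)) ∧
    ∀ t ∈ Ioc 0 T, ∀ᵐ x : ℝ, u t x = heatSemigroup D t U x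
      - (∫ s in (0 : ℝ)..t, heatSemigroup D (t - s) (N s) x)
      + ∫ s in (0 : ℝ)..t, heatSemigroup D (t - s) (kernelOp Φ (h s)) x

/-- The rate function `I(u) = inf { ½ ∫₀ᵀ ‖h(t,·)‖²_{L²} dt : u = 𝓗[h] }`, with `inf ∅ = ∞`. -/
def rateFunction (D : ℝ) (F U : ℝ → ℝ) (Φ : ℝ → ℝ → ℝ) (T : ℝ) (u : ℝ → ℝ → ℝ) : ℝ≥0∞ :=
  ⨅ (h : ℝ → ℝ → ℝ) (_ : IsControl T h ∧ IsMildSolution D F U Φ T h u),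
    (1 / 2) * ∫⁻ t in Icc 0 T, ∫⁻ x, ENNReal.ofReal (h t x ^ 2)

/-- The event `A`: paths in `𝓔¹` from `U` to the profile displaced by `x₀` at time `T`. -/
def displacementEvent (U : ℝ → ℝ) (γ T x₀ : ℝ) : Set (ℝ → ℝ → ℝ) :=
  {u | u ∈ PathSpace U T ∧ u 0 =ᵐ[volume] U ∧ u T =ᵐ[volume] fun x => U (x - γ * T - x₀)}

/-- The cost `𝓙(A) = inf_{u ∈ A} I(u)` of the displacement event. -/
def displacementCost (D : ℝ) (F : ℝ → ℝ) (uM uP : ℝ) (U : ℝ → ℝ) (Φ : ℝ → ℝ → ℝ)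
    (T x₀ : ℝ) : ℝ≥0∞ :=
  ⨅ u ∈ displacementEvent U (waveSpeed F uM uP) T x₀, rateFunction D F U Φ T u

/-! ### The noise kernel -/

/-- The kernel `Φ(x,x') = σ φ₀(x/L₀) (1/l_c) φ₁((x-x')/l_c)`. -/
def noiseKernel (σ : ℝ) (φ₀ φ₁ : ℝ → ℝ) (L₀ lc : ℝ) (x x' : ℝ) : ℝ :=
  σ * φ₀ (x / L₀) * (1 / lc * φ₁ ((x - x') / lc))

/-- The assumptions on the two functions `φ₀`, `φ₁` that make up the noise kernel.
Mathlib's Fourier transform is `𝓕 f ξ = ∫ f x e^{-2πi x ξ} dx`; the conditions on it below do not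
depend on this choice of the frequency variable.  `Function.HasTemperateGrowth` means smooth, with
the function and all its derivatives bounded by polynomials. -/
structure IsNoiseProfile (φ₀ φ₁ : ℝ → ℝ) : Prop where
  integrable₀ : Integrable φ₀
  memH1₀ : MemH1 φ₀
  integrable₁ : Integrable φ₁
  memH1₁ : MemH1 φ₁
  φ₀_zero : φ₀ 0 = 1
  fourier_φ₁_zero : 𝓕 (fun x => (φ₁ x : ℂ)) (0 : ℝ) = 1
  smooth₀ : ContDiff ℝ ∞ φ₀
  pos₀ : ∀ x, 0 < φ₀ x
  fourier_φ₁_ne_zero : ∀ ξ : ℝ, 𝓕 (fun x => (φ₁ x : ℂ)) ξ ≠ 0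
  growth₀ : Function.HasTemperateGrowth (fun x => (φ₀ x)⁻¹)
  growth₁ : ∃ (C : ℝ) (k : ℕ), ∀ ξ : ℝ, ‖𝓕 (fun x => (φ₁ x : ℂ)) ξ‖⁻¹ ≤ C * (1 + |ξ|) ^ k
  mono₀ : MonotoneOn φ₀ (Iio (-1))
  anti₀ : AntitoneOn φ₀ (Ioi 1)
  one₀ : ∀ x ∈ Icc (-1 : ℝ) 1, φ₀ x = 1

/-- `C₁ r ≤ J ≤ C₂ r` as `l_c → 0⁺`. -/
def BoundedAsymp (C₁ C₂ r : ℝ) (J : ℝ → ℝ≥0∞) : Prop :=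
  ∀ᶠ lc in 𝓝[>] (0 : ℝ), ENNReal.ofReal (C₁ * r) ≤ J lc ∧ J lc ≤ ENNReal.ofReal (C₂ * r)

end WaveDisplacement

end

noncomputable section

namespace WaveDisplacement

/-! ### Weak derivatives on the line -/

/-! Both bounds compare the cost with explicit quantities in `x₀`, `T` and `L₀`; the five regimes
are then elementary algebra.

Lower bound. Mass is conserved up to the noise. Integrate the mild equation at time `T` over `[-R,
R]` and let `R → ∞`. Replacing `S(T)U` by the translate of `U` through `γT + x₀` contributes `-(γT +
x₀)(uP - uM)`, the flux contributes `T(F(uP) - F(uM)) = γT(uP - uM)`, so the control must inject the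
mass `-x₀(uP - uM)` (`mass_le_of_isMildSolution`). By Young's inequality and the mass bound for the
heat kernel, a control of squared norm `H` injects at most `‖φ₁‖₁ σ (T L₀ ∫φ₀²)^(1/2) H^(1/2)`; the
rescaling by `l_c` preserves the `L¹` norm. Hence the cost is at least `c x₀² / (T L₀)` for every
`l_c > 0` (`exists_le_displacementCost`).

Upper bound. Take the path that interpolates linearly in time, in the moving frame, between the wave
and its translate. Each of the two waves solves the unforced equation, so the forcing required is
bounded by `(1/T + K)|U(y - x₀) - U(y)|` with `y = x - γt`. It decays exponentially with all its
derivatives, hence can be divided by `σ φ₀(x/L₀)`, whose inverse grows polynomially, and then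
deconvolved: on the Fourier side divide by `φ̂₁(l_c ξ)`, which tends to `1`. By Plancherel and
dominated convergence the energy of the control tends to that of the divided forcing as `l_c → 0`
(`exists_control_of_forcing`). That limit is at most a constant times `x₀²/T` for bounded `x₀`, and
times `x₀/T` for large `x₀`, since the two profiles differ essentially on an interval of length `x₀`
(`exists_energy_le_of_bounded`, `exists_energy_le_of_large`).

The bounds match because `L₀ = γT + x₀ + 1` stays between positive constants when `x₀` and `T` are
bounded, and is at most `2x₀` when `|x₀|` is large; the condition `x₀ + γT ≥ 0` then forces `x₀ >
0`. -/

theorem _root_.MeasureTheory.LocallyIntegrable.intervalIntegrable' {g : ℝ → ℝ}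
    (hg : LocallyIntegrable g) (a b : ℝ) : IntervalIntegrable g volume a b :=
  intervalIntegrable_iff.mpr <|
    (hg.integrableOn_isCompact isCompact_uIcc).mono_set uIoc_subset_uIcc

theorem exists_tsupport_subset_Icc {φ : ℝ → ℝ} (hs : HasCompactSupport φ) :
    ∃ R : ℝ, 0 < R ∧ ∀ x, x ∉ Ioo (-R) R → φ x = 0 ∧ deriv φ x = 0 := by
  obtain ⟨R, hR⟩ := hs.isCompact.isBounded.subset_ball 0
  refine ⟨max R 1, by positivity, fun x hx => ?_⟩
  have hx' : x ∉ tsupport φ := fun h => by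
    have := hR h
    rw [Real.ball_eq_Ioo] at this
    apply hx
    constructor <;> [have := this.1; have := this.2] <;>
      have := le_max_left R 1 <;> linarith
  refine ⟨image_eq_zero_of_notMem_tsupport hx', ?_⟩
  by_contra h
  exact hx' (support_deriv_subset h)

/-- The primitive of a locally integrable function is absolutely continuous with derivative `g`
a.e., so integration by parts holds on an interval containing the support of `φ`. -/
theorem integral_primitive_mul_deriv {g : ℝ → ℝ} (hg : LocallyIntegrable g) {φ : ℝ → ℝ}
    (hφ : ContDiff ℝ ∞ φ) (hs : HasCompactSupport φ) :
    ∫ x, (∫ y in (0 : ℝ)..x, g y) * deriv φ x = -∫ x, g x * φ x := by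
  obtain ⟨R, hR, h0⟩ := exists_tsupport_subset_Icc hs
  have hRR : -R ≤ R := by linarith
  have key : ∀ {ψ : ℝ → ℝ}, (∀ x, x ∉ Ioo (-R) R → ψ x = 0) →
      ∫ x, ψ x = ∫ x in (-R)..R, ψ x := by
    intro ψ h
    rw [intervalIntegral.integral_of_le hRR]
    refine (setIntegral_eq_integral_of_forall_compl_eq_zero fun x hx => h x fun h' => hx ?_).symm
    exact ⟨h'.1, h'.2.le⟩
  have hac : AbsolutelyContinuousOnInterval (fun x => ∫ y in (0 : ℝ)..x, g y) (-R) R :=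
    (hg.intervalIntegrable' _ _).absolutelyContinuousOnInterval_intervalIntegral
      (by rw [uIcc_of_le hRR]; constructor <;> linarith)
  have hφac : AbsolutelyContinuousOnInterval φ (-R) R := by
    have : ∀ x, φ x = (∫ y in (-R)..x, deriv φ y) := fun x => by
      rw [intervalIntegral.integral_deriv_eq_sub (fun y _ => (hφ.differentiable (by simp)) y)
        ((hφ.continuous_deriv (by simp)).intervalIntegrable _ _), (h0 (-R) (by simp)).1, sub_zero]
    rw [funext this]
    exact ((hφ.continuous_deriv (by simp)).intervalIntegrable _ _
      ).absolutelyContinuousOnInterval_intervalIntegral (by simp)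
  rw [key (fun x hx => by rw [(h0 x hx).2, mul_zero]),
    key (ψ := fun x => g x * φ x) (fun x hx => by rw [(h0 x hx).1, mul_zero]),
    hac.integral_mul_deriv_eq_deriv_mul hφac, (h0 R (by simp)).1, (h0 (-R) (by simp)).1]
  simp only [mul_zero, sub_self, zero_sub, neg_inj]
  refine intervalIntegral.integral_congr_ae ?_
  filter_upwards [_root_.LocallyIntegrable.ae_hasDerivAt_integral hg] with x hx _
  rw [(hx 0).deriv]

theorem continuous_primitive' {g : ℝ → ℝ} (hg : LocallyIntegrable g) :
    Continuous fun x => ∫ y in (0 : ℝ)..x, g y :=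
  intervalIntegral.continuous_primitive (fun a b => hg.intervalIntegrable' a b) 0

/-- The du Bois-Reymond lemma. Subtracting from a test function `η` the multiple `(∫ η) ρ` of a
normalised bump leaves a function of zero integral, which is the derivative of a test function; so
`f` pairs with `η` as the constant `∫ f ρ` does. -/
theorem ae_eq_const_of_integral_mul_deriv {f : ℝ → ℝ} (hf : LocallyIntegrable f)
    (h : ∀ φ : ℝ → ℝ, ContDiff ℝ ∞ φ → HasCompactSupport φ → ∫ x, f x * deriv φ x = 0) :
    ∃ c, ∀ᵐ x, f x = c := by
  obtain ⟨ψ⟩ : Nonempty (ContDiffBump (0 : ℝ)) := inferInstance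
  set ρ : ℝ → ℝ := ψ.normed volume with hρ
  have hρs : ContDiff ℝ ∞ ρ := ψ.contDiff_normed
  have hρc : HasCompactSupport ρ := ψ.hasCompactSupport_normed
  have hρ1 : ∫ x, ρ x = 1 := ψ.integral_normed
  refine ⟨∫ x, f x * ρ x, ?_⟩
  set c := ∫ x, f x * ρ x
  refine ae_eq_of_integral_contDiff_smul_eq hf (locallyIntegrable_const c) fun η hη hηs => ?_
  set m := ∫ x, η x
  set χ : ℝ → ℝ := fun x => η x - m * ρ x with hχ
  have hχs : ContDiff ℝ ∞ χ := hη.sub (contDiff_const.mul hρs)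
  have hχc : HasCompactSupport χ := hηs.sub (hρc.mul_left (f := fun _ => m))
  have hηi : Integrable η := hη.continuous.integrable_of_hasCompactSupport hηs
  have hρi : Integrable ρ := hρs.continuous.integrable_of_hasCompactSupport hρc
  have hχ0 : ∫ x, χ x = 0 := by
    simp only [hχ]
    rw [integral_sub hηi (hρi.const_mul m), integral_const_mul, hρ1]
    simp [m]
  obtain ⟨R, hR, h0⟩ := exists_tsupport_subset_Icc hχc
  -- This primitive vanishes to the left of the support of `χ` by the choice of base point, and to
  -- the right because `χ` has zero integral.
  set φ : ℝ → ℝ := fun x => ∫ y in (-R)..x, χ y with hφ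
  have hφd : ∀ x, HasDerivAt φ (χ x) x := fun x =>
    intervalIntegral.integral_hasDerivAt_right (hχs.continuous.intervalIntegrable _ _)
      (hχs.continuous.stronglyMeasurableAtFilter _ _) hχs.continuous.continuousAt
  have hφ' : deriv φ = χ := funext fun x => (hφd x).deriv
  have hφs : ContDiff ℝ ∞ φ := contDiff_infty_iff_deriv.2
    ⟨fun x => (hφd x).differentiableAt, by rw [hφ']; exact hχs⟩
  have hφc : HasCompactSupport φ := by
    refine HasCompactSupport.intro (isCompact_Icc (a := -R) (b := R)) fun x hx => ?_
    rw [mem_Icc, not_and_or, not_le, not_le] at hx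
    rcases hx with hx | hx
    · simp only [hφ]
      rw [intervalIntegral.integral_symm, neg_eq_zero]
      refine intervalIntegral.integral_zero_ae (.of_forall fun y hy => (h0 y ?_).1)
      rw [uIoc_of_le hx.le] at hy
      exact fun h => absurd hy.2 (not_le.2 h.1)
    · have : φ x = ∫ y, χ y := by
        simp only [hφ]
        rw [intervalIntegral.integral_of_le (by linarith)]
        refine setIntegral_eq_integral_of_forall_compl_eq_zero fun y hy => (h0 y fun h => hy ?_).1
        exact ⟨h.1, by linarith [h.2]⟩
      rw [this, hχ0]
  have hfη : Integrable fun x => f x * η x := by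
    simpa [smul_eq_mul, mul_comm] using
      hf.integrable_smul_left_of_hasCompactSupport hη.continuous hηs
  have hfρ : Integrable fun x => f x * ρ x := by
    simpa [smul_eq_mul, mul_comm] using
      hf.integrable_smul_left_of_hasCompactSupport hρs.continuous hρc
  have := h φ hφs hφc
  rw [hφ'] at this
  have e : ∀ x, f x * χ x = f x * η x - m * (f x * ρ x) := fun x => by simp only [hχ]; ring
  simp only [e] at this
  rw [integral_sub hfη (hfρ.const_mul m), integral_const_mul, sub_eq_zero] at this
  simp only [smul_eq_mul]
  rw [integral_mul_const]
  simpa [mul_comm, m, c] using this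

theorem HasWeakDeriv.exists_ae_eq_primitive {f g : ℝ → ℝ} (h : HasWeakDeriv f g) :
    ∃ c, ∀ᵐ x, f x = c + ∫ y in (0 : ℝ)..x, g y := by
  have hG := continuous_primitive' h.locallyIntegrable_deriv
  obtain ⟨c, hc⟩ := ae_eq_const_of_integral_mul_deriv
    (f := fun x => f x - ∫ y in (0 : ℝ)..x, g y)
    (h.locallyIntegrable.sub hG.locallyIntegrable) (fun φ hφ hs => by
      have hd : Continuous (deriv φ) := hφ.continuous_deriv (by simp)
      have h1 : Integrable fun x => f x * deriv φ x := by
        simpa [smul_eq_mul, mul_comm] using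
          h.locallyIntegrable.integrable_smul_left_of_hasCompactSupport hd hs.deriv
      have h2 : Integrable fun x => (∫ y in (0 : ℝ)..x, g y) * deriv φ x :=
        (hG.mul hd).integrable_of_hasCompactSupport hs.deriv.mul_left
      simp only [sub_mul]
      rw [integral_sub h1 h2, h.integral_eq φ hφ hs,
        integral_primitive_mul_deriv h.locallyIntegrable_deriv hφ hs, sub_self])
  exact ⟨c, hc.mono fun x hx => by linarith⟩

/-- A `C¹` function has its classical derivative as weak derivative. -/
theorem HasWeakDeriv.of_hasDerivAt {f g : ℝ → ℝ} (h : ∀ x, HasDerivAt f (g x) x)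
    (hg : Continuous g) : HasWeakDeriv f g where
  locallyIntegrable :=
    (continuous_iff_continuousAt.2 fun x => (h x).continuousAt).locallyIntegrable
  locallyIntegrable_deriv := hg.locallyIntegrable
  integral_eq φ hφ hs := by
    have hf : Continuous f := continuous_iff_continuousAt.2 fun x => (h x).continuousAt
    refine integral_mul_deriv_eq_deriv_mul_of_integrable (fun x _ => h x)
      (fun x _ => ((hφ.differentiable (by simp)) x).hasDerivAt) ?_ ?_ ?_
    · exact (hf.mul (hφ.continuous_deriv (by simp))).integrable_of_hasCompactSupport
        hs.deriv.mul_left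
    · exact (hg.mul hφ.continuous).integrable_of_hasCompactSupport hs.mul_left
    · exact (hf.mul hφ.continuous).integrable_of_hasCompactSupport hs.mul_left

/-! ### Continuous representatives of `H¹` functions -/

theorem integral_sq_eq_toReal_eLpNorm {f : ℝ → ℝ} (hf : MemLp f 2) :
    ∫ x, f x ^ 2 = (eLpNorm f 2 volume).toReal ^ 2 := by
  have h := hf.eLpNorm_eq_integral_rpow_norm two_ne_zero ENNReal.ofNat_ne_top
  have h0 : 0 ≤ ∫ x, f x ^ 2 := integral_nonneg fun x => sq_nonneg _
  have e : ∫ a, ‖f a‖ ^ (ENNReal.toReal 2) = ∫ x, f x ^ 2 :=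
    integral_congr_ae (.of_forall fun x => by simp)
  rw [e] at h
  rw [h, ENNReal.toReal_ofReal (by positivity), ENNReal.toReal_ofNat,
    ← Real.rpow_natCast, ← Real.rpow_mul h0]
  norm_num

/-- Cauchy–Schwarz on an interval of length one, read off from `∫ (|z| - a)² ≥ 0` with `a` the mean
of `|z|`. -/
theorem sq_integral_abs_le {z : ℝ → ℝ} {x : ℝ} (hz : LocallyIntegrable z)
    (hz2 : Integrable fun y => z y ^ 2) :
    (∫ y in x..x + 1, |z y|) ^ 2 ≤ ∫ y in x..x + 1, z y ^ 2 := by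
  set a := ∫ y in x..x + 1, |z y|
  have hi := (hz.intervalIntegrable' x (x + 1)).abs
  have h : 0 ≤ ∫ y in x..x + 1, (z y ^ 2 - 2 * a * |z y| + a ^ 2) :=
    intervalIntegral.integral_nonneg (by linarith) fun y _ => by
      nlinarith [sq_nonneg (|z y| - a), sq_abs (z y)]
  rw [intervalIntegral.integral_add (hz2.intervalIntegrable.sub (hi.const_mul _)) (by simp),
    intervalIntegral.integral_sub hz2.intervalIntegrable (hi.const_mul _),
    intervalIntegral.integral_const_mul, intervalIntegral.integral_const] at h
  simp only [add_sub_cancel_left, smul_eq_mul, one_mul] at h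
  nlinarith

/-- A local Sobolev inequality: average `v(x) = v(y) - ∫ z` over `y` in the unit interval to the
right of `x`. Keeping the right side local yields decay at infinity as well as a sup bound. -/
theorem sq_le_integral_of_primitive {v z : ℝ → ℝ} (hv : Continuous v) (hz : LocallyIntegrable z)
    (hz2 : Integrable fun y => z y ^ 2) (hvz : ∀ x y, v y - v x = ∫ r in x..y, z r) (x : ℝ) :
    v x ^ 2 ≤ ∫ y in x..x + 1, (2 * v y ^ 2 + 2 * z y ^ 2) := by
  have hv2 : Continuous fun y => v y ^ 2 := hv.pow 2
  have h1 : ∀ y ∈ Icc x (x + 1), v x ^ 2 - 2 * ∫ r in x..x + 1, z r ^ 2 ≤ 2 * v y ^ 2 := by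
    intro y hy
    have h2 : |∫ r in x..y, z r| ≤ ∫ r in x..x + 1, |z r| :=
      (intervalIntegral.abs_integral_le_integral_abs hy.1).trans <|
        intervalIntegral.integral_mono_interval le_rfl hy.1 hy.2
          (.of_forall fun _ => abs_nonneg _) (hz.intervalIntegrable' _ _).abs
    have h3 := sq_integral_abs_le (x := x) hz hz2
    have h4 := hvz x y
    have h5 : (∫ r in x..y, z r) ^ 2 ≤ (∫ r in x..x + 1, |z r|) ^ 2 := sq_le_sq' (by
      linarith [neg_le_of_abs_le h2]) (le_of_abs_le h2)
    have h6 : v x = v y - ∫ r in x..y, z r := by linarith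
    rw [h6]
    nlinarith [sq_nonneg (v y + ∫ r in x..y, z r)]
  have h2 := intervalIntegral.integral_mono_on (by linarith : x ≤ x + 1)
    (by simp) ((hv2.const_mul 2).intervalIntegrable _ _) h1 (μ := volume)
  rw [intervalIntegral.integral_add ((hv2.const_mul 2).intervalIntegrable _ _)
    (hz2.intervalIntegrable.const_mul _), intervalIntegral.integral_const_mul 2 fun y => z y ^ 2]
  simp only [intervalIntegral.integral_const, add_sub_cancel_left, smul_eq_mul, one_mul] at h2
  linarith

theorem tendsto_integral_unit_interval {f : ℝ → ℝ} (hf : Integrable f) :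
    Tendsto (fun x => ∫ y in x..x + 1, f y) atTop (𝓝 0) ∧
      Tendsto (fun x => ∫ y in x..x + 1, f y) atBot (𝓝 0) := by
  have e : ∀ x, ∫ y in x..x + 1, f y = (∫ y in (0 : ℝ)..x + 1, f y) - ∫ y in (0 : ℝ)..x, f y :=
    fun x => (intervalIntegral.integral_interval_sub_left hf.intervalIntegrable
      hf.intervalIntegrable).symm
  have h1 := intervalIntegral_tendsto_integral_Ioi 0 hf.integrableOn tendsto_id
  have h1' := intervalIntegral_tendsto_integral_Ioi 0 hf.integrableOn
    (tendsto_atTop_add_const_right atTop (1 : ℝ) tendsto_id)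
  have h2 := (intervalIntegral_tendsto_integral_Iic 0 hf.integrableOn tendsto_id).neg
  have h2' := (intervalIntegral_tendsto_integral_Iic 0 hf.integrableOn
    (tendsto_atBot_add_const_right atBot (1 : ℝ) tendsto_id)).neg
  simp only [← intervalIntegral.integral_symm, id] at h1 h1' h2 h2'
  simp only [e]
  exact ⟨by simpa using h1'.sub h1, by simpa using h2'.sub h2⟩

/-- A continuous representative of an `H¹` function, with its basic properties. -/
theorem HasWeakDeriv.exists_continuous_rep {w z : ℝ → ℝ} (hw : MemLp w 2) (hz : MemLp z 2)
    (h : HasWeakDeriv w z) :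
    ∃ v : ℝ → ℝ, Continuous v ∧ w =ᵐ[volume] v ∧ (∀ᵐ x, HasDerivAt v (z x) x) ∧
      (∀ x y, v y - v x = ∫ r in x..y, z r) ∧
      Tendsto v atTop (𝓝 0) ∧ Tendsto v atBot (𝓝 0) := by
  obtain ⟨c, hc⟩ := h.exists_ae_eq_primitive
  have hzl := h.locallyIntegrable_deriv
  have hG := continuous_primitive' hzl
  set v : ℝ → ℝ := fun x => c + ∫ y in (0 : ℝ)..x, z y with hv
  have hvc : Continuous v := continuous_const.add hG
  have hvz : ∀ x y, v y - v x = ∫ r in x..y, z r := fun x y => by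
    simp only [hv, add_sub_add_left_eq_sub]
    exact intervalIntegral.integral_interval_sub_left (hzl.intervalIntegrable' _ _)
      (hzl.intervalIntegrable' _ _)
  have hv2 : Integrable fun y => v y ^ 2 :=
    hw.integrable_sq.congr (hc.mono fun x hx => by simp only [hx, hv])
  have hi : Integrable fun y => 2 * v y ^ 2 + 2 * z y ^ 2 :=
    (hv2.const_mul 2).add (hz.integrable_sq.const_mul 2)
  have hb := sq_le_integral_of_primitive hvc hzl hz.integrable_sq hvz
  have ht := tendsto_integral_unit_interval hi
  have key : ∀ l : Filter ℝ, Tendsto (fun x => ∫ y in x..x + 1, (2 * v y ^ 2 + 2 * z y ^ 2)) l (𝓝 0) →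
      Tendsto v l (𝓝 0) := fun l hl => by
    have h0 : Tendsto (fun x => v x ^ 2) l (𝓝 0) :=
      squeeze_zero (fun _ => sq_nonneg _) hb hl
    have := h0.sqrt
    simp only [Real.sqrt_sq_eq_abs, Real.sqrt_zero] at this
    exact (tendsto_zero_iff_abs_tendsto_zero v).2 this
  refine ⟨v, hvc, hc, ?_, hvz, key _ ht.1, key _ ht.2⟩
  filter_upwards [_root_.LocallyIntegrable.ae_hasDerivAt_integral hzl] with x hx
  exact (hx 0).const_add c

/-- The embedding of `H¹` into bounded functions. Applied to differences of two times, it turns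
continuity in `H¹` into continuity in time uniformly in `x`. -/
theorem abs_le_eLpNorm_of_primitive {w v z : ℝ → ℝ} (hw : MemLp w 2) (hz : MemLp z 2)
    (hzl : LocallyIntegrable z) (hv : Continuous v) (hwv : w =ᵐ[volume] v)
    (hvz : ∀ x y, v y - v x = ∫ r in x..y, z r) (x : ℝ) :
    |v x| ≤ 2 * ((eLpNorm w 2 volume).toReal + (eLpNorm z 2 volume).toReal) := by
  have hv2 : Integrable fun y => v y ^ 2 :=
    hw.integrable_sq.congr (hwv.mono fun x hx => by simp only [hx])
  have hi : Integrable fun y => 2 * v y ^ 2 + 2 * z y ^ 2 :=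
    (hv2.const_mul 2).add (hz.integrable_sq.const_mul 2)
  have h1 := sq_le_integral_of_primitive hv hzl hz.integrable_sq hvz x
  have h2 : ∫ y in x..x + 1, (2 * v y ^ 2 + 2 * z y ^ 2) ≤ ∫ y, (2 * v y ^ 2 + 2 * z y ^ 2) := by
    rw [intervalIntegral.integral_of_le (by linarith)]
    exact setIntegral_le_integral hi (.of_forall fun y => by positivity)
  rw [integral_add (hv2.const_mul 2) (hz.integrable_sq.const_mul 2), integral_const_mul,
    integral_const_mul, integral_sq_eq_toReal_eLpNorm hz,
    integral_congr_ae (g := fun y => w y ^ 2) (hwv.mono fun x hx => by simp only [hx]),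
    integral_sq_eq_toReal_eLpNorm hw] at h2
  set a := (eLpNorm w 2 volume).toReal
  set b := (eLpNorm z 2 volume).toReal
  have ha : 0 ≤ a := ENNReal.toReal_nonneg
  have hb : 0 ≤ b := ENNReal.toReal_nonneg
  exact abs_le_of_sq_le_sq (by nlinarith) (by positivity)

theorem continuous_uncurry_of_dist_le {X : Type*} [TopologicalSpace X] {f : X → ℝ → ℝ}
    (hf : ∀ s, Continuous (f s)) {ρ : X → X → ℝ} (hρ : ∀ s, Tendsto (ρ s) (𝓝 s) (𝓝 0))
    (h : ∀ s t x, |f t x - f s x| ≤ ρ s t) : Continuous (Function.uncurry f) := by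
  refine continuous_iff_continuousAt.2 fun ⟨s, x⟩ => ?_
  rw [ContinuousAt, tendsto_iff_dist_tendsto_zero]
  have h1 : Tendsto (fun p : X × ℝ => ρ s p.1 + dist (f s p.2) (f s x)) (𝓝 (s, x)) (𝓝 (0 + 0)) := by
    refine ((hρ s).comp (continuous_fst.tendsto (s, x))).add ?_
    rw [← tendsto_iff_dist_tendsto_zero]
    exact ((hf s).comp continuous_snd).tendsto (s, x)
  rw [add_zero] at h1
  refine squeeze_zero (fun _ => dist_nonneg) (fun p => ?_) h1
  refine (dist_triangle _ (f s p.2) _).trans (add_le_add ?_ le_rfl)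
  exact h s p.1 p.2

/-- The continuous version of a path in `𝓔¹`, extended constantly in time beyond `[0,T]`. -/
theorem PathSpace.exists_continuous_rep {U : ℝ → ℝ} {T : ℝ} (hT : 0 ≤ T) {u : ℝ → ℝ → ℝ}
    (hu : u ∈ PathSpace U T) :
    ∃ v z : ℝ → ℝ → ℝ, Continuous (Function.uncurry v) ∧ (∃ C, ∀ s x, |v s x| ≤ C) ∧
      (∀ s, Tendsto (v s) atTop (𝓝 0) ∧ Tendsto (v s) atBot (𝓝 0)) ∧
      (∀ s ∈ Icc 0 T, (fun x => u s x - U x) =ᵐ[volume] v s ∧ MemLp (z s) 2 ∧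
        ∀ᵐ x, HasDerivAt (v s) (z s x) x) ∧
      ∃ C, ∀ s ∈ Icc 0 T, ∫ x, z s x ^ 2 ≤ C := by
  obtain ⟨z, hz, hcont⟩ := hu
  have hrep := fun s : Icc (0 : ℝ) T =>
    (hz s s.2).2.2.exists_continuous_rep (hz s s.2).1 (hz s s.2).2.1
  choose v hvc hwv hvd hvz hvt hvb using hrep
  set N : Icc (0 : ℝ) T → Icc (0 : ℝ) T → ℝ := fun s t =>
    (eLpNorm (fun x => u t x - u s x) 2 volume).toReal +
      (eLpNorm (fun x => z t x - z s x) 2 volume).toReal with hN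
  have hmem : ∀ s t : Icc (0 : ℝ) T, MemLp (fun x => u t x - u s x) 2 := fun s t => by
    have := (hz t t.2).1.sub (hz s s.2).1
    convert this using 1
    ext x
    simp
  have hmemz : ∀ s t : Icc (0 : ℝ) T, MemLp (fun x => z t x - z s x) 2 := fun s t =>
    (hz t t.2).2.1.sub (hz s s.2).2.1
  have hN0 : ∀ s, Tendsto (N s) (𝓝 s) (𝓝 0) := fun s => by
    have h1 := hcont s s.2
    have h2 : Tendsto (fun t : Icc (0 : ℝ) T => (t : ℝ)) (𝓝 s) (𝓝[Icc 0 T] s) :=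
      tendsto_nhdsWithin_iff.2 ⟨continuous_subtype_val.continuousAt, .of_forall fun t => t.2⟩
    have h3 := (ENNReal.tendsto_toReal ENNReal.zero_ne_top).comp (h1.comp h2)
    refine h3.congr fun t => ?_
    exact ENNReal.toReal_add (hmem s t).eLpNorm_ne_top (hmemz s t).eLpNorm_ne_top
  have hd : ∀ s t x, |v t x - v s x| ≤ 2 * N s t := fun s t x => by
    refine abs_le_eLpNorm_of_primitive (hmem s t) (hmemz s t)
      ((hz t t.2).2.2.locallyIntegrable_deriv.sub (hz s s.2).2.2.locallyIntegrable_deriv)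
      (v := fun x => v t x - v s x) ((hvc t).sub (hvc s)) ?_ ?_ x
    · filter_upwards [hwv t, hwv s] with x h1 h2
      rw [← h1, ← h2]; ring
    · intro x y
      rw [intervalIntegral.integral_sub
        ((hz t t.2).2.2.locallyIntegrable_deriv.intervalIntegrable' _ _)
        ((hz s s.2).2.2.locallyIntegrable_deriv.intervalIntegrable' _ _), ← hvz, ← hvz]
      ring
  have hvu : Continuous (Function.uncurry v) :=
    continuous_uncurry_of_dist_le hvc (fun s => by simpa using (hN0 s).const_mul 2) hd
  -- As continuous maps from a compact interval into `L²`, the path and its derivative have bounded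
  -- norms; this gives the uniform bounds in the conclusion.
  set V : Icc (0 : ℝ) T → Lp ℝ 2 (volume : Measure ℝ) := fun s => (hz s s.2).1.toLp
  set Z : Icc (0 : ℝ) T → Lp ℝ 2 (volume : Measure ℝ) := fun s => (hz s s.2).2.1.toLp
  have hVc : Continuous V := continuous_iff_continuousAt.2 fun s => by
    rw [ContinuousAt, tendsto_iff_dist_tendsto_zero]
    refine squeeze_zero (fun _ => dist_nonneg) (fun t => ?_) (hN0 s)
    rw [dist_edist, Lp.edist_toLp_toLp]
    refine le_trans (le_of_eq ?_) (le_add_of_nonneg_right ENNReal.toReal_nonneg)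
    congr 2
    ext x
    simp
  have hZc : Continuous Z := continuous_iff_continuousAt.2 fun s => by
    rw [ContinuousAt, tendsto_iff_dist_tendsto_zero]
    refine squeeze_zero (fun _ => dist_nonneg) (fun t => ?_) (hN0 s)
    rw [dist_edist, Lp.edist_toLp_toLp]
    exact le_add_of_nonneg_left ENNReal.toReal_nonneg
  obtain ⟨CV, hCV⟩ := isCompact_univ.exists_bound_of_continuousOn hVc.continuousOn
  obtain ⟨CZ, hCZ⟩ := isCompact_univ.exists_bound_of_continuousOn hZc.continuousOn
  simp only [V, Z, Lp.norm_toLp, mem_univ, true_imp_iff] at hCV hCZ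
  refine ⟨fun s => v (projIcc 0 T hT s), z, ?_, ⟨2 * (CV + CZ), fun s x => ?_⟩,
    fun s => ⟨hvt _, hvb _⟩, fun s hs => ?_, CZ ^ 2, fun s hs => ?_⟩
  · exact hvu.comp (f := fun p : ℝ × ℝ => (projIcc 0 T hT p.1, p.2))
      ((continuous_projIcc.comp continuous_fst).prodMk continuous_snd)
  · set s' := projIcc 0 T hT s
    refine (abs_le_eLpNorm_of_primitive (hz s' s'.2).1 (hz s' s'.2).2.1
      (hz s' s'.2).2.2.locallyIntegrable_deriv (hvc s') (hwv s') (hvz s') x).trans ?_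
    have := hCV s'
    have := hCZ s'
    linarith
  · beta_reduce
    rw [projIcc_of_mem hT hs]
    exact ⟨hwv ⟨s, hs⟩, (hz s hs).2.1, hvd ⟨s, hs⟩⟩
  · rw [integral_sq_eq_toReal_eLpNorm (hz s hs).2.1]
    exact pow_le_pow_left₀ ENNReal.toReal_nonneg (hCZ ⟨s, hs⟩) 2

/-! ### The heat kernel -/

section HeatKernel

variable {D t : ℝ}

theorem heatKernel_eq_gaussianPDFReal (hD : 0 < D) (ht : 0 < t) (x : ℝ) :
    heatKernel D t x = ProbabilityTheory.gaussianPDFReal 0 (2 * D * t).toNNReal x := by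
  rw [heatKernel, ProbabilityTheory.gaussianPDFReal, Real.coe_toNNReal _ (by positivity)]
  rw [one_div, sub_zero]
  congr 3 <;> ring

theorem heatKernel_nonneg (D t x : ℝ) : 0 ≤ heatKernel D t x := by
  rw [heatKernel]; positivity

theorem heatKernel_neg (D t x : ℝ) : heatKernel D t (-x) = heatKernel D t x := by
  simp [heatKernel]

theorem heatKernel_le (hD : 0 < D) (ht : 0 < t) (x : ℝ) :
    heatKernel D t x ≤ 1 / √(4 * Real.pi * D * t) := by
  rw [heatKernel]
  refine mul_le_of_le_one_right (by positivity) (Real.exp_le_one_iff.2 ?_)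
  rw [neg_div]
  exact neg_nonpos.2 (by positivity)

theorem measurable_heatKernel (D : ℝ) : Measurable fun p : ℝ × ℝ => heatKernel D p.1 p.2 := by
  unfold heatKernel; fun_prop

theorem continuous_heatKernel (D t : ℝ) : Continuous (heatKernel D t) := by
  unfold heatKernel; fun_prop

theorem integrable_heatKernel (hD : 0 < D) (ht : 0 < t) : Integrable (heatKernel D t) := by
  rw [funext (heatKernel_eq_gaussianPDFReal hD ht)]
  exact ProbabilityTheory.integrable_gaussianPDFReal _ _

theorem integral_heatKernel (hD : 0 < D) (ht : 0 < t) : ∫ x, heatKernel D t x = 1 := by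
  rw [funext (heatKernel_eq_gaussianPDFReal hD ht)]
  refine ProbabilityTheory.integral_gaussianPDFReal_eq_one _ ?_
  rw [Ne, Real.toNNReal_eq_zero, not_le]
  positivity

theorem integral_heatKernel_sub (hD : 0 < D) (ht : 0 < t) (x : ℝ) :
    ∫ y, heatKernel D t (x - y) = 1 := by
  rw [integral_sub_left_eq_self (heatKernel D t), integral_heatKernel hD ht]

theorem integrable_id_mul_heatKernel (hD : 0 < D) (ht : 0 < t) :
    Integrable fun y => y * heatKernel D t y := by
  have h := (integrable_mul_exp_neg_mul_sq (b := 1 / (4 * D * t)) (by positivity)).const_mul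
    (1 / √(4 * Real.pi * D * t))
  refine h.congr (.of_forall fun y => ?_)
  simp only [heatKernel]
  rw [show -y ^ 2 / (4 * D * t) = -(1 / (4 * D * t)) * y ^ 2 by ring]
  ring

theorem integral_id_mul_heatKernel (D t : ℝ) : ∫ y, y * heatKernel D t y = 0 := by
  have h := integral_neg_eq_self (fun y => y * heatKernel D t y) volume
  simp only [heatKernel_neg, neg_mul, integral_neg] at h
  linarith

theorem heatSemigroup_eq (D t : ℝ) (f : ℝ → ℝ) (x : ℝ) :
    heatSemigroup D t f x = ∫ y, heatKernel D t y * f (x - y) := by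
  rw [heatSemigroup, ← integral_sub_left_eq_self (fun y => heatKernel D t y * f (x - y)) volume x]
  simp

/-- Substituting `√t y` for `y` moves all time dependence from the kernel to the argument of `f`.
This form extends continuously to `t = 0` and avoids differentiating the kernel in time. -/
theorem heatSemigroup_eq_scaled (ht : 0 < t) (f : ℝ → ℝ) (x : ℝ) :
    heatSemigroup D t f x = ∫ y, heatKernel D 1 y * f (x - √t * y) := by
  have hs : 0 < √t := Real.sqrt_pos.2 ht
  have h := Measure.integral_comp_mul_left (fun y => heatKernel D t y * f (x - y)) √t
  rw [heatSemigroup_eq]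
  rw [abs_of_pos (inv_pos.2 hs), smul_eq_mul, inv_mul_eq_div, eq_div_iff hs.ne', mul_comm,
    ← integral_const_mul] at h
  rw [← h]
  refine integral_congr_ae (.of_forall fun y => ?_)
  simp only [heatKernel, mul_pow, Real.sq_sqrt ht.le, mul_one]
  rw [Real.sqrt_mul' (4 * Real.pi * D) ht.le,
    show -(t * y ^ 2) / (4 * D * t) = -y ^ 2 / (4 * D) by field_simp]
  field_simp

theorem hasDerivAt_heatKernel_one (hD : 0 < D) (y : ℝ) :
    HasDerivAt (heatKernel D 1) (-(y / (2 * D)) * heatKernel D 1 y) y := by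
  unfold heatKernel
  have h := (((hasDerivAt_id y).pow 2).neg.div_const (4 * D * 1)).exp.const_mul
    (1 / √(4 * Real.pi * D * 1))
  refine h.congr_deriv ?_
  field_simp
  norm_num [neg_div]
  ring

end HeatKernel

/-! ### Integrating the flux term over a large interval -/

section Flux

variable {D T C : ℝ}

/-- The bounded part is averaged by a probability kernel, and the `L¹` part is estimated by the
maximum of the kernel. The resulting `τ^(-1/2)` singularity is integrable in time, which justifies
Fubini for the flux term. -/
theorem abs_heatSemigroup_le {τ : ℝ} (hD : 0 < D) (hτ : 0 < τ) {n ζ : ℝ → ℝ}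
    (hζ : Integrable ζ) (hζ0 : ∀ y, 0 ≤ ζ y) (hn : ∀ y, |n y| ≤ C + ζ y) (x : ℝ) :
    |heatSemigroup D τ n x| ≤ C + 1 / √(4 * Real.pi * D * τ) * ∫ y, ζ y := by
  have hp := (integrable_heatKernel hD hτ).comp_sub_left x
  have h1 : Integrable fun y => heatKernel D τ (x - y) * ζ y :=
    hζ.bdd_mul (c := 1 / √(4 * Real.pi * D * τ))
      ((continuous_heatKernel D τ).comp (by fun_prop)).aestronglyMeasurable
      (.of_forall fun y => by
        rw [Real.norm_of_nonneg (heatKernel_nonneg _ _ _)]; exact heatKernel_le hD hτ _)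
  have h2 : Integrable fun y => C * heatKernel D τ (x - y) + heatKernel D τ (x - y) * ζ y :=
    (hp.const_mul C).add h1
  have h3 : ∫ y, heatKernel D τ (x - y) * ζ y ≤ ∫ y, 1 / √(4 * Real.pi * D * τ) * ζ y :=
    integral_mono h1 (hζ.const_mul _) fun y =>
      mul_le_mul_of_nonneg_right (heatKernel_le hD hτ _) (hζ0 y)
  have h4 : |heatSemigroup D τ n x| ≤
      ∫ y, (C * heatKernel D τ (x - y) + heatKernel D τ (x - y) * ζ y) := by
    rw [← Real.norm_eq_abs]
    refine norm_integral_le_of_norm_le h2 (.of_forall fun y => ?_)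
    rw [norm_mul, Real.norm_of_nonneg (heatKernel_nonneg _ _ _), Real.norm_eq_abs]
    nlinarith [hn y, heatKernel_nonneg D τ (x - y)]
  rw [integral_add (hp.const_mul C) h1, integral_const_mul, integral_heatKernel_sub hD hτ] at h4
  rw [integral_const_mul] at h3
  linarith

/-- Fubini followed by the fundamental theorem of calculus: the integral over the window leaves only
the values of `f` at its two shifted end points. -/
theorem integral_Ioc_heatSemigroup_eq {τ R : ℝ} (hD : 0 < D) (hτ : 0 < τ) {n f ζ : ℝ → ℝ}
    (hm : Measurable n) (hζ : Integrable ζ) (hn : ∀ y, |n y| ≤ C + ζ y)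
    (hf : ∀ a b, f b - f a = ∫ y in a..b, n y) (hR : 0 ≤ R) :
    ∫ x in Ioc (-R) R, heatSemigroup D τ n x =
      ∫ y, heatKernel D τ y * (f (R - y) - f (-R - y)) := by
  have hp := integrable_heatKernel hD hτ
  have hint : Integrable (Function.uncurry fun x y => heatKernel D τ y * n (x - y))
      ((volume.restrict (Ioc (-R) R)).prod volume) := by
    have h1 : Integrable (fun q : ℝ × ℝ => C * heatKernel D τ q.2)
        ((volume.restrict (Ioc (-R) R)).prod volume) :=
      (hp.comp_snd (volume.restrict (Ioc (-R) R))).const_mul C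
    have h2 : Integrable (fun q : ℝ × ℝ => heatKernel D τ q.2 * ζ (q.1 - q.2))
        ((volume.restrict (Ioc (-R) R)).prod volume) := by
      have h := hp.convolution_integrand (ContinuousLinearMap.mul ℝ ℝ) hζ
      refine h.mono_measure ?_
      exact Measure.prod_mono Measure.restrict_le_self le_rfl
    refine (h1.add h2).mono' ?_ (.of_forall fun q => ?_)
    · exact (((continuous_heatKernel D τ).measurable.comp measurable_snd).mul
        (hm.comp (measurable_fst.sub measurable_snd))).aestronglyMeasurable
    · simp only [Function.uncurry, Pi.add_apply]
      rw [norm_mul, Real.norm_of_nonneg (heatKernel_nonneg _ _ _), Real.norm_eq_abs]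
      nlinarith [hn (q.1 - q.2), heatKernel_nonneg D τ q.2]
  simp only [heatSemigroup_eq]
  rw [integral_integral_swap hint]
  refine integral_congr_ae (.of_forall fun y => ?_)
  simp only
  rw [integral_const_mul, ← intervalIntegral.integral_of_le (by linarith),
    intervalIntegral.integral_comp_sub_right n, hf]

theorem integrable_one_div_sqrt_sub (hT : 0 ≤ T) (D : ℝ) :
    IntegrableOn (fun s => 1 / √(4 * Real.pi * D * (T - s))) (Ioc 0 T) := by
  have h := (intervalIntegral.intervalIntegrable_rpow' (a := T) (b := 0)
    (r := -(1 / 2)) (by norm_num)).comp_sub_left T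
  simp only [sub_self, sub_zero] at h
  rw [intervalIntegrable_iff_integrableOn_Ioc_of_le hT] at h
  refine (h.const_mul (1 / √(4 * Real.pi * D))).congr ?_
  refine (ae_restrict_iff' measurableSet_Ioc).2 (.of_forall fun s hs => ?_)
  have : 0 ≤ T - s := by linarith [hs.2]
  simp only
  rw [Real.sqrt_mul' _ this, Real.rpow_neg this, ← Real.sqrt_eq_rpow]
  ring

/-- A weak derivative is only fixed for almost every `x` at each time and carries no joint
measurability. Replacing `N` by `deriv (f s)`, jointly measurable because `f` is jointly continuous,
makes both exchanges of integrals legitimate. -/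
theorem integral_flux (hD : 0 < D) (hT : 0 ≤ T) (hC : 0 ≤ C) {f N : ℝ → ℝ → ℝ}
    (hf : Continuous (Function.uncurry f)) (hN : ∀ s ∈ Icc 0 T, N s =ᵐ[volume] deriv (f s))
    (hfN : ∀ s ∈ Icc 0 T, ∀ a b, f s b - f s a = ∫ y in a..b, N s y)
    (hb : ∀ s ∈ Icc 0 T, ∃ ζ : ℝ → ℝ, Integrable ζ ∧ ∫ y, ζ y ≤ C ∧ (∀ y, 0 ≤ ζ y) ∧
      ∀ᵐ y, |N s y| ≤ C + ζ y) {R : ℝ} (hR : 0 ≤ R) :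
    IntervalIntegrable (fun x => ∫ s in (0 : ℝ)..T, heatSemigroup D (T - s) (N s) x)
        volume (-R) R ∧
      ∫ x in (-R)..R, (∫ s in (0 : ℝ)..T, heatSemigroup D (T - s) (N s) x) =
        ∫ s in (0 : ℝ)..T, ∫ y, heatKernel D (T - s) y * (f s (R - y) - f s (-R - y)) := by
  set n : ℝ → ℝ → ℝ := fun s => deriv (f s) with hn
  have hnm : Measurable fun p : ℝ × ℝ => n p.1 p.2 := measurable_deriv_with_param hf
  have hnm' : ∀ s, Measurable (n s) := fun s => measurable_deriv (f s)
  have hb' : ∀ s ∈ Icc 0 T, ∃ ζ : ℝ → ℝ, Integrable ζ ∧ ∫ y, ζ y ≤ C ∧ (∀ y, 0 ≤ ζ y) ∧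
      ∀ y, |n s y| ≤ C + ζ y := by
    intro s hs
    obtain ⟨ζ, h1, h2, h3, h4⟩ := hb s hs
    -- Raising `ζ` on a null set makes the bound hold at every point.
    have he : ζ =ᵐ[volume] fun y => max (ζ y) (|n s y| - C) := by
      filter_upwards [h4, hN s hs] with y hy hy'
      rw [show n s y = N s y from hy'.symm, max_eq_left (by linarith)]
    refine ⟨_, h1.congr he, by rwa [← integral_congr_ae he],
      fun y => (h3 y).trans (le_max_left _ _), fun y => ?_⟩
    linarith [le_max_right (ζ y) (|n s y| - C)]
  have hNn : ∀ s ∈ Icc 0 T, ∀ x, heatSemigroup D (T - s) (N s) x = heatSemigroup D (T - s) (n s) x :=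
    fun s hs x => integral_congr_ae ((hN s hs).mono fun y hy => by simp only [hy, hn])
  set a : ℝ → ℝ → ℝ := fun s x => heatSemigroup D (T - s) (n s) x with ha
  have ham : StronglyMeasurable (Function.uncurry a) := by
    have : Measurable fun q : (ℝ × ℝ) × ℝ =>
        heatKernel D (T - q.1.1) (q.1.2 - q.2) * n q.1.1 q.2 :=
      ((measurable_heatKernel D).comp
        ((measurable_const.sub measurable_fst.fst).prodMk (measurable_fst.snd.sub measurable_snd))).mul
        (hnm.comp (measurable_fst.fst.prodMk measurable_snd))
    exact this.stronglyMeasurable.integral_prod_right'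
  have hab : ∀ s ∈ Ioc 0 T, ∀ x, |a s x| ≤ C + 1 / √(4 * Real.pi * D * (T - s)) * C := by
    intro s hs x
    rcases hs.2.eq_or_lt with rfl | h
    -- At `s = T` the kernel is `0` because of division by zero, and the right side reduces to `C`.
    · simp [ha, heatSemigroup, heatKernel, hC]
    · obtain ⟨ζ, h1, h2, h3, h4⟩ := hb' s ⟨hs.1.le, hs.2⟩
      refine (abs_heatSemigroup_le hD (sub_pos.2 h) h1 h3 h4 x).trans ?_
      gcongr
  have hg : Integrable (fun s => C + 1 / √(4 * Real.pi * D * (T - s)) * C)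
      (volume.restrict (Ioc 0 T)) :=
    (integrable_const C).add ((integrable_one_div_sqrt_sub hT D).mul_const C)
  have hint : Integrable (Function.uncurry a)
      ((volume.restrict (Ioc 0 T)).prod (volume.restrict (Ioc (-R) R))) := by
    refine (hg.comp_fst (volume.restrict (Ioc (-R) R))).mono' ham.aestronglyMeasurable ?_
    rw [Measure.prod_restrict]
    refine (ae_restrict_iff' (measurableSet_Ioc.prod measurableSet_Ioc)).2 (.of_forall fun q hq => ?_)
    exact hab q.1 hq.1 q.2
  have hRR : -R ≤ R := by linarith
  have hA : (fun x => ∫ s in (0 : ℝ)..T, heatSemigroup D (T - s) (N s) x) =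
      fun x => ∫ s in Ioc 0 T, a s x := by
    ext x
    rw [intervalIntegral.integral_of_le hT]
    exact setIntegral_congr_fun measurableSet_Ioc fun s hs => hNn s ⟨hs.1.le, hs.2⟩ x
  rw [hA]
  refine ⟨?_, ?_⟩
  · rw [intervalIntegrable_iff_integrableOn_Ioc_of_le hRR]
    exact hint.integral_prod_right
  · rw [intervalIntegral.integral_of_le hRR, intervalIntegral.integral_of_le hT,
      ← integral_integral_swap hint, ← setIntegral_congr_set Ioo_ae_eq_Ioc,
      ← setIntegral_congr_set (μ := volume) (s := Ioo 0 T) (t := Ioc 0 T) Ioo_ae_eq_Ioc]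
    refine setIntegral_congr_fun measurableSet_Ioo fun s hs => ?_
    have hs' : s ∈ Icc 0 T := ⟨hs.1.le, hs.2.le⟩
    obtain ⟨ζ, h1, h2, h3, h4⟩ := hb' s hs'
    refine integral_Ioc_heatSemigroup_eq hD (sub_pos.2 hs.2) (hnm' s) h1 h4 (fun x y => ?_) hR
    rw [hfN s hs']
    exact intervalIntegral.integral_congr_ae ((hN s hs').mono fun z hz _ => hz)

/-- The window ends run to the two infinities, where the flux has its limiting values, and the
kernel has mass one; the bound on `f` gives domination. -/
theorem tendsto_integral_flux (hD : 0 < D) (hT : 0 ≤ T) {f : ℝ → ℝ → ℝ}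
    (hf : Continuous (Function.uncurry f)) (hb : ∀ s x, |f s x| ≤ C) {a b : ℝ}
    (ha : ∀ s, Tendsto (f s) atBot (𝓝 a)) (hb' : ∀ s, Tendsto (f s) atTop (𝓝 b)) :
    Tendsto (fun R : ℝ => ∫ s in (0 : ℝ)..T,
      ∫ y, heatKernel D (T - s) y * (f s (R - y) - f s (-R - y))) atTop (𝓝 (T * (b - a))) := by
  have hC : 0 ≤ C := (abs_nonneg _).trans (hb 0 0)
  have hbd : ∀ R s y, |f s (R - y) - f s (-R - y)| ≤ 2 * C := fun R s y => by
    have h1 := abs_le.1 (hb s (R - y))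
    have h2 := abs_le.1 (hb s (-R - y))
    exact abs_le.2 ⟨by linarith, by linarith⟩
  have hbd' : ∀ R s y, ‖heatKernel D (T - s) y * (f s (R - y) - f s (-R - y))‖ ≤
      2 * C * heatKernel D (T - s) y := fun R s y => by
    rw [norm_mul, Real.norm_of_nonneg (heatKernel_nonneg _ _ _), Real.norm_eq_abs, mul_comm]
    exact mul_le_mul_of_nonneg_right (hbd R s y) (heatKernel_nonneg _ _ _)
  have hmeas : ∀ R, Measurable fun q : ℝ × ℝ =>
      heatKernel D (T - q.1) q.2 * (f q.1 (R - q.2) - f q.1 (-R - q.2)) := fun R => by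
    refine ((measurable_heatKernel D).comp
      ((measurable_const.sub measurable_fst).prodMk measurable_snd)).mul ?_
    exact ((hf.comp (f := fun q : ℝ × ℝ => (q.1, R - q.2)) (by fun_prop)).sub
      (hf.comp (f := fun q : ℝ × ℝ => (q.1, -R - q.2)) (by fun_prop))).measurable
  have hfin : ∫ _ in (0 : ℝ)..T, (b - a) = T * (b - a) := by simp [mul_sub]
  rw [← hfin]
  refine intervalIntegral.tendsto_integral_filter_of_dominated_convergence (fun _ => 2 * C)
    (.of_forall fun R => ?_) (.of_forall fun R => ?_) (by simp) ?_
  · exact (hmeas R).stronglyMeasurable.integral_prod_right'.aestronglyMeasurable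
  · have : ∀ᵐ s : ℝ, s ≠ T := by simp [ae_iff]
    filter_upwards [this] with s hsT hs
    rw [uIoc_of_le hT] at hs
    have hs' : 0 < T - s := sub_pos.2 (lt_of_le_of_ne hs.2 hsT)
    refine (norm_integral_le_of_norm_le ((integrable_heatKernel hD hs').const_mul (2 * C))
      (.of_forall (hbd' R s))).trans ?_
    rw [integral_const_mul, integral_heatKernel hD hs', mul_one]
  · have : ∀ᵐ s : ℝ, s ≠ T := by simp [ae_iff]
    filter_upwards [this] with s hsT hs
    rw [uIoc_of_le hT] at hs
    have hs' : 0 < T - s := sub_pos.2 (lt_of_le_of_ne hs.2 hsT)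
    have : ∫ y, heatKernel D (T - s) y * (b - a) = b - a := by
      rw [integral_mul_const, integral_heatKernel hD hs', one_mul]
    rw [← this]
    refine tendsto_integral_filter_of_dominated_convergence
      (fun y => 2 * C * heatKernel D (T - s) y) (.of_forall fun R => ?_)
      (.of_forall fun R => .of_forall (hbd' R s))
      ((integrable_heatKernel hD hs').const_mul _) (.of_forall fun y => ?_)
    · exact ((hmeas R).comp (measurable_prodMk_left (x := s))).aestronglyMeasurable
    · refine ((hb' s).comp ?_ |>.sub ((ha s).comp ?_)).const_mul _
      · exact tendsto_atTop_add_const_right atTop (-y) tendsto_id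
      · exact tendsto_atBot_add_const_right atTop (-y) tendsto_neg_atTop_atBot

end Flux

/-! ### The displaced profile and the control term over a large interval -/

section Profile

variable {D t M a b : ℝ} {U : ℝ → ℝ}

/-- Two translates integrated over the same window agree except on intervals of length `|d - y|` at
each end, so only values of `U` far out remain as `R` grows. -/
theorem integral_translate_sub_eq (hU : Continuous U) (d y R : ℝ) :
    ∫ x in (-R)..R, (U (x - d) - U (x - y)) =
      (∫ x in (-R - d)..(-R - y), U x) - ∫ x in (R - d)..(R - y), U x := by
  have hi : ∀ p q, IntervalIntegrable U volume p q := fun p q => hU.intervalIntegrable p q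
  have hi' : ∀ c p q, IntervalIntegrable (fun x => U (x - c)) volume p q := fun c p q =>
    (hU.comp (continuous_id.sub continuous_const)).intervalIntegrable p q
  rw [intervalIntegral.integral_sub (hi' d _ _) (hi' y _ _),
    intervalIntegral.integral_comp_sub_right U, intervalIntegral.integral_comp_sub_right U,
    intervalIntegral.integral_interval_sub_interval_comm (hi _ _) (hi _ _) (hi _ _)]

theorem tendsto_integral_translate_sub (hU : Continuous U) (hM : ∀ x, |U x| ≤ M)
    (ha : Tendsto U atBot (𝓝 a)) (hb : Tendsto U atTop (𝓝 b)) (d y : ℝ) :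
    Tendsto (fun R : ℝ => ∫ x in (-R)..R, (U (x - d) - U (x - y))) atTop
      (𝓝 ((y - d) * (b - a))) := by
  have e : ∀ R : ℝ, ∫ x in (-R)..R, (U (x - d) - U (x - y)) =
      (∫ r in (-d)..(-y), U (-R + r)) - ∫ r in (-d)..(-y), U (R + r) := fun R => by
    rw [integral_translate_sub_eq hU, intervalIntegral.integral_comp_add_left U, intervalIntegral.integral_comp_add_left U]
    simp only [← sub_eq_add_neg]
  have lim : ∀ (g : ℝ → ℝ) (c : ℝ), (∀ r, Tendsto (fun R => U (g R + r)) atTop (𝓝 c)) →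
      Tendsto (fun R => ∫ r in (-d)..(-y), U (g R + r)) atTop (𝓝 ((d - y) * c)) := by
    intro g c h
    have : ∫ _ in (-d)..(-y), c = (d - y) * c := by
      rw [intervalIntegral.integral_const, smul_eq_mul]; ring
    rw [← this]
    refine intervalIntegral.tendsto_integral_filter_of_dominated_convergence (fun _ => M)
      (.of_forall fun R => (hU.comp (continuous_const.add continuous_id)).aestronglyMeasurable)
      (.of_forall fun R => .of_forall fun r _ => hM _) (by simp) (.of_forall fun r _ => h r)
  simp only [e]
  have h1 := lim (fun R => -R) a fun r =>
    ha.comp (tendsto_atBot_add_const_right atTop r tendsto_neg_atTop_atBot)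
  have h2 := lim (fun R => R) b fun r =>
    hb.comp (tendsto_atTop_add_const_right atTop r tendsto_id)
  convert h1.sub h2 using 2
  ring

theorem continuous_heatSemigroup (hD : 0 < D) (ht : 0 < t) (hU : Continuous U)
    (hM : ∀ x, |U x| ≤ M) : Continuous (heatSemigroup D t U) := by
  rw [funext (heatSemigroup_eq D t U)]
  refine continuous_of_dominated (bound := fun y => heatKernel D t y * M) (fun x => ?_)
    (fun x => .of_forall fun y => ?_) ((integrable_heatKernel hD ht).mul_const M)
    (.of_forall fun y => ?_)
  · exact ((continuous_heatKernel D t).mul (hU.comp (by fun_prop))).aestronglyMeasurable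
  · rw [norm_mul, Real.norm_of_nonneg (heatKernel_nonneg _ _ _)]
    exact mul_le_mul_of_nonneg_left (hM _) (heatKernel_nonneg _ _ _)
  · exact continuous_const.mul (hU.comp (by fun_prop))

/-- Write the difference as the heat-kernel average of `U(x - d) - U(x - y)`. Each `y` contributes
`(y - d)(b - a)` in the limit, and the kernel has zero first moment: diffusion does not move the
mass. Domination uses a bound linear in `|y|`. -/
theorem tendsto_integral_displacement (hD : 0 < D) (ht : 0 < t) (hU : Continuous U)
    (hM : ∀ x, |U x| ≤ M) (ha : Tendsto U atBot (𝓝 a)) (hb : Tendsto U atTop (𝓝 b)) (d : ℝ) :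
    Tendsto (fun R : ℝ => ∫ x in (-R)..R, (U (x - d) - heatSemigroup D t U x)) atTop
      (𝓝 (-d * (b - a))) := by
  have hp := integrable_heatKernel hD ht
  have hM0 : 0 ≤ M := (abs_nonneg _).trans (hM 0)
  have hbd : ∀ x y, |U (x - d) - U (x - y)| ≤ 2 * M := fun x y => by
    have h1 := abs_le.1 (hM (x - d))
    have h2 := abs_le.1 (hM (x - y))
    exact abs_le.2 ⟨by linarith, by linarith⟩
  have hsub : ∀ x, U (x - d) - heatSemigroup D t U x =
      ∫ y, heatKernel D t y * (U (x - d) - U (x - y)) := fun x => by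
    have h2 : Integrable fun y => heatKernel D t y * U (x - y) :=
      hp.mul_bdd (c := M) (hU.comp (by fun_prop)).aestronglyMeasurable
        (.of_forall fun y => hM _)
    simp only [mul_sub]
    rw [integral_sub (hp.mul_const _) h2, integral_mul_const, integral_heatKernel hD ht, one_mul,
      heatSemigroup_eq]
  set G : ℝ → ℝ → ℝ := fun R y => ∫ x in (-R)..R, (U (x - d) - U (x - y)) with hG
  have hcont : Continuous fun q : ℝ × ℝ => heatKernel D t q.2 * (U (q.1 - d) - U (q.1 - q.2)) :=
    ((continuous_heatKernel D t).comp continuous_snd).mul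
      ((hU.comp (by fun_prop)).sub (hU.comp (by fun_prop)))
  have hswap : ∀ R : ℝ, 0 ≤ R → ∫ x in (-R)..R, (U (x - d) - heatSemigroup D t U x) =
      ∫ y, heatKernel D t y * G R y := fun R hR => by
    have hRR : -R ≤ R := by linarith
    simp only [hsub]
    rw [intervalIntegral.integral_of_le hRR, integral_integral_swap]
    · refine integral_congr_ae (.of_forall fun y => ?_)
      simp only [hG]
      rw [integral_const_mul, intervalIntegral.integral_of_le hRR]
    · refine ((hp.comp_snd (volume.restrict (Ioc (-R) R))).const_mul (2 * M)).mono'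
        hcont.aestronglyMeasurable (.of_forall fun q => ?_)
      simp only [Function.uncurry]
      rw [norm_mul, Real.norm_of_nonneg (heatKernel_nonneg _ _ _), mul_comm]
      exact mul_le_mul_of_nonneg_right (hbd _ _) (heatKernel_nonneg _ _ _)
  have hGb : ∀ R y, |G R y| ≤ 2 * M * (|y| + |d|) := fun R y => by
    have hJ : ∀ p, |∫ x in (p - d)..(p - y), U x| ≤ M * (|y| + |d|) := fun p => by
      refine (intervalIntegral.norm_integral_le_of_norm_le_const (f := U) fun x _ => hM x).trans ?_
      refine mul_le_mul_of_nonneg_left ?_ hM0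
      rw [show p - y - (p - d) = d - y by ring, add_comm]
      exact abs_sub _ _
    have e := integral_translate_sub_eq hU d y R
    simp only [hG]
    rw [e]
    refine (abs_sub _ _).trans ?_
    linarith [hJ (-R), hJ R]
  have hlim : ∫ y, heatKernel D t y * ((y - d) * (b - a)) = -d * (b - a) := by
    have e : ∀ y, heatKernel D t y * ((y - d) * (b - a)) =
        (b - a) * (y * heatKernel D t y) - d * (b - a) * heatKernel D t y := fun y => by ring
    simp only [e]
    rw [integral_sub ((integrable_id_mul_heatKernel hD ht).const_mul _) (hp.const_mul _),
      integral_const_mul, integral_const_mul, integral_id_mul_heatKernel, integral_heatKernel hD ht]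
    ring
  rw [← hlim]
  have hev : (fun R : ℝ => ∫ y, heatKernel D t y * G R y) =ᶠ[atTop]
      fun R => ∫ x in (-R)..R, (U (x - d) - heatSemigroup D t U x) :=
    (eventually_ge_atTop 0).mono fun R hR => (hswap R hR).symm
  refine Tendsto.congr' hev ?_
  refine tendsto_integral_filter_of_dominated_convergence
    (fun y => 2 * M * |y * heatKernel D t y| + 2 * M * |d| * heatKernel D t y)
    (.of_forall fun R => ?_) (.of_forall fun R => .of_forall fun y => ?_)
    (((integrable_id_mul_heatKernel hD ht).abs.const_mul _).add (hp.const_mul _))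
    (.of_forall fun y => (tendsto_integral_translate_sub hU hM ha hb d y).const_mul _)
  · refine ((continuous_heatKernel D t).mul ?_).aestronglyMeasurable
    exact intervalIntegral.continuous_parametric_intervalIntegral_of_continuous'
      (f := fun y x => U (x - d) - U (x - y)) ((hU.comp (by fun_prop)).sub (hU.comp (by fun_prop)))
      (-R) R
  · rw [norm_mul, Real.norm_of_nonneg (heatKernel_nonneg _ _ _), abs_mul,
      abs_of_nonneg (heatKernel_nonneg _ _ _)]
    have := mul_le_mul_of_nonneg_left (hGb R y) (heatKernel_nonneg D t y)
    rw [Real.norm_eq_abs]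
    linarith

end Profile

section Control

variable {D T : ℝ}

theorem lintegral_ofReal_heatKernel_sub_le (hD : 0 < D) {τ : ℝ} (hτ : 0 ≤ τ) (y : ℝ) :
    ∫⁻ x, ENNReal.ofReal (heatKernel D τ (x - y)) ≤ 1 := by
  rcases hτ.eq_or_lt with rfl | h
  · simp [heatKernel]
  · rw [← ofReal_integral_eq_lintegral_ofReal ((integrable_heatKernel hD h).comp_sub_right y)
      (.of_forall fun x => heatKernel_nonneg _ _ _), integral_sub_right_eq_self (heatKernel D τ),
      integral_heatKernel hD h, ENNReal.ofReal_one]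

/-- Tonelli, with the heat kernel integrating to at most one in `x`. Working with extended norms
dispenses with any integrability requirement on `g`. -/
theorem enorm_integral_heatSemigroup_le (hD : 0 < D) (hT : 0 ≤ T) {g : ℝ → ℝ → ℝ}
    {k : ℝ → ℝ → ℝ≥0∞} (hk : Measurable (Function.uncurry k)) (hg : ∀ s y, ‖g s y‖ₑ ≤ k s y)
    {R : ℝ} (hR : 0 ≤ R) :
    ‖∫ x in (-R)..R, ∫ s in (0 : ℝ)..T, heatSemigroup D (T - s) (g s) x‖ₑ ≤
      ∫⁻ s in Icc 0 T, ∫⁻ y, k s y := by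
  have hpk : Measurable fun q : (ℝ × ℝ) × ℝ =>
      ENNReal.ofReal (heatKernel D (T - q.1.2) (q.1.1 - q.2)) * k q.1.2 q.2 := by
    have h1 : Measurable fun q : (ℝ × ℝ) × ℝ => heatKernel D (T - q.1.2) (q.1.1 - q.2) :=
      (measurable_heatKernel D).comp
        (g := fun p : ℝ × ℝ => heatKernel D p.1 p.2) (f := fun q : (ℝ × ℝ) × ℝ =>
          (T - q.1.2, q.1.1 - q.2)) (by fun_prop)
    have h2 : Measurable fun q : (ℝ × ℝ) × ℝ => k q.1.2 q.2 :=
      hk.comp (f := fun q : (ℝ × ℝ) × ℝ => (q.1.2, q.2)) (by fun_prop)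
    exact h1.ennreal_ofReal.mul h2
  have hI : Measurable fun q : ℝ × ℝ =>
      ∫⁻ y, ENNReal.ofReal (heatKernel D (T - q.2) (q.1 - y)) * k q.2 y :=
    hpk.lintegral_prod_right'
  have h1 : ∀ s x, ‖heatSemigroup D (T - s) (g s) x‖ₑ ≤
      ∫⁻ y, ENNReal.ofReal (heatKernel D (T - s) (x - y)) * k s y := fun s x => by
    refine (enorm_integral_le_lintegral_enorm _).trans (lintegral_mono fun y => ?_)
    rw [enorm_mul, Real.enorm_of_nonneg (heatKernel_nonneg _ _ _)]
    exact mul_le_mul_right (hg s y) _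
  have step1 : ‖∫ x in (-R)..R, ∫ s in (0 : ℝ)..T, heatSemigroup D (T - s) (g s) x‖ₑ ≤
      ∫⁻ x, ∫⁻ s in Icc 0 T, ∫⁻ y, ENNReal.ofReal (heatKernel D (T - s) (x - y)) * k s y := by
    rw [intervalIntegral.integral_of_le (by linarith)]
    refine (enorm_integral_le_lintegral_enorm _).trans ?_
    refine (setLIntegral_le_lintegral _ _).trans (lintegral_mono fun x => ?_)
    rw [intervalIntegral.integral_of_le hT]
    refine (enorm_integral_le_lintegral_enorm _).trans ?_
    exact (lintegral_mono_set Ioc_subset_Icc_self).trans (lintegral_mono fun s => h1 s x)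
  refine step1.trans ?_
  rw [lintegral_lintegral_swap (f := fun x s =>
    ∫⁻ y, ENNReal.ofReal (heatKernel D (T - s) (x - y)) * k s y) hI.aemeasurable]
  refine setLIntegral_mono' measurableSet_Icc fun s hs => ?_
  have hm : Measurable fun q : ℝ × ℝ =>
      ENNReal.ofReal (heatKernel D (T - s) (q.1 - q.2)) * k s q.2 :=
    hpk.comp (f := fun q : ℝ × ℝ => ((q.1, s), q.2)) (by fun_prop)
  rw [lintegral_lintegral_swap (f := fun x y =>
    ENNReal.ofReal (heatKernel D (T - s) (x - y)) * k s y) hm.aemeasurable]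
  refine lintegral_mono fun y => ?_
  have hp : Measurable fun x => ENNReal.ofReal (heatKernel D (T - s) (x - y)) :=
    ((continuous_heatKernel D (T - s)).comp (by fun_prop)).measurable.ennreal_ofReal
  rw [lintegral_mul_const _ hp]
  exact mul_le_of_le_one_left zero_le
    (lintegral_ofReal_heatKernel_sub_le hD (sub_nonneg.2 hs.2) y)

theorem enorm_integral_control_le (hD : 0 < D) (hT : 0 ≤ T) {K h : ℝ → ℝ → ℝ}
    (hK : Measurable (Function.uncurry K)) (hh : Measurable (Function.uncurry h)) {R : ℝ}
    (hR : 0 ≤ R) :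
    ‖∫ x in (-R)..R, ∫ s in (0 : ℝ)..T, heatSemigroup D (T - s) (kernelOp K (h s)) x‖ₑ ≤
      ∫⁻ s in Icc 0 T, ∫⁻ y, ∫⁻ x', ‖K y x' * h s x'‖ₑ := by
  have hm : Measurable fun q : (ℝ × ℝ) × ℝ => ‖K q.1.2 q.2 * h q.1.1 q.2‖ₑ := by
    have h1 : Measurable fun q : (ℝ × ℝ) × ℝ => K q.1.2 q.2 :=
      hK.comp (f := fun q : (ℝ × ℝ) × ℝ => (q.1.2, q.2)) (by fun_prop)
    have h2 : Measurable fun q : (ℝ × ℝ) × ℝ => h q.1.1 q.2 :=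
      hh.comp (f := fun q : (ℝ × ℝ) × ℝ => (q.1.1, q.2)) (by fun_prop)
    exact (h1.mul h2).enorm
  refine enorm_integral_heatSemigroup_le (k := fun s y => ∫⁻ x', ‖K y x' * h s x'‖ₑ) hD hT ?_
    (fun s y => enorm_integral_le_lintegral_enorm _) hR
  exact hm.lintegral_prod_right'

/-- Young's inequality with a free parameter `ε` on `|ψ(y)| |h(s, x')|`, followed by the Schur
argument: either half leaves one variable in which `|k|` integrates to its `L¹` norm. The parameter
is optimised later, replacing Cauchy–Schwarz on the product space. -/
theorem lintegral_conv_control_le {k ψ : ℝ → ℝ} {h : ℝ → ℝ → ℝ}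
    (hkm : Measurable k) (hk : Integrable k) (hψm : Measurable ψ)
    (hψ : Integrable fun y => ψ y ^ 2)
    (hh : Measurable (Function.uncurry h)) {ε : ℝ} (hε : 0 < ε) :
    ∫⁻ s in Icc 0 T, ∫⁻ y, ∫⁻ x', ‖ψ y * k (y - x') * h s x'‖ₑ ≤
      ENNReal.ofReal (∫ z, |k z|) * (ENNReal.ofReal (ε / 2 * T * ∫ y, ψ y ^ 2) +
        ENNReal.ofReal (1 / (2 * ε)) * ∫⁻ s in Icc 0 T, ∫⁻ x, ENNReal.ofReal (h s x ^ 2)) := by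
  have hP : ∀ y, ∫⁻ x', ENNReal.ofReal |k (y - x')| = ENNReal.ofReal (∫ z, |k z|) := fun y => by
    rw [lintegral_sub_left_eq_self (fun z => ENNReal.ofReal |k z|) y,
      ofReal_integral_eq_lintegral_ofReal hk.abs (.of_forall fun z => abs_nonneg _)]
  have hP' : ∀ x', ∫⁻ y, ENNReal.ofReal |k (y - x')| = ENNReal.ofReal (∫ z, |k z|) := fun x' => by
    rw [lintegral_sub_right_eq_self (fun z => ENNReal.ofReal |k z|) x',
      ofReal_integral_eq_lintegral_ofReal hk.abs (.of_forall fun z => abs_nonneg _)]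
  have hpt : ∀ s y x', ‖ψ y * k (y - x') * h s x'‖ₑ ≤
      ENNReal.ofReal |k (y - x')| * ENNReal.ofReal (ε / 2 * ψ y ^ 2) +
        ENNReal.ofReal (1 / (2 * ε)) *
          (ENNReal.ofReal |k (y - x')| * ENNReal.ofReal (h s x' ^ 2)) := by
    intro s y x'
    rw [← ENNReal.ofReal_mul (abs_nonneg _), ← ENNReal.ofReal_mul (abs_nonneg _),
      ← ENNReal.ofReal_mul (by positivity), ← ENNReal.ofReal_add (by positivity) (by positivity),
      ← ofReal_norm]
    refine ENNReal.ofReal_le_ofReal ?_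
    rw [norm_mul, norm_mul, Real.norm_eq_abs, Real.norm_eq_abs, Real.norm_eq_abs]
    have h1 : |ψ y| * |h s x'| ≤ ε / 2 * ψ y ^ 2 + 1 / (2 * ε) * h s x' ^ 2 := by
      have e : ε / 2 * ψ y ^ 2 + 1 / (2 * ε) * h s x' ^ 2 - |ψ y| * |h s x'| =
          (ε * |ψ y| - |h s x'|) ^ 2 / (2 * ε) := by
        rw [← sq_abs (ψ y), ← sq_abs (h s x')]
        field_simp
        ring
      have : 0 ≤ (ε * |ψ y| - |h s x'|) ^ 2 / (2 * ε) := by positivity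
      linarith
    nlinarith [mul_le_mul_of_nonneg_left h1 (abs_nonneg (k (y - x')))]
  have hkm' : Measurable fun q : ℝ × ℝ => ENNReal.ofReal |k (q.1 - q.2)| :=
    (hkm.comp (measurable_fst.sub measurable_snd)).abs.ennreal_ofReal
  have hhm : ∀ s, Measurable (h s) := fun s => hh.comp measurable_prodMk_left
  have hin : ∀ s, ∫⁻ y, ∫⁻ x', ‖ψ y * k (y - x') * h s x'‖ₑ ≤
      ENNReal.ofReal (∫ z, |k z|) * ENNReal.ofReal (ε / 2 * ∫ y, ψ y ^ 2) +
        ENNReal.ofReal (∫ z, |k z|) *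
          (ENNReal.ofReal (1 / (2 * ε)) * ∫⁻ x, ENNReal.ofReal (h s x ^ 2)) := by
    intro s
    have hm2 : Measurable fun q : ℝ × ℝ =>
        ENNReal.ofReal |k (q.1 - q.2)| * ENNReal.ofReal (h s q.2 ^ 2) :=
      hkm'.mul ((hhm s).comp measurable_snd |>.pow_const 2).ennreal_ofReal
    calc _ ≤ ∫⁻ y, ∫⁻ x', (ENNReal.ofReal |k (y - x')| * ENNReal.ofReal (ε / 2 * ψ y ^ 2) +
        ENNReal.ofReal (1 / (2 * ε)) *
          (ENNReal.ofReal |k (y - x')| * ENNReal.ofReal (h s x' ^ 2))) :=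
          lintegral_mono fun y => lintegral_mono fun x' => hpt s y x'
      _ = ∫⁻ y, (ENNReal.ofReal (∫ z, |k z|) * ENNReal.ofReal (ε / 2 * ψ y ^ 2) +
          ENNReal.ofReal (1 / (2 * ε)) *
            ∫⁻ x', ENNReal.ofReal |k (y - x')| * ENNReal.ofReal (h s x' ^ 2)) := by
          refine lintegral_congr fun y => ?_
          have hm2y : Measurable fun x' =>
              ENNReal.ofReal |k (y - x')| * ENNReal.ofReal (h s x' ^ 2) :=
            hm2.comp measurable_prodMk_left
          have hky : Measurable fun x' => ENNReal.ofReal |k (y - x')| :=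
            hkm'.comp measurable_prodMk_left
          rw [lintegral_add_left (hky.mul_const _), lintegral_mul_const _ hky, hP,
            lintegral_const_mul _ hm2y]
      _ = _ := by
          rw [lintegral_add_left, lintegral_const_mul, lintegral_const_mul,
            lintegral_lintegral_swap hm2.aemeasurable]
          · congr 1
            · congr 1
              rw [← ofReal_integral_eq_lintegral_ofReal (hψ.const_mul _)
                (.of_forall fun y => by positivity), integral_const_mul]
            · rw [mul_left_comm]
              congr 1
              rw [← lintegral_const_mul _ ((hhm s).pow_const 2).ennreal_ofReal]
              refine lintegral_congr fun x' => ?_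
              have hkx : Measurable fun y => ENNReal.ofReal |k (y - x')| :=
                hkm'.comp measurable_prodMk_right
              rw [lintegral_mul_const _ hkx, hP']
          · exact hm2.lintegral_prod_right'
          · exact ((hψm.pow_const 2).const_mul _).ennreal_ofReal
          · exact (((hψm.pow_const 2).const_mul _).ennreal_ofReal).const_mul _
  refine (lintegral_mono fun s => hin s).trans (le_of_eq ?_)
  have hH : Measurable fun s => ∫⁻ x, ENNReal.ofReal (h s x ^ 2) :=
    ((hh.pow_const 2).ennreal_ofReal).lintegral_prod_right'
  rw [lintegral_add_left measurable_const, lintegral_const_mul _ (hH.const_mul _),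
    lintegral_const_mul _ hH, setLIntegral_const, Real.volume_Icc, sub_zero, mul_assoc,
    ← ENNReal.ofReal_mul (mul_nonneg (by positivity) (integral_nonneg fun y => sq_nonneg _)),
    ← mul_add]
  ring_nf

end Control

/-! ### Elementary properties of the profile -/

/-- The right-hand side of the profile equation `U' = q(U)`. -/
def profileField (D : ℝ) (F : ℝ → ℝ) (uM uP u : ℝ) : ℝ :=
  (F u - F uM - waveSpeed F uM uP * (u - uM)) / D

section Field

variable {q v : ℝ → ℝ} {a m : ℝ}

theorem eq_const_of_ode {K : NNReal} (hq : LipschitzWith K q)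
    (hv : ∀ x, HasDerivAt v (q (v x)) x) (ha : q a = 0) {x₁ : ℝ} (h : v x₁ = a) (x : ℝ) :
    v x = a := by
  have := ODE_solution_unique_univ (v := fun _ => q) (s := fun _ => univ) (K := K) (t₀ := x₁)
    (f := v) (g := fun _ => a) (fun _ => hq.lipschitzOnWith) (fun t => ⟨hv t, mem_univ _⟩)
    (fun t => ⟨by simpa [ha] using hasDerivAt_const t a, mem_univ _⟩) h
  exact congrFun this x

/-- Near the equilibrium the linear rate `m` loses at most half to the remainder, so with `lam =
-m/2` the function `(v - a)² exp(2 lam x)` is eventually nonincreasing; on the remaining compact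
interval it is bounded by continuity. -/
theorem exists_exp_decay_of_ode (hv : ∀ x, HasDerivAt v (q (v x)) x)
    (hlim : Tendsto v atTop (𝓝 a)) (ha : q a = 0) (hq : HasDerivAt q m a) (hm : m < 0) :
    ∃ C lam : ℝ, 0 < C ∧ 0 < lam ∧ ∀ x, 0 ≤ x → |v x - a| ≤ C * Real.exp (-lam * x) := by
  set lam := -m / 2 with hlam
  have hlam0 : 0 < lam := by simp only [hlam]; linarith
  have hvc : Continuous v := continuous_iff_continuousAt.2 fun x => (hv x).continuousAt
  have h1 : ∀ᶠ x in atTop, (v x - a) * q (v x) ≤ -lam * (v x - a) ^ 2 := by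
    have h := hlim.eventually ((hasDerivAt_iff_isLittleO.1 hq).def hlam0)
    filter_upwards [h] with x hx
    rw [ha, sub_zero, smul_eq_mul, Real.norm_eq_abs, Real.norm_eq_abs] at hx
    have h2 : (v x - a) * (q (v x) - (v x - a) * m) ≤ lam * (v x - a) ^ 2 := by
      refine (le_abs_self _).trans ?_
      rw [abs_mul, ← sq_abs (v x - a)]
      nlinarith [abs_nonneg (v x - a)]
    have : m = -2 * lam := by simp only [hlam]; ring
    rw [this] at h2
    nlinarith
  obtain ⟨X, hX0, hX⟩ := (eventually_atTop.1 h1).imp fun X h =>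
    (⟨trivial, h⟩ : True ∧ ∀ x ≥ X, (v x - a) * q (v x) ≤ -lam * (v x - a) ^ 2)
  set E : ℝ → ℝ := fun x => (v x - a) ^ 2 * Real.exp (2 * lam * x) with hE
  have hEd : ∀ x, HasDerivAt E (2 * (v x - a) * q (v x) * Real.exp (2 * lam * x) +
      (v x - a) ^ 2 * (Real.exp (2 * lam * x) * (2 * lam))) x := fun x => by
    have h2 := ((hv x).sub_const a).pow 2
    have h3 := (((hasDerivAt_id x).const_mul (2 * lam))).exp
    refine (h2.mul h3).congr_deriv ?_
    simp
  have hanti : AntitoneOn E (Ici X) := by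
    refine antitoneOn_of_deriv_nonpos (convex_Ici X)
      (fun x _ => (hEd x).continuousAt.continuousWithinAt)
      (fun x _ => (hEd x).differentiableAt.differentiableWithinAt) fun x hx => ?_
    rw [interior_Ici] at hx
    rw [(hEd x).deriv]
    have := hX x hx.le
    nlinarith [Real.exp_pos (2 * lam * x)]
  obtain ⟨B, hB⟩ := (isCompact_Icc (a := 0) (b := X)).exists_bound_of_continuousOn
    (f := E) (fun x _ => (hEd x).continuousAt.continuousWithinAt)
  have hbound : ∀ x, 0 ≤ x → E x ≤ max B (E X) + 1 := fun x hx => by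
    rcases le_total x X with h | h
    · linarith [le_max_left B (E X), le_of_abs_le (hB x ⟨hx, h⟩)]
    · linarith [le_max_right B (E X), hanti self_mem_Ici h h]
  have hpos : 0 < max B (E X) + 1 := by
    have : 0 ≤ E X := by simp only [hE]; positivity
    linarith [le_max_right B (E X)]
  refine ⟨√(max B (E X) + 1), lam, Real.sqrt_pos.2 hpos, hlam0, fun x hx => ?_⟩
  have h2 := hbound x hx
  have h3 : (v x - a) ^ 2 ≤ (√(max B (E X) + 1) * Real.exp (-lam * x)) ^ 2 := by
    rw [mul_pow, Real.sq_sqrt hpos.le, ← Real.exp_nat_mul]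
    have e : Real.exp (2 * lam * x) * Real.exp ((2 : ℕ) * (-lam * x)) = 1 := by
      rw [← Real.exp_add]
      simp only [Nat.cast_ofNat]
      rw [show 2 * lam * x + 2 * (-lam * x) = 0 by ring, Real.exp_zero]
    have := mul_le_mul_of_nonneg_right h2 (Real.exp_pos ((2 : ℕ) * (-lam * x))).le
    simp only [hE] at this
    rwa [mul_assoc, e, mul_one] at this
  exact abs_le_of_sq_le_sq h3 (by positivity)

end Field

section Wave

variable {D : ℝ} {F : ℝ → ℝ} {uM uP : ℝ} {U : ℝ → ℝ}

theorem IsAdmissibleFlux.differentiable (hF : IsAdmissibleFlux F uM uP) : Differentiable ℝ F :=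
  hF.contDiff.differentiable (by norm_num)

theorem IsAdmissibleFlux.contDiff_deriv (hF : IsAdmissibleFlux F uM uP) :
    ContDiff ℝ 1 (deriv F) := by
  have := hF.contDiff
  rw [show (2 : WithTop ℕ∞) = 1 + 1 by norm_num, contDiff_succ_iff_deriv] at this
  exact this.2.2

theorem profileField_left (D : ℝ) (F : ℝ → ℝ) (uM uP : ℝ) : profileField D F uM uP uM = 0 := by
  simp [profileField]

theorem IsAdmissibleFlux.profileField_right (hF : IsAdmissibleFlux F uM uP) (D : ℝ) :
    profileField D F uM uP uP = 0 := by
  have : uP - uM ≠ 0 := sub_ne_zero.2 hF.ne.symm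
  rw [profileField, waveSpeed, div_mul_cancel₀ _ this, sub_self, zero_div]

theorem IsAdmissibleFlux.hasDerivAt_profileField (hF : IsAdmissibleFlux F uM uP) (D u : ℝ) :
    HasDerivAt (profileField D F uM uP) ((deriv F u - waveSpeed F uM uP) / D) u := by
  have h := ((((hF.differentiable u).hasDerivAt).sub_const (F uM)).sub
    (((hasDerivAt_id u).sub_const uM).const_mul (waveSpeed F uM uP))).div_const D
  exact h.congr_deriv (by ring)

theorem IsAdmissibleFlux.exists_lipschitz_profileField (hF : IsAdmissibleFlux F uM uP)
    (hD : 0 < D) : ∃ K, LipschitzWith K (profileField D F uM uP) := by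
  obtain ⟨C, hC⟩ := hF.bounded
  refine ⟨((C + |waveSpeed F uM uP|) / D).toNNReal, lipschitzWith_of_nnnorm_deriv_le
    (fun u => (hF.hasDerivAt_profileField D u).differentiableAt) fun u => ?_⟩
  rw [(hF.hasDerivAt_profileField D u).deriv, ← norm_toNNReal]
  refine Real.toNNReal_le_toNNReal ?_
  rw [norm_div, Real.norm_of_nonneg hD.le]
  gcongr
  exact (norm_sub_le _ _).trans (add_le_add (hC u).1 le_rfl)

namespace IsWaveProfile

theorem hasDerivAt (hU : IsWaveProfile D F uM uP U) (x : ℝ) :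
    HasDerivAt U (profileField D F uM uP (U x)) x := hU.ode x

theorem continuous (hU : IsWaveProfile D F uM uP U) : Continuous U :=
  continuous_iff_continuousAt.2 fun x => (hU.ode x).continuousAt

/-- By uniqueness for the profile equation, a profile attaining an equilibrium is constant,
contradicting its two distinct limits. -/
theorem notMem_range (hU : IsWaveProfile D F uM uP U) (hD : 0 < D)
    (hF : IsAdmissibleFlux F uM uP) {c : ℝ} (hc : profileField D F uM uP c = 0) :
    c ∉ range U := by
  rintro ⟨x₁, hx₁⟩
  obtain ⟨K, hK⟩ := hF.exists_lipschitz_profileField hD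
  have h : U = fun _ => c := funext fun x => eq_const_of_ode hK hU.hasDerivAt hc hx₁ x
  have h1 := hU.tendsto_left
  have h2 := hU.tendsto_right
  rw [h, tendsto_const_nhds_iff] at h1 h2
  exact hF.ne (h1.symm.trans h2)

/-- To leave the interval between its limits, the profile would have to cross an end state by the
intermediate value theorem, and the end states are not attained. -/
theorem mem_uIcc (hU : IsWaveProfile D F uM uP U) (hD : 0 < D) (hF : IsAdmissibleFlux F uM uP)
    (x : ℝ) : U x ∈ uIcc uM uP := by
  have hM := hU.notMem_range hD hF (profileField_left D F uM uP)
  have hP := hU.notMem_range hD hF (hF.profileField_right D)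
  have key : ∀ a c : ℝ, a ≠ c → c ∉ range U → ∀ l : Filter ℝ, l.NeBot → Tendsto U l (𝓝 a) →
      (a < c → U x ≤ c) ∧ (c < a → c ≤ U x) := by
    intro a c _ hcr l hl ht
    constructor
    · intro hac
      by_contra! hlt
      obtain ⟨y, hy⟩ := (ht.eventually (gt_mem_nhds hac)).exists
      exact hcr (mem_range_of_exists_le_of_exists_ge hU.continuous ⟨y, hy.le⟩ ⟨x, hlt.le⟩)
    · intro hac
      by_contra! hlt
      obtain ⟨y, hy⟩ := (ht.eventually (lt_mem_nhds hac)).exists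
      exact hcr (mem_range_of_exists_le_of_exists_ge hU.continuous ⟨x, hlt.le⟩ ⟨y, hy.le⟩)
  have k1 := key uM uP hF.ne hP atBot inferInstance hU.tendsto_left
  have k2 := key uP uM hF.ne.symm hM atTop inferInstance hU.tendsto_right
  rcases lt_or_gt_of_ne hF.ne with h | h
  · rw [uIcc_of_le h.le]
    exact ⟨k2.2 h, k1.1 h⟩
  · rw [uIcc_of_ge h.le]
    exact ⟨k1.2 h, k2.1 h⟩

theorem abs_le (hU : IsWaveProfile D F uM uP U) (hD : 0 < D) (hF : IsAdmissibleFlux F uM uP)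
    (x : ℝ) : |U x| ≤ |uM| + |uP| := by
  have h := hU.mem_uIcc hD hF x
  rw [Set.mem_uIcc] at h
  have h1 := neg_abs_le uM
  have h2 := le_abs_self uM
  have h3 := neg_abs_le uP
  have h4 := le_abs_self uP
  have h5 := abs_nonneg uP
  have h6 := abs_nonneg uM
  rw [_root_.abs_le]
  rcases h with h | h <;> constructor <;> linarith [h.1, h.2]

/-- Exponential convergence of the profile to its end states. -/
theorem exists_exp_decay (hU : IsWaveProfile D F uM uP U) (hD : 0 < D)
    (hF : IsAdmissibleFlux F uM uP) :
    ∃ C lam : ℝ, 0 < C ∧ 0 < lam ∧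
      (∀ x, 0 ≤ x → |U x - uP| ≤ C * Real.exp (-lam * |x|)) ∧
      (∀ x, x ≤ 0 → |U x - uM| ≤ C * Real.exp (-lam * |x|)) ∧
      ∀ x, |profileField D F uM uP (U x)| ≤ C * Real.exp (-lam * |x|) := by
  obtain ⟨C₁, l₁, hC₁, hl₁, h₁⟩ := exists_exp_decay_of_ode hU.hasDerivAt hU.tendsto_right
    (hF.profileField_right D) (hF.hasDerivAt_profileField D uP)
    (div_neg_of_neg_of_pos (sub_neg.2 hF.lax_right) hD)
  -- The reflection of `x` changes the sign of the field, so the unstable equilibrium `uM` becomes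
  -- stable by the left Lax inequality.
  obtain ⟨C₂, l₂, hC₂, hl₂, h₂⟩ := exists_exp_decay_of_ode
    (q := fun u => -profileField D F uM uP u) (v := fun x => U (-x)) (a := uM)
    (fun x => ((hU.hasDerivAt (-x)).scomp x (hasDerivAt_neg x)).congr_deriv (by simp))
    (hU.tendsto_left.comp tendsto_neg_atTop_atBot) (by simp [profileField_left])
    (hF.hasDerivAt_profileField D uM).neg
    (neg_neg_of_pos (div_pos (sub_pos.2 hF.lax_left) hD))
  obtain ⟨K, hK⟩ := hF.exists_lipschitz_profileField hD
  have hmono : ∀ l, min l₁ l₂ ≤ l → ∀ x : ℝ, Real.exp (-l * |x|) ≤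
      Real.exp (-min l₁ l₂ * |x|) := fun l hl x =>
    Real.exp_le_exp.2 (by nlinarith [abs_nonneg x])
  have hP : ∀ x, 0 ≤ x → |U x - uP| ≤ (C₁ + C₂) * Real.exp (-min l₁ l₂ * |x|) := fun x hx => by
    refine (h₁ x hx).trans ?_
    have := hmono l₁ (min_le_left _ _) x
    rw [abs_of_nonneg hx] at this ⊢
    nlinarith [Real.exp_pos (-min l₁ l₂ * x)]
  have hM : ∀ x, x ≤ 0 → |U x - uM| ≤ (C₁ + C₂) * Real.exp (-min l₁ l₂ * |x|) := fun x hx => by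
    have h := h₂ (-x) (by linarith)
    rw [neg_neg] at h
    refine h.trans ?_
    have := hmono l₂ (min_le_right _ _) x
    rw [abs_of_nonpos hx] at this ⊢
    nlinarith [Real.exp_pos (-min l₁ l₂ * -x)]
  have hq : ∀ c, profileField D F uM uP c = 0 → ∀ x,
      |profileField D F uM uP (U x)| ≤ K * |U x - c| := fun c hc x => by
    simpa [hc, Real.dist_eq] using hK.dist_le_mul (U x) c
  refine ⟨(K + 1) * (C₁ + C₂), min l₁ l₂, by positivity, lt_min hl₁ hl₂, fun x hx => ?_,
    fun x hx => ?_, fun x => ?_⟩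
  · refine (hP x hx).trans ?_
    gcongr
    nlinarith [K.2, show (0 : ℝ) ≤ K from K.2]
  · refine (hM x hx).trans ?_
    gcongr
    nlinarith [show (0 : ℝ) ≤ K from K.2]
  · have hK0 : (0 : ℝ) ≤ K := K.2
    rcases le_total 0 x with hx | hx
    · have := hq uP (hF.profileField_right D) x
      have h' := mul_le_mul_of_nonneg_left (hP x hx) hK0
      have : 0 < (C₁ + C₂) * Real.exp (-min l₁ l₂ * |x|) := by positivity
      nlinarith
    · have := hq uM (profileField_left D F uM uP) x
      have h' := mul_le_mul_of_nonneg_left (hM x hx) hK0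
      have : 0 < (C₁ + C₂) * Real.exp (-min l₁ l₂ * |x|) := by positivity
      nlinarith

end IsWaveProfile

end Wave

/-! ### Conservation of mass along a mild solution -/

section Mass

variable {D : ℝ} {F : ℝ → ℝ} {uM uP : ℝ} {U : ℝ → ℝ}

/-- The properties of the flux `F(u)` along a path in `𝓔¹` that enter `integral_flux`. -/
theorem PathSpace.exists_flux_rep (hD : 0 < D) (hF : IsAdmissibleFlux F uM uP)
    (hU : IsWaveProfile D F uM uP U) {T : ℝ} (hT : 0 ≤ T) {u N : ℝ → ℝ → ℝ}
    (hu : u ∈ PathSpace U T)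
    (hN : ∀ t ∈ Icc 0 T, HasWeakDeriv (fun x => F (u t x)) (N t)) :
    ∃ (f : ℝ → ℝ → ℝ) (C : ℝ), Continuous (Function.uncurry f) ∧ (∀ s x, |f s x| ≤ C) ∧
      (∀ s, Tendsto (f s) atBot (𝓝 (F uM))) ∧ (∀ s, Tendsto (f s) atTop (𝓝 (F uP))) ∧
      (∀ s ∈ Icc 0 T, N s =ᵐ[volume] deriv (f s)) ∧
      (∀ s ∈ Icc 0 T, ∀ a b, f s b - f s a = ∫ y in a..b, N s y) ∧
      ∀ s ∈ Icc 0 T, ∃ ζ : ℝ → ℝ, Integrable ζ ∧ ∫ y, ζ y ≤ C ∧ (∀ y, 0 ≤ ζ y) ∧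
        ∀ᵐ y, |N s y| ≤ C + ζ y := by
  obtain ⟨v, z, hv, ⟨B, hB⟩, hlim, hvz, ⟨Z, hZ⟩⟩ := PathSpace.exists_continuous_rep hT hu
  obtain ⟨CU, lam, hCU, hlam, -, -, hU'⟩ := hU.exists_exp_decay hD hF
  obtain ⟨CF, hCF⟩ := hF.bounded
  have hFc : Continuous F := hF.contDiff.continuous
  have hCF0 : 0 ≤ CF := (abs_nonneg _).trans (hCF 0).1
  set M := |uM| + |uP| + B
  obtain ⟨Bf, hBf⟩ := (isCompact_Icc (a := -M) (b := M)).exists_bound_of_continuousOn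
    hFc.continuousOn
  set f : ℝ → ℝ → ℝ := fun s x => F (U x + v s x) with hf
  have hfc : Continuous (Function.uncurry f) :=
    hFc.comp ((hU.continuous.comp continuous_snd).add hv)
  have hfc' : ∀ s, Continuous (f s) := fun s => hfc.comp (Continuous.prodMk_right s)
  have hfu : ∀ s ∈ Icc 0 T, (fun x => F (u s x)) =ᵐ[volume] f s := fun s hs => by
    filter_upwards [(hvz s hs).1] with x hx
    simp only [hf, ← hx, add_sub_cancel]
  have hprim : ∀ s ∈ Icc 0 T, ∃ c, ∀ x, f s x = c + ∫ y in (0 : ℝ)..x, N s y := fun s hs => by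
    obtain ⟨c, hc⟩ := (hN s hs).exists_ae_eq_primitive
    refine ⟨c, congrFun ?_⟩
    refine (Continuous.ae_eq_iff_eq volume (hfc' s)
      (continuous_const.add (continuous_primitive' (hN s hs).locallyIntegrable_deriv))).1 ?_
    filter_upwards [hc, hfu s hs] with x h1 h2
    rw [← h2, h1, Pi.add_apply]
  have hder : ∀ s ∈ Icc 0 T, ∀ᵐ x, HasDerivAt (f s) (N s x) x := fun s hs => by
    obtain ⟨c, hc⟩ := hprim s hs
    filter_upwards [_root_.LocallyIntegrable.ae_hasDerivAt_integral
      (hN s hs).locallyIntegrable_deriv] with x hx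
    rw [funext hc]
    exact (hx 0).const_add c
  refine ⟨f, max (max Bf (CF * (CU + 1))) (CF * Z), hfc, fun s x => ?_, fun s => ?_, fun s => ?_,
    fun s hs => ?_, fun s hs a b => ?_, fun s hs => ?_⟩
  · refine (hBf _ (abs_le.1 ?_)).trans ((le_max_left _ _).trans (le_max_left _ _))
    exact (abs_add_le _ _).trans (add_le_add (hU.abs_le hD hF x) (hB s x))
  · have := (hU.tendsto_left.add (hlim s).2)
    rw [add_zero] at this
    exact (hFc.tendsto uM).comp this
  · have := (hU.tendsto_right.add (hlim s).1)
    rw [add_zero] at this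
    exact (hFc.tendsto uP).comp this
  · filter_upwards [hder s hs] with x hx
    exact hx.deriv.symm
  · obtain ⟨c, hc⟩ := hprim s hs
    have hl := (hN s hs).locallyIntegrable_deriv
    rw [hc, hc, add_sub_add_left_eq_sub]
    exact intervalIntegral.integral_interval_sub_left (hl.intervalIntegrable' _ _)
      (hl.intervalIntegrable' _ _)
  · have hz := (hvz s hs).2.1
    refine ⟨fun y => CF * z s y ^ 2, hz.integrable_sq.const_mul CF, ?_,
      fun y => mul_nonneg hCF0 (sq_nonneg _), ?_⟩
    · rw [integral_const_mul]
      exact (mul_le_mul_of_nonneg_left (hZ s hs) hCF0).trans (le_max_right _ _)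
    · filter_upwards [hder s hs, (hvz s hs).2.2] with x h1 h2
      have h3 : HasDerivAt (f s) (deriv F (U x + v s x) *
          (profileField D F uM uP (U x) + z s x)) x :=
        ((hF.differentiable (U x + v s x)).hasDerivAt).comp x ((hU.hasDerivAt x).add h2)
      rw [h1.unique h3, abs_mul]
      have h4 : |profileField D F uM uP (U x)| ≤ CU := by
        refine (hU' x).trans (mul_le_of_le_one_right hCU.le (Real.exp_le_one_iff.2 ?_))
        nlinarith [abs_nonneg x]
      -- The derivative is only in `L²`; `|z| ≤ 1 + z²` splits it into a bounded and an `L¹` part,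
      -- as `integral_flux` requires.
      have h5 : |profileField D F uM uP (U x) + z s x| ≤ CU + 1 + z s x ^ 2 := by
        refine (abs_add_le _ _).trans ?_
        have : |z s x| ≤ 1 + z s x ^ 2 := by
          rw [← sq_abs]; nlinarith [sq_nonneg (|z s x| - 1), abs_nonneg (z s x)]
        linarith
      have h6 := mul_le_mul (hCF (U x + v s x)).1 h5 (abs_nonneg _) hCF0
      refine h6.trans ?_
      have : CF * (CU + 1) ≤ max (max Bf (CF * (CU + 1))) (CF * Z) :=
        (le_max_right _ _).trans (le_max_left _ _)
      linarith

/-- Conservation of mass on `[-R, R]` as `R → ∞`: the transport by `γT` is paid for by the flux, and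
the control must account for the displacement `x₀`. -/
theorem mass_le_of_isMildSolution (hD : 0 < D) (hF : IsAdmissibleFlux F uM uP)
    (hU : IsWaveProfile D F uM uP U) {T x₀ : ℝ} (hT : 0 < T) {Φ h u : ℝ → ℝ → ℝ}
    (hu : u ∈ displacementEvent U (waveSpeed F uM uP) T x₀)
    (hmild : IsMildSolution D F U Φ T h u) {κ : ℝ} (hκ : ∀ R, 0 ≤ R →
      |∫ x in (-R)..R, ∫ s in (0 : ℝ)..T, heatSemigroup D (T - s) (kernelOp Φ (h s)) x| ≤ κ) :
    |x₀ * (uP - uM)| ≤ κ := by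
  obtain ⟨hpath, -, huT⟩ := hu
  obtain ⟨-, N, hN, hmild⟩ := hmild
  obtain ⟨f, C, hfc, hfb, hfM, hfP, hNf, hfN, hfz⟩ :=
    PathSpace.exists_flux_rep hD hF hU hT.le hpath hN
  have hC0 : 0 ≤ C := (abs_nonneg _).trans (hfb 0 0)
  set γ := waveSpeed F uM uP with hγ
  set A : ℝ → ℝ := fun x => ∫ s in (0 : ℝ)..T, heatSemigroup D (T - s) (N s) x with hA
  have hflux := fun R (hR : 0 ≤ R) => integral_flux hD hT.le hC0 hfc hNf hfN hfz hR
  have hUb := hU.abs_le hD hF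
  have hae : ∀ᵐ x, (∫ s in (0 : ℝ)..T, heatSemigroup D (T - s) (kernelOp Φ (h s)) x) =
      (U (x - (γ * T + x₀)) - heatSemigroup D T U x) + A x := by
    filter_upwards [hmild T ⟨hT, le_rfl⟩, huT] with x h1 h2
    rw [h1] at h2
    rw [← sub_sub, ← h2]
    simp only [hA]
    ring
  have heq : ∀ R, 0 ≤ R →
      ∫ x in (-R)..R, ∫ s in (0 : ℝ)..T, heatSemigroup D (T - s) (kernelOp Φ (h s)) x =
      (∫ x in (-R)..R, (U (x - (γ * T + x₀)) - heatSemigroup D T U x)) +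
        ∫ s in (0 : ℝ)..T, ∫ y, heatKernel D (T - s) y * (f s (R - y) - f s (-R - y)) := by
    intro R hR
    rw [intervalIntegral.integral_congr_ae (hae.mono fun x hx _ => hx),
      intervalIntegral.integral_add _ (hflux R hR).1, (hflux R hR).2]
    exact ((hU.continuous.comp (continuous_id.sub continuous_const)).sub
      (continuous_heatSemigroup hD hT hU.continuous hUb)).intervalIntegrable _ _
  have hlim := (tendsto_integral_displacement hD hT hU.continuous hUb hU.tendsto_left
    hU.tendsto_right (γ * T + x₀)).add (tendsto_integral_flux hD hT.le hfc hfb hfM hfP)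
  -- The Rankine–Hugoniot relation cancels the contribution of the wave speed.
  have hval : -(γ * T + x₀) * (uP - uM) + T * (F uP - F uM) = -(x₀ * (uP - uM)) := by
    have h0 : uP - uM ≠ 0 := sub_ne_zero.2 hF.ne.symm
    have : γ * (uP - uM) = F uP - F uM := by rw [hγ, waveSpeed, div_mul_cancel₀ _ h0]
    rw [← this]; ring
  rw [hval] at hlim
  have := hlim.abs
  rw [abs_neg] at this
  refine le_of_tendsto this ((eventually_ge_atTop 0).mono fun R hR => ?_)
  rw [← heq R hR]
  exact hκ R hR

end Mass

/-! ### Lower bound on the cost -/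

section LowerBound

variable {D : ℝ} {F : ℝ → ℝ} {uM uP : ℝ} {U : ℝ → ℝ}

/-- The mass bound holds with every `ε > 0` from Young's inequality; choosing the best `ε` gives the
quadratic estimate. -/
theorem displacement_sq_le_of_measurable (hD : 0 < D) (hF : IsAdmissibleFlux F uM uP)
    (hU : IsWaveProfile D F uM uP U) {T x₀ : ℝ} (hT : 0 < T) {k ψ : ℝ → ℝ} {h u : ℝ → ℝ → ℝ}
    (hkm : Measurable k) (hk : Integrable k) (hψm : Measurable ψ)
    (hψ : Integrable fun y => ψ y ^ 2) (hh : Measurable (Function.uncurry h)) {H : ℝ}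
    (hH0 : 0 ≤ H) (hH : ∫⁻ s in Icc 0 T, ∫⁻ x, ENNReal.ofReal (h s x ^ 2) ≤ ENNReal.ofReal H)
    (hu : u ∈ displacementEvent U (waveSpeed F uM uP) T x₀)
    (hmild : IsMildSolution D F U (fun x x' => ψ x * k (x - x')) T h u) :
    (x₀ * (uP - uM)) ^ 2 ≤ (∫ z, |k z|) ^ 2 * T * (∫ y, ψ y ^ 2) * H := by
  set P := ∫ z, |k z|
  set Q := ∫ y, ψ y ^ 2
  have hP : 0 ≤ P := integral_nonneg fun z => abs_nonneg _
  have hQ : 0 ≤ Q := integral_nonneg fun z => sq_nonneg _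
  set a := |x₀ * (uP - uM)| with ha
  have key : ∀ ε, 0 < ε → a ≤ P * (ε / 2 * T * Q + 1 / (2 * ε) * H) := fun ε hε => by
    refine mass_le_of_isMildSolution hD hF hU hT hu hmild fun R hR => ?_
    have hKm : Measurable (Function.uncurry fun x x' => ψ x * k (x - x')) :=
      (hψm.comp measurable_fst).mul (hkm.comp (measurable_fst.sub measurable_snd))
    have h1 := (enorm_integral_control_le hD hT.le hKm hh hR).trans
      (lintegral_conv_control_le (T := T) hkm hk hψm hψ hh hε)
    have h2 : ENNReal.ofReal P * (ENNReal.ofReal (ε / 2 * T * Q) +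
        ENNReal.ofReal (1 / (2 * ε)) * ∫⁻ s in Icc 0 T, ∫⁻ x, ENNReal.ofReal (h s x ^ 2)) ≤
        ENNReal.ofReal (P * (ε / 2 * T * Q + 1 / (2 * ε) * H)) := by
      rw [ENNReal.ofReal_mul hP, ENNReal.ofReal_add (by positivity) (by positivity),
        ENNReal.ofReal_mul (p := 1 / (2 * ε)) (by positivity)]
      gcongr
    have h3 := h1.trans h2
    rw [← ofReal_norm] at h3
    exact (ENNReal.ofReal_le_ofReal_iff (by positivity)).1 h3
  rw [← sq_abs, ← ha]
  have ha0 : 0 ≤ a := abs_nonneg _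
  rcases ha0.eq_or_lt with h0 | h0
  · rw [← h0, zero_pow two_ne_zero]
    positivity
  set B := P * T * Q with hB
  have hB0 : 0 ≤ B := by positivity
  rcases hB0.eq_or_lt with hBz | hBp
  · exfalso
    -- If `B = 0` only the term decreasing in `ε` survives, and a large `ε` contradicts `a > 0`.
    set ε := P * H / a + 1 with hε
    have hεp : 0 < ε := by positivity
    have h1 := key ε hεp
    have e : P * (ε / 2 * T * Q + 1 / (2 * ε) * H) = ε / 2 * B + P * H / (2 * ε) := by
      rw [hB]; ring
    rw [e, ← hBz, mul_zero, zero_add, le_div_iff₀ (by positivity)] at h1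
    have h2 : a * (2 * ε) = 2 * (P * H) + 2 * a := by rw [hε]; field_simp
    nlinarith [mul_nonneg hP hH0]
  -- With `ε = a / B` the first term is `a / 2` and is absorbed on the left.
  · have h1 := key (a / B) (by positivity)
    have e : P * (a / B / 2 * T * Q + 1 / (2 * (a / B)) * H) = a / 2 + P * B * H / (2 * a) := by
      have : P * (a / B / 2 * T * Q + 1 / (2 * (a / B)) * H) =
        a / B / 2 * B + P * (1 / (2 * (a / B)) * H) := by rw [hB]; ring
      rw [this]
      field_simp
    rw [e] at h1
    have h2 : a / 2 ≤ P * B * H / (2 * a) := by linarith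
    rw [le_div_iff₀ (by positivity)] at h2
    have e2 : P ^ 2 * T * Q * H = P * B * H := by rw [hB]; ring
    rw [e2]
    nlinarith

/-- Passing to measurable representatives of `k` and `h` changes neither the energy nor the mild
equation: reflections and translations preserve null sets, so `k(y - ·)` changes on a null set for
every `y`. -/
theorem displacement_sq_le (hD : 0 < D) (hF : IsAdmissibleFlux F uM uP)
    (hU : IsWaveProfile D F uM uP U) {T x₀ : ℝ} (hT : 0 < T) {k ψ : ℝ → ℝ} {h u : ℝ → ℝ → ℝ}
    (hk : Integrable k) (hψm : Measurable ψ)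
    (hψ : Integrable fun y => ψ y ^ 2) (hh : IsControl T h) {H : ℝ}
    (hH0 : 0 ≤ H) (hH : ∫⁻ s in Icc 0 T, ∫⁻ x, ENNReal.ofReal (h s x ^ 2) ≤ ENNReal.ofReal H)
    (hu : u ∈ displacementEvent U (waveSpeed F uM uP) T x₀)
    (hmild : IsMildSolution D F U (fun x x' => ψ x * k (x - x')) T h u) :
    (x₀ * (uP - uM)) ^ 2 ≤ (∫ z, |k z|) ^ 2 * T * (∫ y, ψ y ^ 2) * H := by
  obtain ⟨k', hk'm, hkk'⟩ := hk.aestronglyMeasurable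
  obtain ⟨g, hgm, hhg⟩ := hh.aestronglyMeasurable
  set h' : ℝ → ℝ → ℝ := fun s x => g (s, x) with hh'
  have hh'm : Measurable (Function.uncurry h') := hgm.measurable
  have hsl : ∀ᵐ s ∂(volume.restrict (Icc 0 T)), h s =ᵐ[volume] h' s :=
    Measure.ae_ae_of_ae_prod hhg
  have hkint : ∫ z, |k z| = ∫ z, |k' z| := integral_congr_ae (hkk'.mono fun z hz => by simp only [hz])
  rw [hkint]
  refine displacement_sq_le_of_measurable hD hF hU hT hk'm.measurable (hk.congr hkk') hψm hψ hh'm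
    hH0 ?_ hu ?_
  · refine le_trans (le_of_eq (lintegral_congr_ae ?_)) hH
    filter_upwards [hsl] with s hs
    exact lintegral_congr_ae (hs.mono fun x hx => by simp only [hx])
  · obtain ⟨h0, N, hN, hm⟩ := hmild
    refine ⟨h0, N, hN, fun t ht => (hm t ht).mono fun x hx => hx.trans ?_⟩
    congr 1
    rw [intervalIntegral.integral_of_le ht.1.le, intervalIntegral.integral_of_le ht.1.le]
    refine integral_congr_ae ?_
    have hsl' := ae_mono (Measure.restrict_mono (Ioc_subset_Icc_self.trans
      (Icc_subset_Icc_right ht.2)) le_rfl) hsl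
    filter_upwards [hsl'] with s hs
    congr 1
    ext y
    refine integral_congr_ae ?_
    have hky : ∀ᵐ x', k (y - x') = k' (y - x') :=
      (quasiMeasurePreserving_sub_left_of_right_invariant volume y).ae hkk'
    filter_upwards [hs, hky] with x' h1 h2
    rw [h1, h2]

end LowerBound

theorem integral_abs_rescale {φ : ℝ → ℝ} {lc : ℝ} (hlc : 0 < lc) :
    ∫ z, |1 / lc * φ (z / lc)| = ∫ z, |φ z| := by
  have h := Measure.integral_comp_div (fun z => |φ z|) lc
  simp only [abs_mul, integral_const_mul, h]
  rw [abs_of_pos hlc, abs_of_pos (by positivity), smul_eq_mul]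
  field_simp

/-- The constant is independent of `lc` because the rescaling of `φ₁` preserves its `L¹` norm; the
modulation `φ₀(·/L₀)` has squared `L²` norm proportional to `L₀`. -/
theorem exists_le_displacementCost {D : ℝ} {F : ℝ → ℝ} {uM uP : ℝ} {U φ₀ φ₁ : ℝ → ℝ} {σ : ℝ}
    (hD : 0 < D) (hF : IsAdmissibleFlux F uM uP) (hU : IsWaveProfile D F uM uP U)
    (hφ : IsNoiseProfile φ₀ φ₁) :
    ∃ c : ℝ, 0 < c ∧ ∀ T x₀ L₀ lc : ℝ, 0 < T → 0 < L₀ → 0 < lc →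
      ENNReal.ofReal (c * (x₀ ^ 2 / (T * L₀))) ≤
        displacementCost D F uM uP U (noiseKernel σ φ₀ φ₁ L₀ lc) T x₀ := by
  set P := ∫ z, |φ₁ z|
  set Q := ∫ y, φ₀ y ^ 2
  have hP : 0 ≤ P := integral_nonneg fun z => abs_nonneg _
  have hQ : 0 ≤ Q := integral_nonneg fun z => sq_nonneg _
  have hΔ : 0 < (uP - uM) ^ 2 := by
    have : uP - uM ≠ 0 := sub_ne_zero.2 hF.ne.symm
    positivity
  -- The summand `1` ensures that the denominator is positive without discussing the norms of `φ₀`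
  -- and `φ₁`.
  set E := P ^ 2 * σ ^ 2 * Q + 1 with hE
  have hE0 : 0 < E := by positivity
  refine ⟨(uP - uM) ^ 2 / (2 * E), by positivity, fun T x₀ L₀ lc hT hL hlc => ?_⟩
  refine le_iInf₂ fun u hu => le_iInf₂ fun h hh => ?_
  set H := ∫⁻ t in Icc 0 T, ∫⁻ x, ENNReal.ofReal (h t x ^ 2) with hH
  rcases eq_or_ne H ⊤ with htop | htop
  · rw [htop, ENNReal.mul_top (by simp)]
    exact le_top
  have hφ₀ : Integrable fun y => φ₀ y ^ 2 := hφ.memH1₀.1.integrable_sq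
  have hψint : ∫ y, (σ * φ₀ (y / L₀)) ^ 2 = σ ^ 2 * (L₀ * Q) := by
    have h := Measure.integral_comp_div (fun z => φ₀ z ^ 2) L₀
    simp only [mul_pow, integral_const_mul, h]
    rw [abs_of_pos hL, smul_eq_mul]
  have key := displacement_sq_le hD hF hU hT (k := fun z => 1 / lc * φ₁ (z / lc))
    (ψ := fun y => σ * φ₀ (y / L₀)) ((hφ.integrable₁.comp_div hlc.ne').const_mul _)
    ((hφ.smooth₀.continuous.measurable.comp (measurable_id.div_const L₀)).const_mul σ)
    (by
      have := (hφ₀.comp_div hL.ne').const_mul (σ ^ 2)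
      simpa only [mul_pow] using this) hh.1
    (H := H.toReal) ENNReal.toReal_nonneg (ENNReal.ofReal_toReal htop).ge hu hh.2
  rw [integral_abs_rescale hlc, hψint] at key
  have hhalf : (1 / 2 : ℝ≥0∞) * H = ENNReal.ofReal (1 / 2 * H.toReal) := by
    rw [ENNReal.ofReal_mul (by norm_num), ENNReal.ofReal_toReal htop]
    congr 1
    rw [ENNReal.ofReal_div_of_pos (by norm_num)]
    simp
  rw [hhalf]
  refine ENNReal.ofReal_le_ofReal ?_
  have hH0 : 0 ≤ H.toReal := ENNReal.toReal_nonneg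
  have h2 : x₀ ^ 2 * (uP - uM) ^ 2 ≤ E * (T * L₀) * H.toReal := by
    rw [← mul_pow]
    refine key.trans ?_
    have : 0 ≤ T * L₀ * H.toReal := by positivity
    rw [hE]
    nlinarith
  rw [div_mul_div_comm, div_le_iff₀ (by positivity)]
  linarith

/-! ### Fourier transform: Plancherel on `L¹ ∩ L²` and deconvolution -/

section Fourier

open SchwartzMap

theorem integral_fourier_mul_eq {f g : ℝ → ℂ} (hf : Integrable f) (hg : Integrable g) :
    ∫ ξ, 𝓕 f ξ * g ξ = ∫ x, f x * 𝓕 g x := by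
  have h := VectorFourier.integral_fourierIntegral_smul_eq_flip (μ := volume) (ν := volume)
    (L := innerₗ ℝ) Real.continuous_fourierChar continuous_inner hf hg
  rw [flip_innerₗ] at h
  exact h

/-- The `L²` Fourier transform and the Fourier integral agree a.e., because by duality both pair
with a test function `g` to `∫ m ĝ`. Plancherel then transfers to the Fourier integral. -/
theorem lintegral_enorm_fourier_sq {m : ℝ → ℂ} (h1 : Integrable m) (h2 : MemLp m 2) :
    ∫⁻ ξ, ‖𝓕 m ξ‖ₑ ^ 2 = ∫⁻ x, ‖m x‖ₑ ^ 2 := by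
  set G : Lp ℂ 2 (volume : Measure ℝ) := h2.toLp m
  have hcont : Continuous (𝓕 m) := VectorFourier.fourierIntegral_continuous
    Real.continuous_fourierChar continuous_inner h1
  have hae : ∀ᵐ x, (𝓕 G : Lp ℂ 2 (volume : Measure ℝ)) x = 𝓕 m x := by
    refine ae_eq_of_integral_contDiff_smul_eq
      ((Lp.memLp _).locallyIntegrable (by norm_num)) hcont.locallyIntegrable fun g hg hgs => ?_
    have hg₁ : HasCompactSupport (Complex.ofRealCLM ∘ g) := hgs.comp_left rfl
    have hg₂ : ContDiff ℝ ∞ (Complex.ofRealCLM ∘ g) := by fun_prop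
    set s : 𝓢(ℝ, ℂ) := hg₁.toSchwartzMap hg₂ with hs
    have e1 : ∫ x, g x • (𝓕 G : Lp ℂ 2 (volume : Measure ℝ)) x =
        Lp.toTemperedDistribution (𝓕 G : Lp ℂ 2 (volume : Measure ℝ)) s := by
      rw [Lp.toTemperedDistribution_apply]
      simp [hs]
    have e2 := congrArg (fun d : 𝓢'(ℝ, ℂ) => d s) (Lp.fourier_toTemperedDistribution_eq G)
    simp only [TemperedDistribution.fourier_apply, Lp.toTemperedDistribution_apply] at e2
    rw [e1, Lp.toTemperedDistribution_apply, ← e2]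
    have e3 : ∫ x, (𝓕 s) x • G x = ∫ x, m x * 𝓕 (s : ℝ → ℂ) x := by
      refine integral_congr_ae ?_
      filter_upwards [h2.coeFn_toLp] with x hx
      rw [hx, smul_eq_mul, mul_comm, SchwartzMap.fourier_coe]
    rw [e3, ← integral_fourier_mul_eq h1 s.integrable]
    refine integral_congr_ae (.of_forall fun x => ?_)
    simp [hs, mul_comm]
  have hn : ‖(𝓕 G : Lp ℂ 2 (volume : Measure ℝ))‖ₑ = ‖G‖ₑ := by
    rw [← ofReal_norm, ← ofReal_norm, Lp.norm_fourier_eq]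
  have key : ∀ H : Lp ℂ 2 (volume : Measure ℝ), ‖H‖ₑ ^ 2 = ∫⁻ x, ‖H x‖ₑ ^ 2 := fun H => by
    have := eLpNorm_nnreal_pow_eq_lintegral (f := H) (μ := volume) (p := 2) (by norm_num)
    simp only [NNReal.coe_ofNat, ENNReal.rpow_ofNat, ENNReal.coe_ofNat] at this
    rw [Lp.enorm_def, this]
  have h3 := congrArg (· ^ 2) hn
  simp only [key] at h3
  rw [lintegral_congr_ae (hae.mono fun x hx => by rw [← hx]), h3]
  exact lintegral_congr_ae (h2.coeFn_toLp.mono fun x hx => by simp only [G, hx])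

theorem fourier_const_add (g : ℝ → ℂ) (x ξ : ℝ) :
    𝓕 (fun y => g (x + y)) ξ = (Real.fourierChar (ξ * x) : ℂ) * 𝓕 g ξ := by
  rw [Real.fourier_real_eq, Real.fourier_real_eq, ← integral_const_mul,
    ← integral_add_left_eq_self (fun y => (Real.fourierChar (ξ * x) : ℂ) *
      (Real.fourierChar (-(y * ξ)) • g y)) x]
  refine integral_congr_ae (.of_forall fun y => ?_)
  simp only [Circle.smul_def, smul_eq_mul]
  rw [← mul_assoc, ← Circle.coe_mul, ← AddChar.map_add_eq_mul]
  ring_nf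

theorem fourier_rescale (g : ℝ → ℂ) {lc : ℝ} (hlc : 0 < lc) (ξ : ℝ) :
    𝓕 (fun z => (1 / lc : ℂ) * g (z / lc)) ξ = 𝓕 g (lc * ξ) := by
  rw [Real.fourier_real_eq, Real.fourier_real_eq]
  have h := Measure.integral_comp_div (fun z => Real.fourierChar (-(z * (lc * ξ))) • g z) lc
  rw [abs_of_pos hlc, ← inv_smul_eq_iff₀ hlc.ne', ← integral_smul] at h
  rw [← h]
  refine integral_congr_ae (.of_forall fun z => ?_)
  simp only [Circle.smul_def, smul_eq_mul, Complex.real_smul]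
  rw [show z / lc * (lc * ξ) = z * ξ by field_simp]
  push_cast
  ring

/-- Convolution of a kernel `k` with the inverse transform of `f̂ / k̂` gives `f` back. -/
theorem integral_mul_fourierInv_div {k f : ℝ → ℂ} (hk : Integrable k) (hf : Continuous f)
    (hfi : Integrable f) (hff : Integrable (𝓕 f)) (hk0 : ∀ ξ, 𝓕 k ξ ≠ 0)
    (hm : Integrable fun ξ => 𝓕 f ξ / 𝓕 k ξ) (x : ℝ) :
    ∫ x', k (x - x') * 𝓕⁻ (fun ξ => 𝓕 f ξ / 𝓕 k ξ) x' = f x := by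
  set m := fun ξ => 𝓕 f ξ / 𝓕 k ξ
  calc ∫ x', k (x - x') * 𝓕⁻ m x' = ∫ y, 𝓕 m y * k (x + y) := by
        rw [← integral_neg_eq_self]
        refine integral_congr_ae (.of_forall fun y => ?_)
        simp only [sub_neg_eq_add]
        rw [Real.fourierInv_eq_fourier_neg, neg_neg, mul_comm]
    _ = ∫ ξ, m ξ * 𝓕 (fun y => k (x + y)) ξ :=
        integral_fourier_mul_eq hm (hk.comp_add_left x)
    _ = 𝓕⁻ (𝓕 f) x := by
        rw [Real.fourierInv_eq]
        refine integral_congr_ae (.of_forall fun ξ => ?_)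
        simp only
        rw [fourier_const_add, Circle.smul_def, smul_eq_mul, mul_left_comm,
          div_mul_cancel₀ _ (hk0 ξ)]
        simp [mul_comm]
    _ = f x := by rw [hf.fourierInv_fourier_eq hfi hff]

end Fourier

/-! ### Families of functions with bounds on their derivatives -/

/-- The first `n` derivatives of the functions `f i` are bounded by a multiple of `w`, uniformly in
the index `i`. -/
def DerivBound {ι : Type*} (w : ℝ → ℝ) : ℕ → (ι → ℝ → ℝ) → Prop
  | 0, f => ∃ C, ∀ i x, |f i x| ≤ C * w x
  | n + 1, f => (∃ C, ∀ i x, |f i x| ≤ C * w x) ∧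
      ∃ f' : ι → ℝ → ℝ, (∀ i x, HasDerivAt (f i) (f' i x) x) ∧ DerivBound w n f'

namespace DerivBound

variable {ι : Type*} {w w₁ w₂ : ℝ → ℝ} {n : ℕ} {f g : ι → ℝ → ℝ}

theorem bound (h : DerivBound w n f) : ∃ C, ∀ i x, |f i x| ≤ C * w x := by
  cases n with
  | zero => exact h
  | succ n => exact h.1

theorem of_succ (h : DerivBound w (n + 1) f) : DerivBound w n f := by
  induction n generalizing f with
  | zero => exact h.1
  | succ n ih =>
    obtain ⟨h1, f', h2, h3⟩ := h
    exact ⟨h1, f', h2, ih h3⟩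

theorem mono_weight (h : DerivBound w₁ n f) {K : ℝ} (hw₁ : ∀ x, 0 ≤ w₁ x)
    (hK : ∀ x, w₁ x ≤ K * w₂ x) : DerivBound w₂ n f := by
  have key : ∀ {f : ι → ℝ → ℝ}, (∃ C, ∀ i x, |f i x| ≤ C * w₁ x) →
      ∃ C, ∀ i x, |f i x| ≤ C * w₂ x := fun ⟨C, hC⟩ => by
    refine ⟨|C| * K, fun i x => (hC i x).trans ?_⟩
    rw [mul_assoc]
    exact (mul_le_mul_of_nonneg_right (le_abs_self C) (hw₁ x)).trans
      (mul_le_mul_of_nonneg_left (hK x) (abs_nonneg C))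
  induction n generalizing f with
  | zero => exact key h
  | succ n ih =>
    obtain ⟨h1, f', h2, h3⟩ := h
    exact ⟨key h1, f', h2, ih h3⟩

theorem translate (h : DerivBound w₁ n f) {a : ι → ℝ} {K : ℝ} (hw₁ : ∀ x, 0 ≤ w₁ x)
    (hK : ∀ i x, w₁ (x - a i) ≤ K * w₂ x) : DerivBound w₂ n fun i x => f i (x - a i) := by
  have key : ∀ {f : ι → ℝ → ℝ}, (∃ C, ∀ i x, |f i x| ≤ C * w₁ x) →
      ∃ C, ∀ i x, |f i (x - a i)| ≤ C * w₂ x := fun ⟨C, hC⟩ => by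
    refine ⟨|C| * K, fun i x => (hC i _).trans ?_⟩
    rw [mul_assoc]
    exact (mul_le_mul_of_nonneg_right (le_abs_self C) (hw₁ _)).trans
      (mul_le_mul_of_nonneg_left (hK i x) (abs_nonneg C))
  induction n generalizing f with
  | zero => exact key h
  | succ n ih =>
    obtain ⟨h1, f', h2, h3⟩ := h
    exact ⟨key h1, fun i x => f' i (x - a i), fun i x => (h2 i _).comp_sub_const x (a i), ih h3⟩

theorem add (hf : DerivBound w n f) (hg : DerivBound w n g) :
    DerivBound w n fun i x => f i x + g i x := by
  have key : ∀ {f g : ι → ℝ → ℝ}, (∃ C, ∀ i x, |f i x| ≤ C * w x) →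
      (∃ C, ∀ i x, |g i x| ≤ C * w x) → ∃ C, ∀ i x, |f i x + g i x| ≤ C * w x :=
    fun ⟨C, hC⟩ ⟨C', hC'⟩ => ⟨C + C', fun i x => by
      rw [add_mul]; exact (abs_add_le _ _).trans (add_le_add (hC i x) (hC' i x))⟩
  induction n generalizing f g with
  | zero => exact key hf hg
  | succ n ih =>
    obtain ⟨h1, f', h2, h3⟩ := hf
    obtain ⟨h1', g', h2', h3'⟩ := hg
    exact ⟨key h1 h1', fun i x => f' i x + g' i x, fun i x => (h2 i x).add (h2' i x), ih h3 h3'⟩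

theorem const_mul (hf : DerivBound w n f) (hw : ∀ x, 0 ≤ w x) {c : ι → ℝ} {K : ℝ}
    (hc : ∀ i, |c i| ≤ K) : DerivBound w n fun i x => c i * f i x := by
  have key : ∀ {f : ι → ℝ → ℝ}, (∃ C, ∀ i x, |f i x| ≤ C * w x) →
      ∃ C, ∀ i x, |c i * f i x| ≤ C * w x := fun ⟨C, hC⟩ => by
    refine ⟨K * |C|, fun i x => ?_⟩
    rw [abs_mul, mul_assoc]
    refine mul_le_mul (hc i) ((hC i x).trans ?_) (abs_nonneg _) ((abs_nonneg _).trans (hc i))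
    exact mul_le_mul_of_nonneg_right (le_abs_self C) (hw x)
  induction n generalizing f with
  | zero => exact key hf
  | succ n ih =>
    obtain ⟨h1, f', h2, h3⟩ := hf
    exact ⟨key h1, fun i x => c i * f' i x, fun i x => (h2 i x).const_mul (c i), ih h3⟩

theorem sub (hf : DerivBound w n f) (hg : DerivBound w n g) (hw : ∀ x, 0 ≤ w x) :
    DerivBound w n fun i x => f i x - g i x := by
  have := hf.add (hg.const_mul hw (c := fun _ => -1) (K := 1) (by simp))
  simpa only [neg_mul, one_mul, ← sub_eq_add_neg] using this

theorem mul (hf : DerivBound w₁ n f) (hg : DerivBound w₂ n g) (hw₁ : ∀ x, 0 ≤ w₁ x) :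
    DerivBound (fun x => w₁ x * w₂ x) n fun i x => f i x * g i x := by
  have key : ∀ {f g : ι → ℝ → ℝ}, (∃ C, ∀ i x, |f i x| ≤ C * w₁ x) →
      (∃ C, ∀ i x, |g i x| ≤ C * w₂ x) → ∃ C, ∀ i x, |f i x * g i x| ≤ C * (w₁ x * w₂ x) :=
    fun ⟨C, hC⟩ ⟨C', hC'⟩ => ⟨|C| * C', fun i x => by
      rw [abs_mul, mul_mul_mul_comm]
      exact mul_le_mul ((hC i x).trans (mul_le_mul_of_nonneg_right (le_abs_self C) (hw₁ x)))
        (hC' i x) (abs_nonneg _) (mul_nonneg (abs_nonneg C) (hw₁ x))⟩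
  induction n generalizing f g with
  | zero => exact key hf hg
  | succ n ih =>
    have hf' := hf.of_succ
    have hg' := hg.of_succ
    obtain ⟨h1, f', h2, h3⟩ := hf
    obtain ⟨h1', g', h2', h3'⟩ := hg
    exact ⟨key h1 h1', _, fun i x => (h2 i x).mul (h2' i x), (ih h3 hg').add (ih hf' h3')⟩

theorem comp {G : ℝ → ℝ} {K : Set ℝ} (hK : IsCompact K) (hG : ∀ u ∈ K, ContDiffAt ℝ ∞ G u)
    (hf : DerivBound (fun _ => 1) n f) (hfK : ∀ i x, f i x ∈ K) :
    DerivBound (fun _ => 1) n fun i x => G (f i x) := by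
  have key : ∀ {G : ℝ → ℝ}, (∀ u ∈ K, ContDiffAt ℝ ∞ G u) →
      ∃ C : ℝ, ∀ i x, |G (f i x)| ≤ C * 1 := fun hG => by
    obtain ⟨C, hC⟩ := hK.exists_bound_of_continuousOn
      (fun u hu => (hG u hu).continuousAt.continuousWithinAt)
    exact ⟨C, fun i x => by rw [mul_one]; exact hC _ (hfK i x)⟩
  induction n generalizing G with
  | zero => exact key hG
  | succ n ih =>
    have hf' := hf.of_succ
    obtain ⟨h1, f', h2, h3⟩ := hf
    have hG' : ∀ u ∈ K, ContDiffAt ℝ ∞ (deriv G) u := fun u hu =>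
      (hG u hu).derivWithin (n := ∞) (m := ∞) (by simp)
    refine ⟨key hG, fun i x => deriv G (f i x) * f' i x, fun i x => ?_, ?_⟩
    · exact (((hG _ (hfK i x)).differentiableAt (by simp)).hasDerivAt).comp x (h2 i x)
    · simpa using (ih hG' hf').mul h3 (fun _ => zero_le_one)

theorem fourier_decay {w : ℝ → ℝ} (hw : Integrable w) (hf : DerivBound w n f) :
    ∃ C, ∀ i ξ, |ξ| ^ n * ‖𝓕 (fun x => (f i x : ℂ)) ξ‖ ≤ C := by
  have key : ∀ {f : ι → ℝ → ℝ}, (∃ C, ∀ i x, |f i x| ≤ C * w x) →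
      ∃ C, ∀ i ξ, ‖𝓕 (fun x => (f i x : ℂ)) ξ‖ ≤ C := fun ⟨C, hC⟩ => by
    refine ⟨∫ x, C * w x, fun i ξ => ?_⟩
    rw [Real.fourier_real_eq]
    refine norm_integral_le_of_norm_le (hw.const_mul C) (.of_forall fun x => ?_)
    rw [Circle.norm_smul, Complex.norm_real]
    exact hC i x
  have hint : ∀ {f : ι → ℝ → ℝ}, (∃ C, ∀ i x, |f i x| ≤ C * w x) → (∀ i, Measurable (f i)) →
      ∀ i, Integrable fun x => (f i x : ℂ) := fun ⟨C, hC⟩ hm i =>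
    ((hw.const_mul C).mono' (hm i).aestronglyMeasurable (.of_forall fun x => hC i x)).ofReal
  induction n generalizing f with
  | zero => simpa using key hf
  | succ n ih =>
    obtain ⟨h1, f', h2, h3⟩ := hf
    obtain ⟨C, hC⟩ := ih h3
    refine ⟨C / (2 * Real.pi), fun i ξ => ?_⟩
    have hder : deriv (fun x => (f i x : ℂ)) = fun x => (f' i x : ℂ) :=
      funext fun x => (h2 i x).ofReal_comp.deriv
    have hf'm : ∀ i, Measurable (f' i) := fun i => by
      rw [show f' i = deriv (f i) from funext fun x => (h2 i x).deriv.symm]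
      exact measurable_deriv _
    have hfm : ∀ i, Measurable (f i) := fun i =>
      (continuous_iff_continuousAt.2 fun x => (h2 i x).continuousAt).measurable
    have hF := congrFun (Real.fourier_deriv (f := fun x => (f i x : ℂ)) (hint h1 hfm i)
      (fun x => (h2 i x).ofReal_comp.differentiableAt)
      (by rw [hder]; exact hint h3.bound hf'm i)) ξ
    rw [hder] at hF
    have h4 := hC i ξ
    rw [hF, norm_smul] at h4
    have h5 : ‖(2 * Real.pi * Complex.I * ξ : ℂ)‖ = 2 * Real.pi * |ξ| := by
      simp [abs_of_pos Real.pi_pos]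
    rw [h5] at h4
    rw [le_div_iff₀ (by positivity)]
    rw [pow_succ]
    linarith

end DerivBound

/-! ### Controls realising a given forcing -/

section Control

theorem continuous_fourier_of_integrable {f : ℝ → ℂ} (hf : Integrable f) : Continuous (𝓕 f) :=
  VectorFourier.fourierIntegral_continuous Real.continuous_fourierChar continuous_inner hf

theorem integrable_inv_one_add_sq_sq : Integrable fun x : ℝ => ((1 + x ^ 2)⁻¹) ^ 2 := by
  refine integrable_inv_one_add_sq.mono' (by fun_prop) (.of_forall fun x => ?_)
  have h1 : (1 + x ^ 2)⁻¹ ≤ 1 := inv_le_one_of_one_le₀ (by nlinarith)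
  have h0 : 0 ≤ (1 + x ^ 2)⁻¹ := by positivity
  rw [Real.norm_of_nonneg (by positivity)]
  nlinarith

variable {φ₀ φ₁ : ℝ → ℝ}

/-- The decay of the transform of `f` beats the polynomial growth of `1/φ̂₁`. For `lc ≤ 1` one has
`|lc ξ| ≤ |ξ|`, so the bound is uniform in `lc` and can serve as a dominating function. -/
theorem IsNoiseProfile.exists_decay_div {ι : Type*} (hφ : IsNoiseProfile φ₀ φ₁)
    {f : ι → ℝ → ℝ} (hdec : ∀ n, DerivBound (fun x => (1 + x ^ 2)⁻¹) n f) :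
    ∃ C, 0 ≤ C ∧ ∀ i, ∀ lc ∈ Ioc (0 : ℝ) 1, ∀ ξ,
      ‖𝓕 (fun x => (f i x : ℂ)) ξ‖ ≤ C * (1 + ξ ^ 2)⁻¹ ∧
      ‖𝓕 (fun x => (f i x : ℂ)) ξ / 𝓕 (fun x => (φ₁ x : ℂ)) (lc * ξ)‖ ≤ C * (1 + ξ ^ 2)⁻¹ := by
  obtain ⟨B, k, hB⟩ := hφ.growth₁
  obtain ⟨C₀, hC₀⟩ := (hdec 0).fourier_decay integrable_inv_one_add_sq
  -- Of the derivatives, `k` pay for the growth of `1/φ̂₁` and two more yield the integrable weight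
  -- `(1 + ξ²)⁻¹`.
  obtain ⟨C₁, hC₁⟩ := (hdec (k + 2)).fourier_decay integrable_inv_one_add_sq
  have hB0 : 0 ≤ B := by
    have := hB 0
    simp only [abs_zero, add_zero, one_pow, mul_one] at this
    exact (inv_nonneg.2 (norm_nonneg _)).trans this
  set E := 2 ^ (k + 1) * (|C₀| + |C₁|) with hE
  have hpow : ∀ i ξ, (1 + |ξ|) ^ (k + 2) * ‖𝓕 (fun x => (f i x : ℂ)) ξ‖ ≤ E := fun i ξ => by
    have h1 := add_pow_le zero_le_one (abs_nonneg ξ) (k + 2)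
    have h2 := hC₀ i ξ
    have h3 := hC₁ i ξ
    rw [pow_zero, one_mul] at h2
    rw [one_pow, Nat.add_sub_cancel (n := k + 1) (m := 1)] at h1
    refine (mul_le_mul_of_nonneg_right h1 (norm_nonneg _)).trans ?_
    rw [hE, mul_assoc]
    refine mul_le_mul_of_nonneg_left ?_ (by positivity)
    rw [add_mul, one_mul]
    exact add_le_add (h2.trans (le_abs_self _)) (h3.trans (le_abs_self _))
  have hbase : ∀ i ξ, (1 + |ξ|) ^ k * ‖𝓕 (fun x => (f i x : ℂ)) ξ‖ ≤ E * (1 + ξ ^ 2)⁻¹ :=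
    fun i ξ => by
    rw [← div_eq_mul_inv, le_div_iff₀ (by positivity)]
    refine le_trans ?_ (hpow i ξ)
    have h1 : 1 + ξ ^ 2 ≤ (1 + |ξ|) ^ 2 := by
      nlinarith [abs_nonneg ξ, sq_abs ξ]
    rw [pow_add, mul_right_comm]
    gcongr
  refine ⟨(B + 1) * E, by positivity, fun i lc hlc ξ => ⟨?_, ?_⟩⟩
  · have h1 : 1 ≤ (1 + |ξ|) ^ k := one_le_pow₀ (by linarith [abs_nonneg ξ])
    have h2 := hbase i ξ
    have h3 : ‖𝓕 (fun x => (f i x : ℂ)) ξ‖ ≤ E * (1 + ξ ^ 2)⁻¹ :=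
      (le_mul_of_one_le_left (norm_nonneg _) h1).trans h2
    refine h3.trans ?_
    have : 0 ≤ E * (1 + ξ ^ 2)⁻¹ := by positivity
    nlinarith
  · rw [norm_div, div_eq_mul_inv]
    have h1 : ‖𝓕 (fun x => (φ₁ x : ℂ)) (lc * ξ)‖⁻¹ ≤ B * (1 + |ξ|) ^ k := by
      refine (hB (lc * ξ)).trans ?_
      rw [abs_mul, abs_of_pos hlc.1]
      have : lc * |ξ| ≤ |ξ| := mul_le_of_le_one_left (abs_nonneg _) hlc.2
      have := hlc.1
      gcongr
    have h2 := mul_le_mul_of_nonneg_left h1 (norm_nonneg (𝓕 (fun x => (f i x : ℂ)) ξ))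
    refine h2.trans ?_
    have h3 := mul_le_mul_of_nonneg_left (hbase i ξ) hB0
    have : 0 ≤ E * (1 + ξ ^ 2)⁻¹ := by positivity
    nlinarith

theorem stronglyMeasurable_fourier_param {f : ℝ → ℝ → ℂ}
    (hf : StronglyMeasurable (Function.uncurry f)) :
    StronglyMeasurable fun q : ℝ × ℝ => 𝓕 (f q.1) q.2 := by
  simp only [Real.fourier_real_eq]
  have : StronglyMeasurable fun q : (ℝ × ℝ) × ℝ =>
      Real.fourierChar (-(q.2 * q.1.2)) • f q.1.1 q.2 := by
    simp only [Circle.smul_def]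
    have h1 : Continuous fun q : (ℝ × ℝ) × ℝ => (Real.fourierChar (-(q.2 * q.1.2)) : ℂ) :=
      continuous_subtype_val.comp (Real.continuous_fourierChar.comp (by fun_prop))
    refine h1.stronglyMeasurable.smul ?_
    exact hf.comp_measurable (g := fun q : (ℝ × ℝ) × ℝ => (q.1.1, q.2)) (by fun_prop)
  exact this.integral_prod_right'

theorem memLp_two_of_decay {m : ℝ → ℂ} (hm : AEStronglyMeasurable m) {C : ℝ}
    (h : ∀ ξ, ‖m ξ‖ ≤ C * (1 + ξ ^ 2)⁻¹) : Integrable m ∧ MemLp m 2 := by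
  refine ⟨(integrable_inv_one_add_sq.const_mul C).mono' hm (.of_forall h), ?_⟩
  rw [memLp_two_iff_integrable_sq_norm hm]
  refine (integrable_inv_one_add_sq_sq.const_mul (C ^ 2)).mono' (hm.norm.pow 2)
    (.of_forall fun ξ => ?_)
  rw [Real.norm_of_nonneg (by positivity), ← mul_pow]
  exact pow_le_pow_left₀ (norm_nonneg _) (h ξ) 2

/-- The control is the inverse transform of `f̂(ξ) / φ̂₁(lc ξ)`. Since `φ̂₁(0) = 1`, its energy
tends by Plancherel and dominated convergence to that of `f`, hence falls below any strictly larger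
bound for small `lc`. -/
theorem exists_control_of_forcing {T : ℝ} (hφ : IsNoiseProfile φ₀ φ₁)
    {f : ℝ → ℝ → ℝ} (hf : Continuous (Function.uncurry f))
    (hdec : ∀ n, DerivBound (fun x => (1 + x ^ 2)⁻¹) n fun t : Icc 0 T => f t) {A : ℝ}
    (hA : ∫⁻ t in Icc 0 T, ∫⁻ x, ENNReal.ofReal (f t x ^ 2) < ENNReal.ofReal A) :
    ∀ᶠ lc in 𝓝[>] (0 : ℝ), ∃ h : ℝ → ℝ → ℝ, IsControl T h ∧
      (∀ t ∈ Icc 0 T, ∀ x, ∫ x', 1 / lc * φ₁ ((x - x') / lc) * h t x' = f t x) ∧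
      ∫⁻ t in Icc 0 T, ∫⁻ x, ENNReal.ofReal (h t x ^ 2) ≤ ENNReal.ofReal A := by
  obtain ⟨C, hC0, hC⟩ := hφ.exists_decay_div hdec
  have hft : ∀ t, Continuous (f t) := fun t => hf.comp (Continuous.prodMk_right t)
  set fh : ℝ → ℝ → ℂ := fun t => 𝓕 (fun x => (f t x : ℂ)) with hfh
  set p : ℝ → ℂ := 𝓕 (fun x => (φ₁ x : ℂ)) with hp
  have hpc : Continuous p := continuous_fourier_of_integrable hφ.integrable₁.ofReal
  set m : ℝ → ℝ → ℝ → ℂ := fun lc t ξ => fh t ξ / p (lc * ξ) with hm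
  have hfhm : StronglyMeasurable (Function.uncurry fh) :=
    stronglyMeasurable_fourier_param (f := fun t x => (f t x : ℂ))
      (Complex.continuous_ofReal.comp hf).stronglyMeasurable
  have hmm : ∀ lc, StronglyMeasurable (Function.uncurry (m lc)) := fun lc =>
    (hfhm.measurable.div ((hpc.comp (continuous_const.mul continuous_snd)).measurable
      )).stronglyMeasurable
  have hmm' : ∀ lc t, AEStronglyMeasurable (m lc t) := fun lc t =>
    ((hmm lc).comp_measurable measurable_prodMk_left).aestronglyMeasurable
  have hfi : ∀ t ∈ Icc 0 T, Integrable (fun x => (f t x : ℂ)) ∧ MemLp (fun x => (f t x : ℂ)) 2 :=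
    fun t ht => by
    obtain ⟨B, hB⟩ := (hdec 0).bound
    exact memLp_two_of_decay (Complex.continuous_ofReal.comp (hft t)).aestronglyMeasurable
      (C := B) fun x => by rw [Complex.norm_real]; exact hB ⟨t, ht⟩ x
  have hmi : ∀ lc ∈ Ioc (0 : ℝ) 1, ∀ t ∈ Icc 0 T, Integrable (m lc t) ∧ MemLp (m lc t) 2 :=
    fun lc hlc t ht => memLp_two_of_decay (hmm' lc t) fun ξ => (hC ⟨t, ht⟩ lc hlc ξ).2
  have hfhi : ∀ t ∈ Icc 0 T, Integrable (fh t) := fun t ht =>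
    (memLp_two_of_decay (hfhm.comp_measurable measurable_prodMk_left).aestronglyMeasurable
      fun ξ => (hC ⟨t, ht⟩ 1 ⟨one_pos, le_rfl⟩ ξ).1).1
  have hlim : Tendsto (fun lc => ∫⁻ t in Icc 0 T, ∫⁻ ξ, ‖m lc t ξ‖ₑ ^ 2) (𝓝[>] 0)
      (𝓝 (∫⁻ t in Icc 0 T, ∫⁻ x, ENNReal.ofReal (f t x ^ 2))) := by
    have e1 : ∫⁻ t in Icc 0 T, ∫⁻ x, ENNReal.ofReal (f t x ^ 2) =
        ∫⁻ q, ‖fh q.1 q.2‖ₑ ^ 2 ∂((volume.restrict (Icc 0 T)).prod volume) := by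
      rw [lintegral_prod (fun q : ℝ × ℝ => ‖fh q.1 q.2‖ₑ ^ 2) (hfhm.enorm.pow_const 2).aemeasurable]
      refine setLIntegral_congr_fun measurableSet_Icc fun t ht => ?_
      simp only [hfh]
      rw [lintegral_enorm_fourier_sq (hfi t ht).1 (hfi t ht).2]
      refine lintegral_congr fun x => ?_
      rw [← ofReal_norm, Complex.norm_real, ← ENNReal.ofReal_pow (norm_nonneg _),
        Real.norm_eq_abs, sq_abs]
    have e2 : ∀ lc, ∫⁻ t in Icc 0 T, ∫⁻ ξ, ‖m lc t ξ‖ₑ ^ 2 =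
        ∫⁻ q, ‖m lc q.1 q.2‖ₑ ^ 2 ∂((volume.restrict (Icc 0 T)).prod volume) := fun lc =>
      (lintegral_prod _ ((hmm lc).enorm.pow_const 2).aemeasurable).symm
    rw [e1]
    simp only [e2]
    have hIoc : ∀ᶠ lc in 𝓝[>] (0 : ℝ), lc ∈ Ioc (0 : ℝ) 1 := Ioc_mem_nhdsGT one_pos
    have hae : ∀ᵐ q : ℝ × ℝ ∂((volume.restrict (Icc 0 T)).prod volume), q.1 ∈ Icc 0 T := by
      have h : ∀ᵐ t ∂(volume.restrict (Icc 0 T)), t ∈ Icc 0 T := ae_restrict_mem measurableSet_Icc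
      exact Measure.quasiMeasurePreserving_fst.ae h
    refine tendsto_lintegral_filter_of_dominated_convergence
      (fun q => ENNReal.ofReal (C * (1 + q.2 ^ 2)⁻¹) ^ 2)
      (.of_forall fun lc => (hmm lc).enorm.pow_const 2) ?_ ?_ ?_
    · filter_upwards [hIoc] with lc hlc
      filter_upwards [hae] with q hq
      rw [← ofReal_norm]
      gcongr
      exact (hC ⟨q.1, hq⟩ lc hlc q.2).2
    · have hi : Integrable (fun q : ℝ × ℝ => C ^ 2 * ((1 + q.2 ^ 2)⁻¹) ^ 2)
          ((volume.restrict (Icc 0 T)).prod volume) :=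
        (integrable_inv_one_add_sq_sq.comp_snd (volume.restrict (Icc 0 T))).const_mul _
      refine ne_of_eq_of_ne (lintegral_congr fun q => ?_) hi.lintegral_lt_top.ne
      rw [← ENNReal.ofReal_pow (by positivity), mul_pow]
    · refine .of_forall fun q => ?_
      have h1 : Tendsto (fun lc : ℝ => p (lc * q.2)) (𝓝[>] 0) (𝓝 (p 0)) := by
        refine ((hpc.tendsto 0).comp ?_).mono_left nhdsWithin_le_nhds
        have : Continuous fun lc : ℝ => lc * q.2 := by fun_prop
        simpa using this.tendsto 0
      have h2 : Tendsto (fun lc => m lc q.1 q.2) (𝓝[>] 0) (𝓝 (fh q.1 q.2 / p 0)) :=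
        tendsto_const_nhds.div h1 (hφ.fourier_φ₁_ne_zero 0)
      rw [show p 0 = 1 from hφ.fourier_φ₁_zero, div_one] at h2
      exact ((ENNReal.continuous_pow 2).tendsto _).comp h2.enorm
  have hIoc : ∀ᶠ lc in 𝓝[>] (0 : ℝ), lc ∈ Ioc (0 : ℝ) 1 := Ioc_mem_nhdsGT one_pos
  filter_upwards [hIoc, hlim.eventually (gt_mem_nhds hA)] with lc hlc hlt
  -- Taking real parts does not increase the norm and commutes with convolution by the real kernel,
  -- so no symmetry argument is needed to make the control real.
  set h : ℝ → ℝ → ℝ := fun t x => (𝓕⁻ (m lc t) x).re with hh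
  have hhm : StronglyMeasurable (Function.uncurry h) := by
    have h1 := (stronglyMeasurable_fourier_param (hmm lc)).comp_measurable
      (g := fun q : ℝ × ℝ => (q.1, -q.2)) (by fun_prop)
    have h2 := Complex.continuous_re.comp_stronglyMeasurable h1
    convert h2 using 1
    ext q
    simp only [hh, Function.uncurry, Function.comp, Real.fourierInv_eq_fourier_neg]
  have hbound : ∫⁻ t in Icc 0 T, ∫⁻ x, ENNReal.ofReal (h t x ^ 2) ≤
      ∫⁻ t in Icc 0 T, ∫⁻ ξ, ‖m lc t ξ‖ₑ ^ 2 := by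
    refine setLIntegral_mono' measurableSet_Icc fun t ht => ?_
    rw [← lintegral_enorm_fourier_sq (hmi lc hlc t ht).1 (hmi lc hlc t ht).2,
      ← lintegral_neg_eq_self]
    refine lintegral_mono fun x => ?_
    rw [← ofReal_norm, ← ENNReal.ofReal_pow (norm_nonneg _)]
    refine ENNReal.ofReal_le_ofReal ?_
    simp only [hh, Real.fourierInv_eq_fourier_neg, neg_neg]
    rw [← sq_abs]
    exact pow_le_pow_left₀ (abs_nonneg _) (Complex.abs_re_le_norm _) 2
  refine ⟨h, ?_, fun t ht x => ?_, hbound.trans hlt.le⟩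
  · rw [IsControl, memLp_two_iff_integrable_sq hhm.aestronglyMeasurable]
    refine ⟨(hhm.pow 2).aestronglyMeasurable, ?_⟩
    rw [hasFiniteIntegral_iff_ofReal (.of_forall fun q => sq_nonneg _)]
    rw [lintegral_prod _ ((hhm.measurable.pow_const 2).ennreal_ofReal).aemeasurable]
    exact (hbound.trans_lt hlt).trans ENNReal.ofReal_lt_top
  · set k : ℝ → ℂ := fun z => (1 / lc : ℂ) * (φ₁ (z / lc) : ℂ) with hk
    have hki : Integrable k := (hφ.integrable₁.comp_div hlc.1.ne').ofReal.const_mul _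
    have hFk : 𝓕 k = fun ξ => p (lc * ξ) :=
      funext fun ξ => fourier_rescale (fun x => (φ₁ x : ℂ)) hlc.1 ξ
    have hmt := (hmi lc hlc t ht).1
    have key := integral_mul_fourierInv_div (k := k) (f := fun x => (f t x : ℂ)) hki
      (Complex.continuous_ofReal.comp (hft t)) (hfi t ht).1 (hfhi t ht)
      (fun ξ => by rw [hFk]; exact hφ.fourier_φ₁_ne_zero _) (by rw [hFk]; exact hmt) x
    rw [hFk] at key
    have hki' : Integrable fun x' => k (x - x') * 𝓕⁻ (m lc t) x' := by
      have hcont : Continuous (𝓕⁻ (m lc t)) := by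
        rw [Real.fourierInv_eq_fourier_comp_neg]
        exact continuous_fourier_of_integrable hmt.comp_neg
      refine (hki.comp_sub_left x).mul_bdd (c := ∫ ξ, ‖m lc t ξ‖) hcont.aestronglyMeasurable
        (.of_forall fun x' => ?_)
      rw [Real.fourierInv_eq]
      refine (norm_integral_le_integral_norm _).trans (le_of_eq ?_)
      simp only [Circle.norm_smul]
    have hre := congrArg Complex.re key
    rw [Complex.ofReal_re] at hre
    rw [← hre]
    have := Complex.reCLM.integral_comp_comm hki'
    simp only [Complex.reCLM_apply] at this
    change _ = (∫ x', k (x - x') * 𝓕⁻ (m lc t) x').re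
    rw [← this]
    refine integral_congr_ae (.of_forall fun x' => ?_)
    simp only [hk, hh]
    rw [← Complex.ofReal_one, ← Complex.ofReal_div, ← Complex.ofReal_mul, Complex.re_ofReal_mul]

end Control

/-! ### Duhamel's formula for classical solutions -/

section Duhamel

variable {D t C : ℝ}

/-- The rescaled form is continuous up to `s = t`, where it equals `g t x`, whereas `heatSemigroup D
0` is zero by the conventions on division. -/
theorem continuousOn_integral_scaled (hD : 0 < D) {g : ℝ → ℝ → ℝ}
    (hg : Continuous (Function.uncurry g)) (hb : ∀ s ∈ Icc 0 t, ∀ x, |g s x| ≤ C) (x : ℝ) :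
    ContinuousOn (fun s => ∫ z, heatKernel D 1 z * g s (x - √(t - s) * z)) (Icc 0 t) := by
  have hG := continuous_heatKernel D 1
  refine continuousOn_of_dominated (bound := fun z => heatKernel D 1 z * C) (fun s _ => ?_)
    (fun s hs => .of_forall fun z => ?_) ((integrable_heatKernel hD one_pos).mul_const C)
    (.of_forall fun z => Continuous.continuousOn ?_)
  · exact (hG.mul (hg.comp (f := fun z : ℝ => (s, x - √(t - s) * z))
      (by fun_prop))).aestronglyMeasurable
  · rw [norm_mul, Real.norm_of_nonneg (heatKernel_nonneg _ _ _)]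
    exact mul_le_mul_of_nonneg_left (hb s hs _) (heatKernel_nonneg _ _ _)
  · exact continuous_const.mul (hg.comp (f := fun s : ℝ => (s, x - √(t - s) * z)) (by fun_prop))

theorem heatSemigroup_ae_eq_scaled {g : ℝ → ℝ → ℝ} (x : ℝ) :
    ∀ᵐ s, s ∈ uIoc 0 t → 0 ≤ t → ∫ z, heatKernel D 1 z * g s (x - √(t - s) * z) =
      heatSemigroup D (t - s) (g s) x := by
  have : ∀ᵐ s : ℝ, s ≠ t := by simp [ae_iff]
  filter_upwards [this] with s hst hs ht
  rw [uIoc_of_le ht] at hs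
  rw [heatSemigroup_eq_scaled (sub_pos.2 (lt_of_le_of_ne hs.2 hst))]

theorem intervalIntegrable_heatSemigroup (hD : 0 < D) (ht : 0 ≤ t) {g : ℝ → ℝ → ℝ}
    (hg : Continuous (Function.uncurry g)) (hb : ∀ s ∈ Icc 0 t, ∀ x, |g s x| ≤ C) (x : ℝ) :
    IntervalIntegrable (fun s => heatSemigroup D (t - s) (g s) x) volume 0 t := by
  have h := (continuousOn_integral_scaled hD hg hb x).intervalIntegrable_of_Icc ht (μ := volume)
  refine h.congr_ae ?_
  exact (ae_restrict_iff' measurableSet_uIoc).2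
    ((heatSemigroup_ae_eq_scaled x).mono fun s hs hs' => hs hs' ht)

/-- Integration by parts with `G' = -(z / 2D) G` for the Gaussian `G`: a factor `z` is traded for a
space derivative. -/
theorem integral_id_mul_heatKernel_mul (hD : 0 < D) {f f' : ℝ → ℝ} {c : ℝ}
    (hf : ∀ z, HasDerivAt f (f' z) z) (hf' : Continuous f') (hb : ∀ z, |f z| ≤ C)
    (hb' : ∀ z, |f' z| ≤ C) (x : ℝ) :
    ∫ z, heatKernel D 1 z * (z * f (x - c * z)) =
      -(2 * D * c) * ∫ z, heatKernel D 1 z * f' (x - c * z) := by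
  have hG := continuous_heatKernel D 1
  have hGi := integrable_heatKernel hD one_pos
  have hfc : Continuous f := continuous_iff_continuousAt.2 fun z => (hf z).continuousAt
  have hi1 : Integrable fun z => heatKernel D 1 z * f' (x - c * z) :=
    hGi.mul_bdd (c := C) (hf'.comp (by fun_prop)).aestronglyMeasurable (.of_forall fun z => hb' _)
  have hi2 : Integrable fun z => heatKernel D 1 z * f (x - c * z) :=
    hGi.mul_bdd (c := C) (hfc.comp (by fun_prop)).aestronglyMeasurable (.of_forall fun z => hb _)
  have hi3 : Integrable fun z => z * heatKernel D 1 z * f (x - c * z) :=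
    (integrable_id_mul_heatKernel hD one_pos).mul_bdd (c := C)
      (hfc.comp (by fun_prop)).aestronglyMeasurable (.of_forall fun z => hb _)
  have hd : ∀ z, HasDerivAt (fun z => f (x - c * z)) (-c * f' (x - c * z)) z := fun z => by
    have h1 : HasDerivAt (fun z => x - c * z) (-c) z := by
      simpa using ((hasDerivAt_id z).const_mul c).const_sub x
    exact ((hf (x - c * z)).comp z h1).congr_deriv (by ring)
  have h := integral_mul_deriv_eq_deriv_mul_of_integrable (u := fun z => f (x - c * z))
    (v := heatKernel D 1) (fun z _ => hd z) (fun z _ => hasDerivAt_heatKernel_one hD z)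
    (by
      refine (hi3.const_mul (-(1 / (2 * D)))).congr (.of_forall fun z => ?_)
      simp only [Pi.mul_apply]; ring)
    (by
      refine (hi1.const_mul (-c)).congr (.of_forall fun z => ?_)
      simp only [Pi.mul_apply]; ring)
    (by
      refine hi2.congr (.of_forall fun z => ?_)
      simp only [Pi.mul_apply]; ring)
  have e1 : ∫ z, f (x - c * z) * (-(z / (2 * D)) * heatKernel D 1 z) =
      -(1 / (2 * D)) * ∫ z, heatKernel D 1 z * (z * f (x - c * z)) := by
    rw [← integral_const_mul]
    exact integral_congr_ae (.of_forall fun z => by simp only; ring)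
  have e2 : ∫ z, -c * f' (x - c * z) * heatKernel D 1 z =
      -c * ∫ z, heatKernel D 1 z * f' (x - c * z) := by
    rw [← integral_const_mul]
    exact integral_congr_ae (.of_forall fun z => by simp only; ring)
  rw [e1, e2] at h
  generalize (∫ z, heatKernel D 1 z * (z * f (x - c * z))) = I at h ⊢
  generalize (∫ z, heatKernel D 1 z * f' (x - c * z)) = I' at h ⊢
  field_simp at h
  linarith

/-- The moving argument `x - √(t-s) z` produces `u₁` times `z / (2√(t-s))`, and integration by parts
against the Gaussian turns this into `-D u₂`. The hypothesis `hder`, a chain rule along curves, is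
exactly what the differentiation under the integral needs. -/
theorem hasDerivAt_integral_scaled (hD : 0 < D) {u v u₁ u₂ : ℝ → ℝ → ℝ}
    (hu : Continuous (Function.uncurry u)) (hv : Continuous (Function.uncurry v))
    (hu₁ : Continuous (Function.uncurry u₁)) (hu₂ : Continuous (Function.uncurry u₂))
    (hder : ∀ s (y : ℝ → ℝ) (y' : ℝ), HasDerivAt y y' s →
      HasDerivAt (fun r => u r (y r)) (v s (y s) + u₁ s (y s) * y') s)
    (hder₁ : ∀ s x, HasDerivAt (u₁ s) (u₂ s x) x)
    (hb : ∀ s ∈ Icc 0 t, ∀ x, |u s x| ≤ C ∧ |v s x| ≤ C ∧ |u₁ s x| ≤ C ∧ |u₂ s x| ≤ C)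
    {s : ℝ} (hs : s ∈ Ioo 0 t) (x : ℝ) :
    HasDerivAt (fun s => ∫ z, heatKernel D 1 z * u s (x - √(t - s) * z))
      (∫ z, heatKernel D 1 z * (v s (x - √(t - s) * z) - D * u₂ s (x - √(t - s) * z))) s := by
  have hG := continuous_heatKernel D 1
  have hGi := integrable_heatKernel hD one_pos
  have hGi' := (integrable_id_mul_heatKernel hD one_pos).abs
  have hC : 0 ≤ C := (abs_nonneg _).trans (hb s ⟨hs.1.le, hs.2.le⟩ 0).1
  set U' : ℝ → ℝ → ℝ := fun r z => heatKernel D 1 z * (v r (x - √(t - r) * z) +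
    u₁ r (x - √(t - r) * z) * (1 / (2 * √(t - r)) * z)) with hU'
  -- Stopping halfway between `s` and `t` keeps `√(t - r)` away from zero, so one dominating
  -- function serves the whole neighbourhood.
  have hball : ∀ r ∈ Ioo 0 ((s + t) / 2), r ∈ Ioo 0 t ∧ (t - s) / 2 ≤ t - r := fun r hr =>
    ⟨⟨hr.1, by linarith [hr.2, hs.2]⟩, by linarith [hr.2]⟩
  have hnhds : Ioo 0 ((s + t) / 2) ∈ 𝓝 s := Ioo_mem_nhds hs.1 (by linarith [hs.2])
  have hts : 0 < (t - s) / 2 := by linarith [hs.2]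
  have h := (hasDerivAt_integral_of_dominated_loc_of_deriv_le (μ := volume) (𝕜 := ℝ)
    (F := fun s z => heatKernel D 1 z * u s (x - √(t - s) * z)) (F' := U') (x₀ := s)
    (bound := fun z => C * heatKernel D 1 z +
      C * (1 / (2 * √((t - s) / 2))) * |z * heatKernel D 1 z|) hnhds
    (.of_forall fun r => (hG.mul (hu.comp (f := fun z : ℝ => (r, x - √(t - r) * z))
      (by fun_prop))).aestronglyMeasurable)
    (hGi.mul_bdd (c := C) (hu.comp (f := fun z : ℝ => (s, x - √(t - s) * z))
      (by fun_prop)).aestronglyMeasurable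
      (.of_forall fun z => (hb s ⟨hs.1.le, hs.2.le⟩ _).1))
    ?_ (.of_forall fun z r hr => ?_) ((hGi.const_mul C).add (hGi'.const_mul _))
    (.of_forall fun z r hr => ?_)).2
  · refine h.congr_deriv ?_
    have hsqrt : 0 < √(t - s) := Real.sqrt_pos.2 (by linarith [hs.2])
    have hs' : s ∈ Icc 0 t := ⟨hs.1.le, hs.2.le⟩
    have st := integral_id_mul_heatKernel_mul (C := C) (c := √(t - s)) hD (hder₁ s)
      (hu₂.comp (Continuous.prodMk_right s)) (fun z => (hb s hs' z).2.2.1)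
      (fun z => (hb s hs' z).2.2.2) x
    have i1 : Integrable fun z => heatKernel D 1 z * v s (x - √(t - s) * z) :=
      hGi.mul_bdd (c := C) (hv.comp (f := fun z : ℝ => (s, x - √(t - s) * z))
        (by fun_prop)).aestronglyMeasurable (.of_forall fun z => (hb s hs' _).2.1)
    have i2 : Integrable fun z => heatKernel D 1 z * u₂ s (x - √(t - s) * z) :=
      hGi.mul_bdd (c := C) (hu₂.comp (f := fun z : ℝ => (s, x - √(t - s) * z))
        (by fun_prop)).aestronglyMeasurable (.of_forall fun z => (hb s hs' _).2.2.2)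
    have i3 : Integrable fun z => heatKernel D 1 z * (z * u₁ s (x - √(t - s) * z)) := by
      have : Integrable fun z => z * heatKernel D 1 z * u₁ s (x - √(t - s) * z) :=
        (integrable_id_mul_heatKernel hD one_pos).mul_bdd (c := C)
          (hu₁.comp (f := fun z : ℝ => (s, x - √(t - s) * z))
            (by fun_prop)).aestronglyMeasurable (.of_forall fun z => (hb s hs' _).2.2.1)
      exact this.congr (.of_forall fun z => by simp only; ring)
    have e1 : ∫ z, U' s z = (∫ z, heatKernel D 1 z * v s (x - √(t - s) * z)) +
        1 / (2 * √(t - s)) * ∫ z, heatKernel D 1 z * (z * u₁ s (x - √(t - s) * z)) := by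
      rw [← integral_const_mul, ← integral_add i1 (i3.const_mul _)]
      exact integral_congr_ae (.of_forall fun z => by simp only [hU']; ring)
    have e2 : ∫ z, heatKernel D 1 z * (v s (x - √(t - s) * z) - D * u₂ s (x - √(t - s) * z)) =
        (∫ z, heatKernel D 1 z * v s (x - √(t - s) * z)) -
          D * ∫ z, heatKernel D 1 z * u₂ s (x - √(t - s) * z) := by
      rw [← integral_const_mul, ← integral_sub i1 (i2.const_mul _)]
      exact integral_congr_ae (.of_forall fun z => by simp only; ring)
    rw [e1, e2, st]
    field_simp
    ring
  · refine (hG.mul ((hv.comp (f := fun z : ℝ => (s, x - √(t - s) * z)) (by fun_prop)).add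
      ((hu₁.comp (f := fun z : ℝ => (s, x - √(t - s) * z)) (by fun_prop)).mul
        (by fun_prop)))).aestronglyMeasurable
  · obtain ⟨hr1, hr2⟩ := hball r hr
    have hr' : r ∈ Icc 0 t := ⟨hr1.1.le, hr1.2.le⟩
    have h1 := (hb r hr' (x - √(t - r) * z)).2.1
    have h2 := (hb r hr' (x - √(t - r) * z)).2.2.1
    have h3 : 1 / (2 * √(t - r)) ≤ 1 / (2 * √((t - s) / 2)) := by
      have := Real.sqrt_pos.2 hts
      gcongr
    have h4 : 0 ≤ 1 / (2 * √(t - r)) := by positivity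
    have hGz := heatKernel_nonneg D 1 z
    simp only [hU']
    rw [norm_mul, Real.norm_of_nonneg hGz, abs_mul z, abs_of_nonneg hGz]
    have h5 : ‖v r (x - √(t - r) * z) + u₁ r (x - √(t - r) * z) * (1 / (2 * √(t - r)) * z)‖ ≤
        C + C * (1 / (2 * √((t - s) / 2)) * |z|) := by
      refine (norm_add_le _ _).trans (add_le_add h1 ?_)
      rw [norm_mul, norm_mul, Real.norm_of_nonneg h4]
      gcongr
      · exact h2
      · exact le_rfl
    refine (mul_le_mul_of_nonneg_left h5 hGz).trans (le_of_eq ?_)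
    ring
  · obtain ⟨hr1, hr2⟩ := hball r hr
    have hpos : 0 < t - r := by linarith
    have h1 : HasDerivAt (fun r => x - √(t - r) * z) (1 / (2 * √(t - r)) * z) r := by
      have := ((((hasDerivAt_id r).const_sub t).sqrt hpos.ne').mul_const z).const_sub x
      refine this.congr_deriv ?_
      simp only [id]
      ring
    exact (hder r _ _ h1).const_mul _

/-- The fundamental theorem of calculus for `s ↦ S(t-s) u(s)`, used in its rescaled form so that it
is continuous at `s = t`. -/
theorem duhamel (hD : 0 < D) (ht : 0 < t) {u v u₁ u₂ : ℝ → ℝ → ℝ}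
    (hu : Continuous (Function.uncurry u)) (hv : Continuous (Function.uncurry v))
    (hu₁ : Continuous (Function.uncurry u₁)) (hu₂ : Continuous (Function.uncurry u₂))
    (hder : ∀ s (y : ℝ → ℝ) (y' : ℝ), HasDerivAt y y' s →
      HasDerivAt (fun r => u r (y r)) (v s (y s) + u₁ s (y s) * y') s)
    (hder₁ : ∀ s x, HasDerivAt (u₁ s) (u₂ s x) x)
    (hb : ∀ s ∈ Icc 0 t, ∀ x, |u s x| ≤ C ∧ |v s x| ≤ C ∧ |u₁ s x| ≤ C ∧ |u₂ s x| ≤ C)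
    (x : ℝ) :
    u t x = heatSemigroup D t (u 0) x +
      ∫ s in (0 : ℝ)..t, heatSemigroup D (t - s) (fun y => v s y - D * u₂ s y) x := by
  have hC : 0 ≤ C := (abs_nonneg _).trans (hb 0 ⟨le_rfl, ht.le⟩ 0).1
  have hg : Continuous (Function.uncurry fun s y => v s y - D * u₂ s y) :=
    hv.sub (continuous_const.mul hu₂)
  have hgb : ∀ s ∈ Icc 0 t, ∀ x, |v s x - D * u₂ s x| ≤ C + D * C := fun s hs x => by
    refine (abs_sub _ _).trans (add_le_add (hb s hs x).2.1 ?_)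
    rw [abs_mul, abs_of_pos hD]
    exact mul_le_mul_of_nonneg_left (hb s hs x).2.2.2 hD.le
  have hcont := continuousOn_integral_scaled hD hu (fun s hs x => (hb s hs x).1) x
  have hint := (continuousOn_integral_scaled hD hg hgb x).intervalIntegrable_of_Icc ht.le
    (μ := volume)
  have h := intervalIntegral.integral_eq_sub_of_hasDerivAt_of_le ht.le hcont
    (fun s hs => hasDerivAt_integral_scaled hD hu hv hu₁ hu₂ hder hder₁ hb hs x) hint
  rw [intervalIntegral.integral_congr_ae ((heatSemigroup_ae_eq_scaled
    (g := fun s y => v s y - D * u₂ s y) x).mono fun s hs hs' => hs hs' ht.le)] at h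
  rw [h, sub_zero, ← heatSemigroup_eq_scaled ht]
  simp [integral_mul_const, integral_heatKernel hD one_pos]

end Duhamel

/-! ### Classical solutions as elements of the path space and as mild solutions -/

section Classical

variable {D T C : ℝ} {U F w : ℝ → ℝ} {u v u₁ u₂ : ℝ → ℝ → ℝ}

theorem tendsto_eLpNorm_of_lipschitz (hw : MemLp w 2) (hC : 0 ≤ C)
    (hlip : ∀ s ∈ Icc 0 T, ∀ t ∈ Icc 0 T, ∀ x, |u s x - u t x| ≤ C * |s - t| * w x)
    {t : ℝ} (ht : t ∈ Icc 0 T) :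
    Tendsto (fun s => eLpNorm (fun x => u s x - u t x) 2 volume) (𝓝[Icc 0 T] t) (𝓝 0) := by
  have h1 : Tendsto (fun s => ENNReal.ofReal (C * |s - t|) * eLpNorm w 2 volume)
      (𝓝[Icc 0 T] t) (𝓝 0) := by
    have h2 : Tendsto (fun s => ENNReal.ofReal (C * |s - t|)) (𝓝[Icc 0 T] t) (𝓝 0) := by
      have h3 : Continuous fun s => ENNReal.ofReal (C * |s - t|) :=
        ENNReal.continuous_ofReal.comp (by fun_prop)
      have := (h3.tendsto t).mono_left (nhdsWithin_le_nhds (s := Icc 0 T))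
      simpa using this
    have := ENNReal.Tendsto.mul_const h2 (Or.inr hw.eLpNorm_ne_top)
    simpa using this
  refine tendsto_of_tendsto_of_tendsto_of_le_of_le' tendsto_const_nhds h1
    (.of_forall fun _ => zero_le) ?_
  filter_upwards [self_mem_nhdsWithin] with s hs
  refine eLpNorm_le_mul_eLpNorm_of_ae_le_mul (.of_forall fun x => ?_) 2
  have := hlip s hs t ht x
  refine (Real.norm_eq_abs _).le.trans (this.trans ?_)
  exact mul_le_mul_of_nonneg_left (le_abs_self _) (by positivity)

theorem memLp_sub_of_lipschitz (hw : MemLp w 2) (hu : Continuous (Function.uncurry u))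
    (hlip : ∀ s ∈ Icc 0 T, ∀ t ∈ Icc 0 T, ∀ x, |u s x - u t x| ≤ C * |s - t| * w x)
    {s t : ℝ} (hs : s ∈ Icc 0 T) (ht : t ∈ Icc 0 T) : MemLp (fun x => u s x - u t x) 2 := by
  refine (hw.const_mul (C * |s - t|)).mono' ?_ (.of_forall fun x => hlip s hs t ht x)
  have h : ∀ s, Continuous (u s) := fun s => hu.comp (Continuous.prodMk_right s)
  exact ((h s).sub (h t)).aestronglyMeasurable

/-- Lipschitz dependence on time with an `L²` spatial weight, for the path and its space derivative,
gives continuity in `H¹`. -/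
theorem mem_pathSpace_of_lipschitz (hT : 0 ≤ T) (hw : MemLp w 2) (hC : 0 ≤ C)
    (hu : Continuous (Function.uncurry u)) (hu₁ : Continuous (Function.uncurry u₁))
    (hder : ∀ t x, HasDerivAt (u t) (u₁ t x) x)
    (hlip : ∀ s ∈ Icc 0 T, ∀ t ∈ Icc 0 T, ∀ x, |u s x - u t x| ≤ C * |s - t| * w x)
    (hlip₁ : ∀ s ∈ Icc 0 T, ∀ t ∈ Icc 0 T, ∀ x, |u₁ s x - u₁ t x| ≤ C * |s - t| * w x) :
    u ∈ PathSpace (u 0) T := by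
  have h0 : (0 : ℝ) ∈ Icc 0 T := ⟨le_rfl, hT⟩
  have h₁ : ∀ s, Continuous (u₁ s) := fun s => hu₁.comp (Continuous.prodMk_right s)
  refine ⟨fun t x => u₁ t x - u₁ 0 x, fun t ht => ⟨memLp_sub_of_lipschitz hw hu hlip ht h0,
    memLp_sub_of_lipschitz hw hu₁ hlip₁ ht h0,
    .of_hasDerivAt (fun x => (hder t x).sub (hder 0 x)) ((h₁ t).sub (h₁ 0))⟩, fun t ht => ?_⟩
  simp only [sub_sub_sub_cancel_right]
  simpa using (tendsto_eLpNorm_of_lipschitz hw hC hlip ht).add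
    (tendsto_eLpNorm_of_lipschitz hw hC hlip₁ ht)

theorem integrable_heatKernel_mul_of_bounded (hD : 0 < D) {t : ℝ} (ht : 0 < t) {f : ℝ → ℝ}
    (hf : Continuous f) (hb : ∀ x, |f x| ≤ C) (x : ℝ) :
    Integrable fun y => heatKernel D t (x - y) * f y :=
  ((integrable_heatKernel hD ht).comp_sub_left x).mul_bdd (c := C) hf.aestronglyMeasurable
    (.of_forall hb)

/-- Duhamel's formula with source `v - D u₂`; the equation writes this source as the forcing minus
`F(u)_x`, and linearity of the semigroup splits the time integral. -/
theorem isMildSolution_of_classical (hD : 0 < D) (hF : Differentiable ℝ F)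
    (hF' : Continuous (deriv F)) (hFb : ∀ y, |deriv F y| ≤ C)
    (hu : Continuous (Function.uncurry u)) (hv : Continuous (Function.uncurry v))
    (hu₁ : Continuous (Function.uncurry u₁)) (hu₂ : Continuous (Function.uncurry u₂))
    (hder : ∀ s (y : ℝ → ℝ) (y' : ℝ), HasDerivAt y y' s →
      HasDerivAt (fun r => u r (y r)) (v s (y s) + u₁ s (y s) * y') s)
    (hder₀ : ∀ s x, HasDerivAt (u s) (u₁ s x) x)
    (hder₁ : ∀ s x, HasDerivAt (u₁ s) (u₂ s x) x)
    (hb : ∀ s ∈ Icc 0 T, ∀ x, |u s x| ≤ C ∧ |v s x| ≤ C ∧ |u₁ s x| ≤ C ∧ |u₂ s x| ≤ C)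
    {Φ h : ℝ → ℝ → ℝ} (hΦ : ∀ s ∈ Icc 0 T, ∀ x,
      kernelOp Φ (h s) x = v s x + deriv F (u s x) * u₁ s x - D * u₂ s x) :
    IsMildSolution D F (u 0) Φ T h u := by
  set N : ℝ → ℝ → ℝ := fun s x => deriv F (u s x) * u₁ s x with hN
  set G : ℝ → ℝ → ℝ := fun s x => v s x + N s x - D * u₂ s x with hG
  have hNc : Continuous (Function.uncurry N) := (hF'.comp hu).mul hu₁
  have hGc : Continuous (Function.uncurry G) := (hv.add hNc).sub (continuous_const.mul hu₂)
  have hNb : ∀ s ∈ Icc 0 T, ∀ x, |N s x| ≤ C * C := fun s hs x => by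
    rw [hN, abs_mul]
    exact mul_le_mul (hFb _) (hb s hs x).2.2.1 (abs_nonneg _) ((abs_nonneg _).trans (hFb 0))
  have hGb : ∀ s ∈ Icc 0 T, ∀ x, |G s x| ≤ C + C * C + D * C := fun s hs x => by
    refine (abs_sub _ _).trans (add_le_add ((abs_add_le _ _).trans
      (add_le_add (hb s hs x).2.1 (hNb s hs x))) ?_)
    rw [abs_mul, abs_of_pos hD]
    exact mul_le_mul_of_nonneg_left (hb s hs x).2.2.2 hD.le
  refine ⟨.rfl, N, fun t _ => .of_hasDerivAt
    (fun x => (hF (u t x)).hasDerivAt.comp x (hder₀ t x))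
    (hNc.comp (Continuous.prodMk_right t)), fun t ht => .of_forall fun x => ?_⟩
  have hsub : Icc 0 t ⊆ Icc 0 T := Icc_subset_Icc_right ht.2
  rw [duhamel hD ht.1 hu hv hu₁ hu₂ hder hder₁ (fun s hs => hb s (hsub hs)) x]
  have e1 : ∫ s in (0 : ℝ)..t, heatSemigroup D (t - s) (kernelOp Φ (h s)) x =
      ∫ s in (0 : ℝ)..t, heatSemigroup D (t - s) (G s) x := by
    refine intervalIntegral.integral_congr fun s hs => ?_
    rw [uIcc_of_le ht.1.le] at hs
    rw [show kernelOp Φ (h s) = G s from funext fun x => hΦ s (hsub hs) x]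
  rw [e1, sub_add_eq_add_sub, add_sub_assoc, ← intervalIntegral.integral_sub
    (intervalIntegrable_heatSemigroup hD ht.1.le hGc (fun s hs => hGb s (hsub hs)) x)
    (intervalIntegrable_heatSemigroup hD ht.1.le hNc (fun s hs => hNb s (hsub hs)) x)]
  congr 1
  refine intervalIntegral.integral_congr_ae ?_
  have hne : ∀ᵐ s : ℝ, s ≠ t := by
    simp [ae_iff]
  filter_upwards [hne] with s hst hs
  rw [uIoc_of_le ht.1.le] at hs
  have hs' : s ∈ Icc 0 T := hsub ⟨hs.1.le, hs.2⟩
  have hpos : 0 < t - s := sub_pos.2 (lt_of_le_of_ne hs.2 hst)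
  simp only [heatSemigroup]
  have hGi : Integrable fun y => heatKernel D (t - s) (x - y) * G s y :=
    integrable_heatKernel_mul_of_bounded hD hpos (hGc.comp (Continuous.prodMk_right s))
      (hGb s hs') x
  have hNi : Integrable fun y => heatKernel D (t - s) (x - y) * N s y :=
    integrable_heatKernel_mul_of_bounded hD hpos (hNc.comp (Continuous.prodMk_right s))
      (hNb s hs') x
  rw [← integral_sub hGi hNi]
  refine integral_congr_ae (.of_forall fun y => ?_)
  simp only [hG]
  ring

end Classical

/-! ### Interpolation between the moving profile and its translate -/

/-- Linear interpolation in time, in the frame moving with speed `γ`, between `f` and its translate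
by `x₀`. -/
def blend (f : ℝ → ℝ) (γ T x₀ t x : ℝ) : ℝ :=
  (1 - t / T) * f (x - γ * t) + t / T * f (x - γ * t - x₀)

section Blend

variable {f f' : ℝ → ℝ} {γ T x₀ C lam : ℝ}

theorem continuous_blend (hf : Continuous f) :
    Continuous (Function.uncurry (blend f γ T x₀)) := by
  simp only [blend, Function.uncurry_def]
  fun_prop

theorem blend_zero : blend f γ T x₀ 0 = f := by
  ext x; simp [blend]

theorem blend_end (hT : T ≠ 0) : blend f γ T x₀ T = fun x => f (x - γ * T - x₀) := by
  ext x; simp [blend, hT]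

theorem hasDerivAt_blend (hf : ∀ x, HasDerivAt f (f' x) x) (t x : ℝ) :
    HasDerivAt (blend f γ T x₀ t) (blend f' γ T x₀ t x) x := by
  have h1 := ((hf (x - γ * t)).comp_sub_const x (γ * t)).const_mul (1 - t / T)
  have h2 := ((hf (x - γ * t - x₀)).comp_sub_const (x - γ * t) x₀).comp_sub_const x (γ * t)
  exact h1.add (h2.const_mul (t / T))

theorem hasDerivAt_blend_along (hf : ∀ x, HasDerivAt f (f' x) x) {s y' : ℝ} {y : ℝ → ℝ}
    (hy : HasDerivAt y y' s) :
    HasDerivAt (fun r => blend f γ T x₀ r (y r))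
      ((f (y s - γ * s - x₀) - f (y s - γ * s)) / T - γ * blend f' γ T x₀ s (y s) +
        blend f' γ T x₀ s (y s) * y') s := by
  have hz : HasDerivAt (fun r => y r - γ * r) (y' - γ) s :=
    (hy.sub ((hasDerivAt_id s).const_mul γ)).congr_deriv (by simp)
  have h1 := (hf (y s - γ * s)).comp s hz
  have h2 := (hf (y s - γ * s - x₀)).comp s (hz.sub_const x₀)
  have hθ : HasDerivAt (fun r : ℝ => r / T) (1 / T) s := (hasDerivAt_id s).div_const T
  refine (((hθ.const_sub 1).mul h1).add (hθ.mul h2)).congr_deriv ?_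
  simp only [blend, Function.comp]
  ring

theorem exp_neg_mul_abs_sub_le (hlam : 0 ≤ lam) {a M : ℝ} (ha : |a| ≤ M) (x : ℝ) :
    Real.exp (-lam * |x - a|) ≤ Real.exp (lam * M) * Real.exp (-lam * |x|) := by
  rw [← Real.exp_add, Real.exp_le_exp]
  have h1 := abs_sub_abs_le_abs_sub x a
  have : |x| ≤ |x - a| + M := by linarith
  nlinarith [mul_le_mul_of_nonneg_left this hlam]

/-- The mean value inequality, together with the fact that a shift by at most `M` costs only the
factor `exp(lam M)` in the exponential weight. -/
theorem abs_sub_translate_le (hlam : 0 ≤ lam) (hC : 0 ≤ C) (hf : ∀ x, HasDerivAt f (f' x) x)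
    (hb : ∀ x, |f' x| ≤ C * Real.exp (-lam * |x|)) {M : ℝ} (hM : |x₀| ≤ M) (x : ℝ) :
    |f (x - x₀) - f x| ≤ C * Real.exp (lam * M) * |x₀| * Real.exp (-lam * |x|) := by
  have h := (convex_uIcc x (x - x₀)).norm_image_sub_le_of_norm_hasDerivWithin_le
    (f := f) (f' := f') (C := C * (Real.exp (lam * M) * Real.exp (-lam * |x|)))
    (fun y _ => (hf y).hasDerivWithinAt) (fun y hy => ?_) left_mem_uIcc right_mem_uIcc
  · rw [sub_sub_cancel_left, norm_neg] at h
    refine h.trans (le_of_eq ?_)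
    rw [Real.norm_eq_abs]
    ring
  · refine (hb y).trans (mul_le_mul_of_nonneg_left ?_ hC)
    have h1 : |x - y| ≤ M := by
      have := abs_sub_left_of_mem_uIcc hy
      rw [abs_sub_comm, sub_sub_cancel_left, abs_neg] at this
      exact this.trans hM
    have := exp_neg_mul_abs_sub_le hlam h1 x
    rwa [sub_sub_cancel] at this

theorem abs_blend_le {t : ℝ} (ht : t ∈ Icc 0 T) {B x : ℝ} (h1 : |f (x - γ * t)| ≤ B)
    (h2 : |f (x - γ * t - x₀)| ≤ B) : |blend f γ T x₀ t x| ≤ B := by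
  have hθ0 : 0 ≤ t / T := div_nonneg ht.1 (ht.1.trans ht.2)
  have hθ1 : 0 ≤ 1 - t / T := sub_nonneg.2 (div_le_one_of_le₀ ht.2 (ht.1.trans ht.2))
  calc |blend f γ T x₀ t x| ≤ (1 - t / T) * B + t / T * B := by
        refine (abs_add_le _ _).trans ?_
        rw [abs_mul, abs_mul, abs_of_nonneg hθ0, abs_of_nonneg hθ1]
        gcongr
    _ = B := by ring

theorem exists_lipschitz_blend (hT : 0 < T) (hlam : 0 ≤ lam) (hC : 0 ≤ C)
    (hf : ∀ x, HasDerivAt f (f' x) x) (hb : ∀ x, |f' x| ≤ C * Real.exp (-lam * |x|)) :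
    ∃ C' : ℝ, 0 ≤ C' ∧ ∀ s ∈ Icc 0 T, ∀ t ∈ Icc 0 T, ∀ x,
      |blend f γ T x₀ s x - blend f γ T x₀ t x| ≤ C' * |s - t| * Real.exp (-lam * |x|) := by
  set M := |γ| * T + |x₀| with hM
  have hM0 : 0 ≤ M := by positivity
  set B := C * Real.exp (lam * |x₀|) * |x₀| * Real.exp (lam * M) / T +
    |γ| * (C * Real.exp (lam * M)) with hB
  refine ⟨B, by positivity, fun s hs t ht x => ?_⟩
  have h := (convex_Icc 0 T).norm_image_sub_le_of_norm_hasDerivWithin_le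
    (f := fun r => blend f γ T x₀ r x) (C := B * Real.exp (-lam * |x|))
    (fun r _ => ((hasDerivAt_blend_along hf (γ := γ) (T := T) (x₀ := x₀)
      (hasDerivAt_const r x)).hasDerivWithinAt)) (fun r hr => ?_) ht hs
  · refine h.trans (le_of_eq ?_)
    rw [Real.norm_eq_abs]
    ring
  have hr1 : |γ * r| ≤ M := by
    rw [abs_mul, abs_of_nonneg hr.1, hM]
    nlinarith [abs_nonneg γ, abs_nonneg x₀, hr.2]
  have hr2 : |γ * r + x₀| ≤ M := by
    refine (abs_add_le _ _).trans ?_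
    rw [abs_mul, abs_of_nonneg hr.1, hM]
    nlinarith [abs_nonneg γ, hr.2]
  have h1 : |(f (x - γ * r - x₀) - f (x - γ * r)) / T| ≤
      C * Real.exp (lam * |x₀|) * |x₀| * Real.exp (lam * M) / T * Real.exp (-lam * |x|) := by
    rw [abs_div, abs_of_pos hT, div_mul_eq_mul_div, mul_assoc]
    refine div_le_div_of_nonneg_right ((abs_sub_translate_le hlam hC hf hb le_rfl _).trans ?_) hT.le
    exact mul_le_mul_of_nonneg_left (exp_neg_mul_abs_sub_le hlam hr1 x) (by positivity)
  have h2 : |blend f' γ T x₀ r x| ≤ C * Real.exp (lam * M) * Real.exp (-lam * |x|) := by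
    refine abs_blend_le hr ?_ ?_
    · rw [mul_assoc]
      exact (hb _).trans (mul_le_mul_of_nonneg_left (exp_neg_mul_abs_sub_le hlam hr1 x) hC)
    · rw [mul_assoc, sub_sub]
      exact (hb _).trans (mul_le_mul_of_nonneg_left (exp_neg_mul_abs_sub_le hlam hr2 x) hC)
  rw [mul_zero, add_zero, hB, add_mul]
  refine (abs_sub _ _).trans (add_le_add h1 ?_)
  rw [abs_mul, mul_assoc |γ|]
  exact mul_le_mul_of_nonneg_left h2 (abs_nonneg γ)

theorem exp_neg_mul_abs_mul_pow_le (hlam : 0 < lam) (n : ℕ) (x : ℝ) :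
    Real.exp (-lam * |x|) * (1 + |x|) ^ n ≤ n.factorial * Real.exp lam / lam ^ n := by
  have h := Real.pow_div_factorial_le_exp (lam * (1 + |x|)) (by positivity) n
  rw [div_le_iff₀ (by positivity), mul_pow, mul_add, mul_one, Real.exp_add] at h
  have h1 : Real.exp (-lam * |x|) * Real.exp (lam * |x|) = 1 := by
    rw [← Real.exp_add]; simp
  rw [le_div_iff₀ (by positivity)]
  calc Real.exp (-lam * |x|) * (1 + |x|) ^ n * lam ^ n
      = Real.exp (-lam * |x|) * (lam ^ n * (1 + |x|) ^ n) := by ring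
    _ ≤ Real.exp (-lam * |x|) * (Real.exp lam * Real.exp (lam * |x|) * n.factorial) := by gcongr
    _ = Real.exp (-lam * |x|) * Real.exp (lam * |x|) * (n.factorial * Real.exp lam) := by ring
    _ = n.factorial * Real.exp lam := by rw [h1, one_mul]

theorem exists_exp_neg_mul_abs_mul_pow_le (hlam : 0 < lam) (n : ℕ) :
    ∃ K : ℝ, 0 < K ∧ ∀ x : ℝ, Real.exp (-lam * |x|) * (1 + |x|) ^ n ≤ K * (1 + x ^ 2)⁻¹ := by
  -- Two extra powers of `1 + |x|` dominate `1 + x²`.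
  refine ⟨(n + 2).factorial * Real.exp lam / lam ^ (n + 2), by positivity, fun x => ?_⟩
  rw [← div_eq_mul_inv, le_div_iff₀ (by positivity)]
  refine le_trans ?_ (exp_neg_mul_abs_mul_pow_le hlam (n + 2) x)
  rw [pow_add, mul_assoc]
  gcongr
  nlinarith [abs_nonneg x, sq_abs x]

theorem memLp_exp_neg_mul_abs (hlam : 0 < lam) :
    MemLp (fun x : ℝ => Real.exp (-lam * |x|)) 2 := by
  have hc : Continuous fun x : ℝ => Real.exp (-lam * |x|) := by fun_prop
  rw [memLp_two_iff_integrable_sq hc.aestronglyMeasurable]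
  obtain ⟨K, hK, h⟩ := exists_exp_neg_mul_abs_mul_pow_le hlam 0
  refine (integrable_inv_one_add_sq.const_mul K).mono' (hc.pow 2).aestronglyMeasurable
    (.of_forall fun x => ?_)
  have h1 : Real.exp (-lam * |x|) ≤ 1 := Real.exp_le_one_iff.2 (by
    nlinarith [abs_nonneg x])
  have h2 := Real.exp_pos (-lam * |x|)
  have h3 := h x
  rw [Real.norm_of_nonneg (by positivity)]
  rw [pow_zero, mul_one] at h3
  nlinarith

end Blend

/-! ### The interpolating path and its forcing -/

/-- The forcing `u_t + F(u)_x - D u_xx` of the interpolation `u` between the travelling wave and its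
translate by `x₀`. -/
def displacementForcing (D : ℝ) (F : ℝ → ℝ) (uM uP : ℝ) (U : ℝ → ℝ) (T x₀ t x : ℝ) : ℝ :=
  let γ := waveSpeed F uM uP
  let u := blend U γ T x₀ t x
  let U₁ := U (x - γ * t)
  let U₂ := U (x - γ * t - x₀)
  (U₂ - U₁) / T + ((1 - t / T) * ((deriv F u - deriv F U₁) * profileField D F uM uP U₁) +
    t / T * ((deriv F u - deriv F U₂) * profileField D F uM uP U₂))

section

variable {D uM uP σ : ℝ} {F U φ₀ φ₁ : ℝ → ℝ} {T x₀ : ℝ}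

theorem IsAdmissibleFlux.continuous_deriv (hF : IsAdmissibleFlux F uM uP) :
    Continuous (deriv F) := hF.contDiff_deriv.continuous

theorem IsAdmissibleFlux.continuous_profileField (hF : IsAdmissibleFlux F uM uP) (D : ℝ) :
    Continuous (profileField D F uM uP) :=
  continuous_iff_continuousAt.2 fun u => (hF.hasDerivAt_profileField D u).continuousAt

theorem IsWaveProfile.hasDerivAt_profileField (hU : IsWaveProfile D F uM uP U)
    (hF : IsAdmissibleFlux F uM uP) (x : ℝ) :
    HasDerivAt (fun x => profileField D F uM uP (U x))
      ((deriv F (U x) - waveSpeed F uM uP) / D * profileField D F uM uP (U x)) x :=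
  (hF.hasDerivAt_profileField D (U x)).comp x (hU.hasDerivAt x)

theorem continuous_displacementForcing (hF : IsAdmissibleFlux F uM uP)
    (hU : IsWaveProfile D F uM uP U) :
    Continuous (Function.uncurry (displacementForcing D F uM uP U T x₀)) := by
  have hUc := hU.continuous
  have hF' := hF.continuous_deriv
  have hq := hF.continuous_profileField D
  have hb : Continuous fun p : ℝ × ℝ => blend U (waveSpeed F uM uP) T x₀ p.1 p.2 :=
    continuous_blend hUc
  simp only [displacementForcing, Function.uncurry_def]
  fun_prop

/-- The interpolating path `blend U` is admissible for the displacement event and is a mild solution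
for any control producing its forcing, so the energy of such a control bounds the cost. -/
theorem displacementCost_le_of_control (hD : 0 < D) (hF : IsAdmissibleFlux F uM uP)
    (hU : IsWaveProfile D F uM uP U) (hT : 0 < T) {Φ h : ℝ → ℝ → ℝ} (hh : IsControl T h)
    (hΦ : ∀ s ∈ Icc 0 T, ∀ x, kernelOp Φ (h s) x = displacementForcing D F uM uP U T x₀ s x) :
    displacementCost D F uM uP U Φ T x₀ ≤
      (1 / 2) * ∫⁻ t in Icc 0 T, ∫⁻ x, ENNReal.ofReal (h t x ^ 2) := by
  obtain ⟨C, lam, hC, hlam, -, -, hdec⟩ := hU.exists_exp_decay hD hF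
  obtain ⟨B, hB⟩ := hF.bounded
  have hB0 : 0 ≤ B := (abs_nonneg _).trans (hB 0).1
  set γ := waveSpeed F uM uP with hγ
  set q : ℝ → ℝ := fun x => profileField D F uM uP (U x) with hq
  set r : ℝ → ℝ := fun x => (deriv F (U x) - γ) / D * q x with hr
  have hUc := hU.continuous
  have hqc : Continuous q := (hF.continuous_profileField D).comp hUc
  have hrc : Continuous r := (((hF.continuous_deriv.comp hUc).sub continuous_const).div_const D).mul
    hqc
  have hUd : ∀ x, HasDerivAt U (q x) x := hU.hasDerivAt
  have hqd : ∀ x, HasDerivAt q (r x) x := hU.hasDerivAt_profileField hF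
  have hexp : ∀ x : ℝ, Real.exp (-lam * |x|) ≤ 1 := fun x => Real.exp_le_one_iff.2 (by
    nlinarith [abs_nonneg x])
  set C' := (B + |γ|) / D * C with hC'
  have hC'0 : 0 ≤ C' := by positivity
  have hrdec : ∀ x, |r x| ≤ C' * Real.exp (-lam * |x|) := fun x => by
    rw [hr, abs_mul, abs_div, abs_of_pos hD, hC', mul_assoc]
    have h1 : |deriv F (U x) - γ| ≤ B + |γ| := (abs_sub _ _).trans
      (by linarith [(hB (U x)).1])
    gcongr
    exact hdec x
  have hqb : ∀ x, |q x| ≤ C := fun x => (hdec x).trans (mul_le_of_le_one_right hC.le (hexp x))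
  have hrb : ∀ x, |r x| ≤ C' := fun x => (hrdec x).trans (mul_le_of_le_one_right hC'0 (hexp x))
  obtain ⟨L, hL, hlip⟩ := exists_lipschitz_blend (γ := γ) (x₀ := x₀) hT hlam.le hC.le hUd hdec
  obtain ⟨L', hL', hlip'⟩ := exists_lipschitz_blend (γ := γ) (x₀ := x₀) hT hlam.le hC'0 hqd hrdec
  set u := blend U γ T x₀ with hu
  set u₁ := blend q γ T x₀ with hu₁
  set u₂ := blend r γ T x₀ with hu₂
  set v : ℝ → ℝ → ℝ := fun s x => (U (x - γ * s - x₀) - U (x - γ * s)) / T - γ * u₁ s x with hv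
  have huc : Continuous (Function.uncurry u) := continuous_blend hUc
  have hu₁c : Continuous (Function.uncurry u₁) := continuous_blend hqc
  have hu₂c : Continuous (Function.uncurry u₂) := continuous_blend hrc
  have hvc : Continuous (Function.uncurry v) := by
    have : Continuous fun p : ℝ × ℝ => u₁ p.1 p.2 := hu₁c
    simp only [hv, Function.uncurry_def]
    fun_prop
  have hu0 : u 0 = U := blend_zero
  have hpath : u ∈ PathSpace U T := by
    have hm : ∀ {f : ℝ → ℝ → ℝ} {K : ℝ}, K ≤ max L L' → (∀ s ∈ Icc 0 T, ∀ t ∈ Icc 0 T, ∀ x,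
        |f s x - f t x| ≤ K * |s - t| * Real.exp (-lam * |x|)) → ∀ s ∈ Icc 0 T, ∀ t ∈ Icc 0 T, ∀ x,
        |f s x - f t x| ≤ max L L' * |s - t| * Real.exp (-lam * |x|) :=
      fun hK h s hs t ht x => (h s hs t ht x).trans (by gcongr)
    rw [← hu0]
    exact mem_pathSpace_of_lipschitz hT.le (memLp_exp_neg_mul_abs hlam) (hL.trans (le_max_left L L'))
      huc hu₁c (hasDerivAt_blend hUd) (hm (le_max_left _ _) hlip) (hm (le_max_right _ _) hlip')
  set M := |uM| + |uP| with hM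
  have hUb : ∀ x, |U x| ≤ M := hU.abs_le hD hF
  set V := (M + M) / T + |γ| * C with hV
  have hM0 : 0 ≤ M := by positivity
  have hV0 : 0 ≤ V := by positivity
  have hmild : IsMildSolution D F U Φ T h u := by
    rw [← hu0]
    refine isMildSolution_of_classical (C := B + M + V + C + C') (v := v) (u₁ := u₁) (u₂ := u₂) hD
      hF.differentiable hF.continuous_deriv (fun y => (hB y).1.trans (by linarith)) huc hvc hu₁c hu₂c
      (fun s y y' hy => hasDerivAt_blend_along hUd hy) (hasDerivAt_blend hUd) (hasDerivAt_blend hqd)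
      (fun s hs x => ?_) fun s hs x => ?_
    · have h1 : |u₁ s x| ≤ C := abs_blend_le hs (hqb _) (hqb _)
      have h2 : |u s x| ≤ M := abs_blend_le hs (hUb _) (hUb _)
      have h3 : |u₂ s x| ≤ C' := abs_blend_le hs (hrb _) (hrb _)
      have h4 : |v s x| ≤ V := by
        refine (abs_sub _ _).trans ?_
        rw [abs_div, abs_of_pos hT, abs_mul]
        have h5 := (abs_sub (U (x - γ * s - x₀)) (U (x - γ * s))).trans
          (add_le_add (hUb _) (hUb _))
        exact add_le_add (div_le_div_of_nonneg_right h5 hT.le)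
          (mul_le_mul_of_nonneg_left h1 (abs_nonneg γ))
      refine ⟨?_, ?_, ?_, ?_⟩ <;> linarith
    -- By the profile equation each of the two waves solves the unforced equation. What remains is
    -- the time derivative of the weights and the mismatch of `F'` at the blend and at each wave.
    · rw [hΦ s hs x]
      simp only [displacementForcing, ← hγ, ← hu]
      generalize deriv F (u s x) = a
      simp only [hv, hu₂, hu₁, hr, hq, blend]
      field_simp
      ring
  refine iInf₂_le_of_le u ⟨hpath, by rw [hu0], by rw [hu, blend_end hT.ne']⟩ ?_
  exact iInf₂_le_of_le h ⟨hh, hmild⟩ le_rfl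

theorem kernelOp_noiseKernel (σ : ℝ) (φ₀ φ₁ : ℝ → ℝ) (L₀ lc : ℝ) (f : ℝ → ℝ) (x : ℝ) :
    kernelOp (noiseKernel σ φ₀ φ₁ L₀ lc) f x =
      σ * φ₀ (x / L₀) * ∫ x', 1 / lc * φ₁ ((x - x') / lc) * f x' := by
  rw [kernelOp, ← integral_const_mul]
  exact integral_congr_ae (.of_forall fun x' => by simp only [noiseKernel]; ring)

/-- Without displacement the interpolation is the travelling wave itself and the zero control
suffices. Separate treatment is needed because the general upper bound rests on a strict inequality.
-/
theorem displacementCost_zero_displacement (hD : 0 < D) (hF : IsAdmissibleFlux F uM uP)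
    (hU : IsWaveProfile D F uM uP U) (hT : 0 < T) (Φ : ℝ → ℝ → ℝ) :
    displacementCost D F uM uP U Φ T 0 = 0 := by
  have h := displacementCost_le_of_control hD hF hU hT (x₀ := 0) (Φ := Φ) (h := fun _ _ => 0)
    (MemLp.zero' (p := 2)) fun s _ x => by
      simp only [kernelOp, mul_zero, integral_zero, displacementForcing, blend, sub_zero,
        sub_self, zero_div, zero_add]
      rw [show (1 - s / T) * U (x - waveSpeed F uM uP * s) + s / T * U (x - waveSpeed F uM uP * s) =
        U (x - waveSpeed F uM uP * s) by ring]
      ring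
  simpa using h

end

/-! ### Decay of the derivatives of the forcing -/

section

variable {D uM uP σ : ℝ} {F U φ₀ φ₁ : ℝ → ℝ} {T x₀ L₀ lam : ℝ} {ι : Type*}

theorem IsAdmissibleFlux.contDiffAt_deriv (hF : IsAdmissibleFlux F uM uP) :
    ∀ u ∈ uIcc uM uP, ContDiffAt ℝ ∞ (deriv F) u := fun u hu =>
  (hF.smooth u hu).derivWithin (n := ∞) (m := ∞) (by simp)

theorem exp_neg_mul_abs_le_one (hlam : 0 ≤ lam) (x : ℝ) : Real.exp (-lam * |x|) ≤ 1 :=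
  Real.exp_le_one_iff.2 (by nlinarith [abs_nonneg x])

/-- A joint induction: with `q = profileField`, one has `U' = q(U)` and `q(U)' = ((F' - γ)/D)(U)
q(U)`, so each derivative beyond `U` itself keeps a decaying factor `q(U)`. -/
theorem IsWaveProfile.derivBound (hU : IsWaveProfile D F uM uP U) (hD : 0 < D)
    (hF : IsAdmissibleFlux F uM uP) (hlam : 0 ≤ lam) {C : ℝ}
    (hdec : ∀ x, |profileField D F uM uP (U x)| ≤ C * Real.exp (-lam * |x|)) (n : ℕ) :
    DerivBound (fun x => Real.exp (-lam * |x|)) n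
        (fun (_ : ι) x => profileField D F uM uP (U x)) ∧
      DerivBound (fun _ => 1) n fun (_ : ι) => U := by
  have hUb : ∃ C : ℝ, ∀ (_ : ι) x, |U x| ≤ C * 1 := ⟨_, fun _ x => by
    simpa using hU.abs_le hD hF x⟩
  induction n with
  | zero => exact ⟨⟨C, fun _ => hdec⟩, hUb⟩
  | succ n ih =>
    obtain ⟨ih1, ih2⟩ := ih
    have hG : ∀ u ∈ uIcc uM uP,
        ContDiffAt ℝ ∞ (fun u => (deriv F u - waveSpeed F uM uP) / D) u := fun u hu =>
      ((hF.contDiffAt_deriv u hu).sub contDiffAt_const).div_const D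
    have h1 := (DerivBound.comp isCompact_uIcc hG ih2 fun _ x => hU.mem_uIcc hD hF x).mul ih1
      fun _ => zero_le_one
    refine ⟨⟨⟨C, fun _ => hdec⟩, _, fun _ x => hU.hasDerivAt_profileField hF x, ?_⟩,
      ⟨hUb, _, fun _ x => hU.hasDerivAt x, ?_⟩⟩
    · simpa using h1
    · exact ih1.mono_weight (K := 1) (fun x => (Real.exp_pos _).le)
        fun x => by simpa using exp_neg_mul_abs_le_one hlam x

theorem DerivBound.of_hasTemperateGrowth {g : ℝ → ℝ} (hg : g.HasTemperateGrowth) (n : ℕ) :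
    ∃ k : ℕ, DerivBound (fun x => (1 + |x|) ^ k) n fun _ : ι => g := by
  obtain ⟨k, C, -, h⟩ := hg.norm_iteratedFDeriv_le_uniform n
  refine ⟨k, ?_⟩
  have key : ∀ m j, m + j ≤ n →
      DerivBound (fun x => (1 + |x|) ^ k) m fun _ : ι => iteratedDeriv j g := by
    intro m
    induction m with
    | zero =>
      intro j hj
      refine ⟨C, fun _ x => ?_⟩
      have := h j (by omega) x
      rwa [norm_iteratedFDeriv_eq_norm_iteratedDeriv] at this
    | succ m ih =>
      intro j hj
      refine ⟨⟨C, fun _ x => ?_⟩, _, fun _ x => ?_, ih (j + 1) (by omega)⟩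
      · have := h j (by omega) x
        rwa [norm_iteratedFDeriv_eq_norm_iteratedDeriv] at this
      · rw [iteratedDeriv_succ]
        have h1 : Differentiable ℝ (iteratedDeriv j g) :=
          hg.1.differentiable_iteratedDeriv j (by exact_mod_cast WithTop.coe_lt_top _)
        exact (h1 x).hasDerivAt
  have := key n 0 le_rfl
  rwa [iteratedDeriv_zero] at this

/-- The forcing in the equation with the noise modulation divided out. -/
def controlForcing (D : ℝ) (F : ℝ → ℝ) (uM uP : ℝ) (U : ℝ → ℝ) (σ : ℝ) (φ₀ : ℝ → ℝ)
    (L₀ T x₀ t x : ℝ) : ℝ :=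
  displacementForcing D F uM uP U T x₀ t x * (σ⁻¹ * (φ₀ (x / L₀))⁻¹)

theorem continuous_controlForcing (hF : IsAdmissibleFlux F uM uP)
    (hU : IsWaveProfile D F uM uP U) (hφ : IsNoiseProfile φ₀ φ₁) :
    Continuous (Function.uncurry (controlForcing D F uM uP U σ φ₀ L₀ T x₀)) := by
  have h1 : Continuous fun p : ℝ × ℝ => displacementForcing D F uM uP U T x₀ p.1 p.2 :=
    continuous_displacementForcing hF hU
  have h2 : Continuous fun x => (φ₀ x)⁻¹ := hφ.growth₀.1.continuous
  have h3 : Continuous fun p : ℝ × ℝ => (φ₀ (p.2 / L₀))⁻¹ :=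
    h2.comp (continuous_snd.div_const L₀)
  exact h1.mul (continuous_const.mul h3)

/-- Every term carries either `q` at a translate of `U` or the difference of two translates, hence
the exponential weight. The translations are bounded for `t ∈ [0,T]`, which makes the estimate
uniform in time. -/
theorem derivBound_displacementForcing (hD : 0 < D) (hF : IsAdmissibleFlux F uM uP)
    (hU : IsWaveProfile D F uM uP U) (hT : 0 < T) (hlam : 0 ≤ lam) {C : ℝ} (hC : 0 ≤ C)
    (hdec : ∀ x, |profileField D F uM uP (U x)| ≤ C * Real.exp (-lam * |x|)) (n : ℕ) :
    DerivBound (fun x => Real.exp (-lam * |x|)) n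
      fun t : Icc 0 T => displacementForcing D F uM uP U T x₀ t := by
  set γ := waveSpeed F uM uP with hγ
  set w : ℝ → ℝ := fun x => Real.exp (-lam * |x|) with hw
  have hw0 : ∀ x, 0 ≤ w x := fun x => (Real.exp_pos _).le
  set M := |γ| * T + |x₀| with hM
  have ha1 : ∀ t : Icc 0 T, |γ * t| ≤ M := fun t => by
    rw [abs_mul, abs_of_nonneg t.2.1, hM]
    nlinarith [abs_nonneg γ, abs_nonneg x₀, t.2.2]
  have ha2 : ∀ t : Icc 0 T, |γ * t + x₀| ≤ M := fun t => by
    refine (abs_add_le _ _).trans ?_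
    rw [abs_mul, abs_of_nonneg t.2.1, hM]
    nlinarith [abs_nonneg γ, t.2.2]
  have tq : ∀ (a : Icc 0 T → ℝ), (∀ t, |a t| ≤ M) → ∀ n,
      DerivBound w n fun t x => profileField D F uM uP (U (x - a t)) := fun a ha n =>
    (hU.derivBound (ι := Icc 0 T) hD hF hlam hdec n).1.translate hw0
      fun t x => exp_neg_mul_abs_sub_le hlam (ha t) x
  have tU : ∀ (a : Icc 0 T → ℝ), ∀ n, DerivBound (fun _ => 1) n fun t x => U (x - a t) :=
    fun a n => (hU.derivBound (ι := Icc 0 T) hD hF hlam hdec n).2.translate (K := 1)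
      (fun _ => zero_le_one) fun _ _ => by simp
  have hθ0 : ∀ t : Icc 0 T, 0 ≤ (t : ℝ) / T := fun t => div_nonneg t.2.1 hT.le
  have hθ1 : ∀ t : Icc 0 T, (t : ℝ) / T ≤ 1 := fun t => div_le_one_of_le₀ t.2.2 hT.le
  have hc1 : ∀ t : Icc 0 T, |1 - (t : ℝ) / T| ≤ 1 := fun t => by
    rw [abs_of_nonneg (sub_nonneg.2 (hθ1 t))]; linarith [hθ0 t]
  have hc2 : ∀ t : Icc 0 T, |(t : ℝ) / T| ≤ 1 := fun t => by
    rw [abs_of_nonneg (hθ0 t)]; exact hθ1 t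
  have hdiff : DerivBound w (n + 1) fun (t : Icc 0 T) x =>
      U (x - (γ * t + x₀)) - U (x - γ * t) := by
    refine ⟨⟨C * Real.exp (lam * |x₀|) * |x₀| * Real.exp (lam * M), fun t x => ?_⟩, _,
      fun t x => ((hU.hasDerivAt _).comp_sub_const x _).sub ((hU.hasDerivAt _).comp_sub_const x _),
      (tq _ ha2 n).sub (tq _ ha1 n) hw0⟩
    simp only [← sub_sub]
    refine (abs_sub_translate_le hlam hC hU.hasDerivAt hdec le_rfl _).trans ?_
    rw [mul_assoc _ (Real.exp (lam * M))]
    exact mul_le_mul_of_nonneg_left (exp_neg_mul_abs_sub_le hlam (ha1 t) x) (by positivity)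
  have hu : DerivBound (fun _ => 1) n fun (t : Icc 0 T) => blend U γ T x₀ t := by
    have := ((tU (fun t => γ * t) n).const_mul (fun _ => zero_le_one) hc1).add
      ((tU (fun t => γ * t + x₀) n).const_mul (fun _ => zero_le_one) hc2)
    simp only [← sub_sub] at this
    exact this
  -- By convexity the interpolation stays between the end states, where `F` is smooth; elsewhere
  -- only two derivatives are available.
  have hmem : ∀ (t : Icc 0 T) x, blend U γ T x₀ t x ∈ uIcc uM uP := fun t x =>
    convex_uIcc uM uP (hU.mem_uIcc hD hF _) (hU.mem_uIcc hD hF _) (sub_nonneg.2 (hθ1 t)) (hθ0 t)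
      (by ring)
  have hFu := DerivBound.comp isCompact_uIcc hF.contDiffAt_deriv hu hmem
  have hFt : ∀ a : Icc 0 T → ℝ, DerivBound (fun _ => 1) n fun t x => deriv F (U (x - a t)) :=
    fun a => DerivBound.comp isCompact_uIcc hF.contDiffAt_deriv (tU a n)
      fun _ _ => hU.mem_uIcc hD hF _
  have hterm : ∀ a : Icc 0 T → ℝ, (∀ t, |a t| ≤ M) → DerivBound w n fun (t : Icc 0 T) x =>
      (deriv F (blend U γ T x₀ t x) - deriv F (U (x - a t))) *
        profileField D F uM uP (U (x - a t)) := fun a ha => by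
    simpa only [one_mul] using (hFu.sub (hFt a) fun _ => zero_le_one).mul (tq a ha n)
      fun _ => zero_le_one
  have := (hdiff.of_succ.const_mul hw0 (c := fun _ => T⁻¹) fun _ => le_rfl).add
    (((hterm _ ha1).const_mul hw0 hc1).add ((hterm _ ha2).const_mul hw0 hc2))
  simp only [← sub_sub, inv_mul_eq_div] at this
  exact this

theorem derivBound_controlForcing (hD : 0 < D) (hF : IsAdmissibleFlux F uM uP)
    (hU : IsWaveProfile D F uM uP U) (hφ : IsNoiseProfile φ₀ φ₁) (hT : 0 < T) (n : ℕ) :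
    DerivBound (fun x => (1 + x ^ 2)⁻¹) n
      fun t : Icc 0 T => controlForcing D F uM uP U σ φ₀ L₀ T x₀ t := by
  obtain ⟨C, lam, hC, hlam, -, -, hdec⟩ := hU.exists_exp_decay hD hF
  have h1 := derivBound_displacementForcing (x₀ := x₀) hD hF hU hT hlam.le hC.le hdec n
  have hg : (fun x => (φ₀ (x / L₀))⁻¹).HasTemperateGrowth := by
    have h2 : (fun x : ℝ => x * L₀⁻¹).HasTemperateGrowth := by fun_prop
    exact hφ.growth₀.comp h2
  obtain ⟨k, hk⟩ := DerivBound.of_hasTemperateGrowth (ι := Icc 0 T) hg n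
  obtain ⟨K, hK, hexp⟩ := exists_exp_neg_mul_abs_mul_pow_le hlam k
  exact (h1.mul (hk.const_mul (fun x => by positivity) fun _ => le_rfl)
    fun x => (Real.exp_pos _).le).mono_weight (fun x => by positivity) hexp

/-- The modulation `σ φ₀(x/L₀)` multiplies the convolution from outside, so deconvolving the forcing
divided by it gives a control for the forcing. The factor `1/2` in the rate is simply dropped. -/
theorem eventually_displacementCost_le (hD : 0 < D) (hF : IsAdmissibleFlux F uM uP)
    (hU : IsWaveProfile D F uM uP U) (hφ : IsNoiseProfile φ₀ φ₁) (hσ : 0 < σ) (hT : 0 < T) {A : ℝ}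
    (hA : ∫⁻ t in Icc 0 T, ∫⁻ x, ENNReal.ofReal
      (controlForcing D F uM uP U σ φ₀ L₀ T x₀ t x ^ 2) < ENNReal.ofReal A) :
    ∀ᶠ lc in 𝓝[>] (0 : ℝ),
      displacementCost D F uM uP U (noiseKernel σ φ₀ φ₁ L₀ lc) T x₀ ≤ ENNReal.ofReal A := by
  filter_upwards [exists_control_of_forcing hφ (continuous_controlForcing hF hU hφ)
    (derivBound_controlForcing hD hF hU hφ hT) hA] with lc ⟨h, hh, heq, hle⟩
  refine (displacementCost_le_of_control hD hF hU hT hh fun s hs x => ?_).trans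
    ((mul_le_of_le_one_left zero_le (by simp)).trans hle)
  rw [kernelOp_noiseKernel, heq s hs x, controlForcing]
  have := (hφ.pos₀ (x / L₀)).ne'
  field_simp

end

/-! ### The energy of the forcing -/

section

variable {D uM uP σ : ℝ} {F U φ₀ φ₁ : ℝ → ℝ} {T x₀ L₀ lam : ℝ}

/-- The blend differs from either wave by at most their mutual difference, and `F'` is Lipschitz;
hence the nonlinear mismatch is controlled by the same difference that appears in the linear term
with factor `1/T`. -/
theorem exists_abs_displacementForcing_le (hD : 0 < D) (hF : IsAdmissibleFlux F uM uP)
    (hU : IsWaveProfile D F uM uP U) :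
    ∃ K : ℝ, 0 ≤ K ∧ ∀ T x₀, 0 < T → ∀ t ∈ Icc 0 T, ∀ x,
      |displacementForcing D F uM uP U T x₀ t x| ≤ (1 / T + K) *
        |U (x - waveSpeed F uM uP * t - x₀) - U (x - waveSpeed F uM uP * t)| := by
  obtain ⟨C, lam, hC, hlam, -, -, hdec⟩ := hU.exists_exp_decay hD hF
  obtain ⟨B, hB⟩ := hF.bounded
  have hB0 : 0 ≤ B := (abs_nonneg _).trans (hB 0).1
  have hlip : ∀ a b, |deriv F a - deriv F b| ≤ B * |a - b| := fun a b =>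
    convex_univ.norm_image_sub_le_of_norm_deriv_le (f := deriv F)
      (fun x _ => hF.contDiff_deriv.differentiable (by norm_num) x) (fun x _ => (hB x).2)
      (mem_univ b) (mem_univ a)
  have hq : ∀ x, |profileField D F uM uP (U x)| ≤ C := fun x =>
    (hdec x).trans (mul_le_of_le_one_right hC.le (exp_neg_mul_abs_le_one hlam.le x))
  refine ⟨B * C, by positivity, fun T x₀ hT t ht x => ?_⟩
  set γ := waveSpeed F uM uP with hγ
  have hθ0 : 0 ≤ t / T := div_nonneg ht.1 hT.le
  have hθ1 : t / T ≤ 1 := div_le_one_of_le₀ ht.2 hT.le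
  set Δ := U (x - γ * t - x₀) - U (x - γ * t) with hΔ
  have hu1 : |blend U γ T x₀ t x - U (x - γ * t)| ≤ |Δ| := by
    rw [show blend U γ T x₀ t x - U (x - γ * t) = t / T * Δ by simp only [blend, hΔ]; ring,
      abs_mul, abs_of_nonneg hθ0]
    exact mul_le_of_le_one_left (abs_nonneg _) hθ1
  have hu2 : |blend U γ T x₀ t x - U (x - γ * t - x₀)| ≤ |Δ| := by
    rw [show blend U γ T x₀ t x - U (x - γ * t - x₀) = -((1 - t / T) * Δ) by
      simp only [blend, hΔ]; ring, abs_neg, abs_mul, abs_of_nonneg (sub_nonneg.2 hθ1)]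
    exact mul_le_of_le_one_left (abs_nonneg _) (by linarith)
  have hterm : ∀ y, |blend U γ T x₀ t x - U y| ≤ |Δ| →
      |(deriv F (blend U γ T x₀ t x) - deriv F (U y)) * profileField D F uM uP (U y)| ≤
        B * |Δ| * C := fun y hy => by
    rw [abs_mul]
    exact mul_le_mul ((hlip _ _).trans (mul_le_mul_of_nonneg_left hy hB0)) (hq y) (abs_nonneg _)
      (by positivity)
  have e : displacementForcing D F uM uP U T x₀ t x = Δ / T +
      ((1 - t / T) * ((deriv F (blend U γ T x₀ t x) - deriv F (U (x - γ * t))) *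
        profileField D F uM uP (U (x - γ * t))) +
      t / T * ((deriv F (blend U γ T x₀ t x) - deriv F (U (x - γ * t - x₀))) *
        profileField D F uM uP (U (x - γ * t - x₀)))) := rfl
  rw [e]
  calc _ ≤ |Δ| / T + ((1 - t / T) * (B * |Δ| * C) + t / T * (B * |Δ| * C)) := by
        refine (abs_add_le _ _).trans (add_le_add (by rw [abs_div, abs_of_pos hT]) ?_)
        refine (abs_add_le _ _).trans ?_
        rw [abs_mul (1 - t / T), abs_mul (t / T), abs_of_nonneg hθ0,
          abs_of_nonneg (sub_nonneg.2 hθ1)]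
        exact add_le_add (mul_le_mul_of_nonneg_left (hterm _ hu1) (sub_nonneg.2 hθ1))
          (mul_le_mul_of_nonneg_left (hterm _ hu2) hθ0)
    _ = (1 / T + B * C) * |Δ| := by ring

theorem exists_abs_controlForcing_le (hD : 0 < D) (hF : IsAdmissibleFlux F uM uP)
    (hU : IsWaveProfile D F uM uP U) (hφ : IsNoiseProfile φ₀ φ₁) (hσ : 0 < σ) {Tm : ℝ}
    (hTm : 0 < Tm) :
    ∃ (K : ℝ) (k : ℕ), 0 < K ∧ ∀ T x₀ L₀, 0 < T → T ≤ Tm → 0 < L₀ → ∀ t ∈ Icc 0 T, ∀ x,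
      |controlForcing D F uM uP U σ φ₀ L₀ T x₀ t x| ≤ K / T *
        (|U (x - waveSpeed F uM uP * t - x₀) - U (x - waveSpeed F uM uP * t)| *
          (1 + |x| / L₀) ^ k) := by
  obtain ⟨K, hK, h⟩ := exists_abs_displacementForcing_le hD hF hU
  obtain ⟨k, P, hP⟩ := hφ.growth₀.2 0
  have hP' : ∀ x, (φ₀ x)⁻¹ ≤ P * (1 + |x|) ^ k := fun x => by
    have h1 := hP x
    rw [norm_iteratedFDeriv_zero, Real.norm_of_nonneg (inv_pos.2 (hφ.pos₀ x)).le] at h1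
    exact h1
  have hP0 : 0 < P := by
    have := (inv_pos.2 (hφ.pos₀ 0)).trans_le (hP' 0)
    simpa using this
  refine ⟨(1 + K * Tm) * (σ⁻¹ * P), k, by positivity, fun T x₀ L₀ hT hTm' hL t ht x => ?_⟩
  have h1 : 1 / T + K ≤ (1 + K * Tm) / T := by
    rw [add_div]
    gcongr
    rw [le_div_iff₀ hT]
    gcongr
  have h2 := (h T x₀ hT t ht x).trans (mul_le_mul_of_nonneg_right h1 (abs_nonneg _))
  have h3 := hP' (x / L₀)
  rw [abs_div, abs_of_pos hL] at h3
  have h4 := hφ.pos₀ (x / L₀)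
  rw [controlForcing, abs_mul, abs_of_pos (by positivity : 0 < σ⁻¹ * (φ₀ (x / L₀))⁻¹)]
  calc _ ≤ (1 + K * Tm) / T *
        |U (x - waveSpeed F uM uP * t - x₀) - U (x - waveSpeed F uM uP * t)| *
        (σ⁻¹ * (P * (1 + |x| / L₀) ^ k)) := by gcongr
    _ = _ := by ring

theorem lintegral_lintegral_sq_le {f g : ℝ → ℝ → ℝ} {B : ℝ} (hT : 0 ≤ T)
    (hfg : ∀ t ∈ Icc 0 T, ∀ x, f t x ^ 2 ≤ g t x) (hg : ∀ t ∈ Icc 0 T, Integrable (g t))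
    (hB : ∀ t ∈ Icc 0 T, ∫ x, g t x ≤ B) :
    ∫⁻ t in Icc 0 T, ∫⁻ x, ENNReal.ofReal (f t x ^ 2) ≤ ENNReal.ofReal (T * B) := by
  have h : ∀ t ∈ Icc 0 T, ∫⁻ x, ENNReal.ofReal (f t x ^ 2) ≤ ENNReal.ofReal B := fun t ht => by
    refine (lintegral_mono fun x => ENNReal.ofReal_le_ofReal (hfg t ht x)).trans ?_
    rw [← ofReal_integral_eq_lintegral_ofReal (hg t ht)
      (.of_forall fun x => (sq_nonneg _).trans (hfg t ht x))]
    exact ENNReal.ofReal_le_ofReal (hB t ht)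
  refine (setLIntegral_mono' measurableSet_Icc h).trans ?_
  rw [setLIntegral_const, Real.volume_Icc, sub_zero, mul_comm, ENNReal.ofReal_mul hT]

/-- The two profiles differ by at most a multiple of `|x₀|` times an exponential, and the forcing
carries `1/T`: squaring and integrating over a time `T` gives `x₀²/T`. -/
theorem exists_energy_le_of_bounded (hD : 0 < D) (hF : IsAdmissibleFlux F uM uP)
    (hU : IsWaveProfile D F uM uP U) (hφ : IsNoiseProfile φ₀ φ₁) (hσ : 0 < σ) {Tm : ℝ}
    (hTm : 0 < Tm) (M : ℝ) :
    ∃ A : ℝ, 0 ≤ A ∧ ∀ T x₀ L₀, 0 < T → T ≤ Tm → |x₀| ≤ M → 1 ≤ L₀ →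
      ∫⁻ t in Icc 0 T, ∫⁻ x, ENNReal.ofReal (controlForcing D F uM uP U σ φ₀ L₀ T x₀ t x ^ 2) ≤
        ENNReal.ofReal (A * (x₀ ^ 2 / T)) := by
  obtain ⟨C, lam, hC, hlam, -, -, hdec⟩ := hU.exists_exp_decay hD hF
  obtain ⟨K, k, hK, h⟩ := exists_abs_controlForcing_le hD hF hU hφ hσ hTm
  obtain ⟨E, hE, hexp⟩ := exists_exp_neg_mul_abs_mul_pow_le hlam k
  set γ := waveSpeed F uM uP with hγ
  set G := K * (C * Real.exp (lam * M) * Real.exp (lam * (|γ| * Tm)) * E) with hG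
  set I := ∫ x : ℝ, ((1 + x ^ 2)⁻¹) ^ 2 with hI
  have hI0 : 0 ≤ I := integral_nonneg fun x => by positivity
  refine ⟨G ^ 2 * I, by positivity, fun T x₀ L₀ hT hTm' hx₀ hL => ?_⟩
  refine (lintegral_lintegral_sq_le (g := fun _ x => (G * |x₀| / T) ^ 2 * ((1 + x ^ 2)⁻¹) ^ 2)
    (B := (G * |x₀| / T) ^ 2 * I) hT.le (fun t ht x => ?_)
    (fun t _ => integrable_inv_one_add_sq_sq.const_mul _)
    (fun t _ => (integral_const_mul _ _).le)).trans (ENNReal.ofReal_le_ofReal (le_of_eq ?_))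
  · rw [← mul_pow, ← sq_abs]
    refine pow_le_pow_left₀ (abs_nonneg _) ((h T x₀ L₀ hT hTm' (by linarith) t ht x).trans ?_) 2
    have h1 := abs_sub_translate_le hlam.le hC.le hU.hasDerivAt hdec hx₀ (x - γ * t)
    have h2 : |γ * t| ≤ |γ| * Tm := by
      rw [abs_mul, abs_of_nonneg ht.1]
      exact mul_le_mul_of_nonneg_left (ht.2.trans hTm') (abs_nonneg _)
    have h3 := exp_neg_mul_abs_sub_le hlam.le h2 x
    have h4 : |x| / L₀ ≤ |x| := div_le_self (abs_nonneg _) hL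
    calc _ ≤ K / T * ((C * Real.exp (lam * M) * |x₀| *
          (Real.exp (lam * (|γ| * Tm)) * Real.exp (-lam * |x|))) * (1 + |x|) ^ k) := by
          gcongr
          exact h1.trans (by gcongr)
      _ = K / T * (C * Real.exp (lam * M) * |x₀| * Real.exp (lam * (|γ| * Tm))) *
          (Real.exp (-lam * |x|) * (1 + |x|) ^ k) := by ring
      _ ≤ K / T * (C * Real.exp (lam * M) * |x₀| * Real.exp (lam * (|γ| * Tm))) *
          (E * (1 + x ^ 2)⁻¹) := mul_le_mul_of_nonneg_left (hexp x) (by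
            have := abs_nonneg x₀
            have := (Real.exp_pos (lam * M)).le
            positivity)
      _ = _ := by rw [hG]; ring
  · rw [div_pow, mul_pow, sq_abs]
    field_simp

/-- The distance from `y` to the interval `[0, x₀]` controls the difference of the profile and its
translate. -/
theorem exists_abs_sub_translate_le (hD : 0 < D) (hF : IsAdmissibleFlux F uM uP)
    (hU : IsWaveProfile D F uM uP U) :
    ∃ C lam : ℝ, 0 < C ∧ 0 < lam ∧ ∀ x₀, 0 ≤ x₀ → ∀ y,
      (y ≤ 0 → |U (y - x₀) - U y| ≤ C * Real.exp (-lam * |y|)) ∧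
      (x₀ ≤ y → |U (y - x₀) - U y| ≤ C * Real.exp (-lam * |y - x₀|)) ∧
      |U (y - x₀) - U y| ≤ C := by
  obtain ⟨C, lam, hC, hlam, hR, hL, -⟩ := hU.exists_exp_decay hD hF
  refine ⟨2 * C + 2 * (|uM| + |uP|), lam, by positivity, hlam, fun x₀ hx₀ y =>
    ⟨fun hy => ?_, fun hy => ?_, ?_⟩⟩
  · have h1 := hL y hy
    have h2 := hL (y - x₀) (by linarith)
    have h3 : Real.exp (-lam * |y - x₀|) ≤ Real.exp (-lam * |y|) := by
      rw [Real.exp_le_exp, abs_of_nonpos hy, abs_of_nonpos (by linarith)]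
      nlinarith
    have h4 := abs_sub_le (U (y - x₀)) uM (U y)
    rw [abs_sub_comm uM] at h4
    have h5 : 0 ≤ 2 * (|uM| + |uP|) * Real.exp (-lam * |y|) := by positivity
    nlinarith
  · have h1 := hR y (by linarith)
    have h2 := hR (y - x₀) (by linarith)
    have h3 : Real.exp (-lam * |y|) ≤ Real.exp (-lam * |y - x₀|) := by
      rw [Real.exp_le_exp, abs_of_nonneg (hx₀.trans hy), abs_of_nonneg (by linarith)]
      nlinarith
    have h4 := abs_sub_le (U (y - x₀)) uP (U y)
    rw [abs_sub_comm uP] at h4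
    have h5 : 0 ≤ 2 * (|uM| + |uP|) * Real.exp (-lam * |y - x₀|) := by positivity
    nlinarith
  · have := (abs_sub (U (y - x₀)) (U y)).trans
      (add_le_add (hU.abs_le hD hF _) (hU.abs_le hD hF _))
    linarith

/-- In the moving frame the profiles differ by a bounded amount on `[0, x₀]` and exponentially
little outside. On that interval the weight `(1 + |x|/L₀)^k` stays bounded because `L₀` is
comparable to `x₀` or larger. -/
theorem exists_energy_le_of_large (hD : 0 < D) (hF : IsAdmissibleFlux F uM uP)
    (hU : IsWaveProfile D F uM uP U) (hφ : IsNoiseProfile φ₀ φ₁) (hσ : 0 < σ) {Tm : ℝ}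
    (hTm : 0 < Tm) :
    ∃ A : ℝ, 0 ≤ A ∧ ∀ T x₀ L₀, 0 < T → T ≤ Tm → 1 ≤ x₀ → 1 ≤ L₀ →
      x₀ ≤ L₀ + |waveSpeed F uM uP| * Tm →
      ∫⁻ t in Icc 0 T, ∫⁻ x, ENNReal.ofReal (controlForcing D F uM uP U σ φ₀ L₀ T x₀ t x ^ 2) ≤
        ENNReal.ofReal (A * (x₀ / T)) := by
  obtain ⟨C, lam, hC, hlam, hΔ⟩ := exists_abs_sub_translate_le hD hF hU
  obtain ⟨K, k, hK, h⟩ := exists_abs_controlForcing_le hD hF hU hφ hσ hTm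
  obtain ⟨E, hE, hexp⟩ := exists_exp_neg_mul_abs_mul_pow_le hlam k
  set γ := waveSpeed F uM uP with hγ
  set Q := 2 + 2 * (|γ| * Tm) with hQ
  set G := K * (Q ^ k * C * (1 + E)) with hG
  set I := ∫ x : ℝ, ((1 + x ^ 2)⁻¹) ^ 2 with hI
  have hI0 : 0 ≤ I := integral_nonneg fun x => by positivity
  have hγT : 0 ≤ |γ| * Tm := by positivity
  refine ⟨G ^ 2 * (1 + 2 * I), by positivity, fun T x₀ L₀ hT hTm' hx₀ hL hxL => ?_⟩
  -- The majorant has a plateau on `[0, x₀]` and one tail at each end; its integral is at most a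
  -- multiple of `x₀` since `x₀ ≥ 1`.
  set m : ℝ → ℝ := fun y => (G / T) ^ 2 * ((Icc 0 x₀).indicator (fun _ => 1) y +
    (((1 + y ^ 2)⁻¹) ^ 2 + ((1 + (y - x₀) ^ 2)⁻¹) ^ 2)) with hm
  have hi1 : Integrable ((Icc 0 x₀).indicator fun _ : ℝ => (1 : ℝ)) :=
    (integrable_indicator_iff measurableSet_Icc).2 (integrableOn_const (by simp))
  have hi2 : Integrable fun y : ℝ => ((1 + (y - x₀) ^ 2)⁻¹) ^ 2 :=
    integrable_inv_one_add_sq_sq.comp_sub_right x₀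
  have hi3 : Integrable fun y : ℝ => ((1 + y ^ 2)⁻¹) ^ 2 + ((1 + (y - x₀) ^ 2)⁻¹) ^ 2 :=
    integrable_inv_one_add_sq_sq.add hi2
  have hmi : Integrable m := (hi1.add hi3).const_mul _
  have hmI : ∫ y, m y = (G / T) ^ 2 * (x₀ + (I + I)) := by
    rw [hm, integral_const_mul, integral_add hi1 hi3,
      integral_add integrable_inv_one_add_sq_sq hi2, integral_indicator_const _ measurableSet_Icc,
      integral_sub_right_eq_self (fun y : ℝ => ((1 + y ^ 2)⁻¹) ^ 2) x₀]
    simp [Measure.real, hI, (by linarith : 0 ≤ x₀)]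
  refine (lintegral_lintegral_sq_le (g := fun t x => m (x - γ * t))
    (B := (G / T) ^ 2 * (x₀ + (I + I))) hT.le (fun t ht x => ?_)
    (fun t _ => hmi.comp_sub_right _) (fun t _ => ?_)).trans (ENNReal.ofReal_le_ofReal ?_)
  · set y := x - γ * t with hy
    have h2 : |γ * t| ≤ |γ| * Tm := by
      rw [abs_mul, abs_of_nonneg ht.1]
      exact mul_le_mul_of_nonneg_left (ht.2.trans hTm') (abs_nonneg _)
    have hcf := h T x₀ L₀ hT hTm' (by linarith) t ht x
    rw [← hy] at hcf
    have hxy : |x| ≤ |y| + |γ| * Tm := by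
      have := abs_add_le y (γ * t)
      rw [hy, sub_add_cancel] at this
      linarith
    -- Here `d` stands for the distance from `y` to `[0, x₀]`; the bound `x₀ ≤ L₀ + |γ| Tm` absorbs
    -- the rest.
    have hpoly : ∀ d, 0 ≤ d → |y| ≤ d + x₀ → (1 + |x| / L₀) ^ k ≤ Q ^ k * (1 + d) ^ k := by
      intro d hd hyd
      rw [← mul_pow]
      refine pow_le_pow_left₀ (by positivity) ?_ k
      have : |x| / L₀ ≤ 1 + 2 * (|γ| * Tm) + d := by
        rw [div_le_iff₀ (by linarith)]
        nlinarith
      nlinarith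
    have hsq : ∀ z : ℝ, |controlForcing D F uM uP U σ φ₀ L₀ T x₀ t x| ≤ G / T * z →
        controlForcing D F uM uP U σ φ₀ L₀ T x₀ t x ^ 2 ≤ (G / T) ^ 2 * z ^ 2 := fun z hz => by
      rw [← sq_abs, ← mul_pow]
      exact pow_le_pow_left₀ (abs_nonneg _) hz 2
    have hdecay : ∀ z : ℝ, |y| ≤ |z| + x₀ → |U (y - x₀) - U y| ≤ C * Real.exp (-lam * |z|) →
        controlForcing D F uM uP U σ φ₀ L₀ T x₀ t x ^ 2 ≤
          (G / T) ^ 2 * ((1 + z ^ 2)⁻¹) ^ 2 := fun z hz hU' => by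
      refine hsq _ (hcf.trans ?_)
      calc _ ≤ K / T * (C * Real.exp (-lam * |z|) * (Q ^ k * (1 + |z|) ^ k)) := by
            gcongr
            exact hpoly _ (abs_nonneg z) hz
        _ = K / T * (Q ^ k * C) * (Real.exp (-lam * |z|) * (1 + |z|) ^ k) := by ring
        _ ≤ K / T * (Q ^ k * C) * ((1 + E) * (1 + z ^ 2)⁻¹) := by
            refine mul_le_mul_of_nonneg_left ((hexp z).trans ?_) (by positivity)
            gcongr
            linarith
        _ = _ := by rw [hG]; ring
    have hi0 : 0 ≤ (Icc 0 x₀).indicator (fun _ : ℝ => (1 : ℝ)) y :=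
      indicator_nonneg (fun _ _ => zero_le_one) y
    obtain ⟨hl, hr, hbd⟩ := hΔ x₀ (by linarith) y
    rcases le_total y 0 with hy0 | hy0
    · refine (hdecay y (by linarith) (hl hy0)).trans (mul_le_mul_of_nonneg_left ?_ (sq_nonneg _))
      have : 0 ≤ ((1 + (y - x₀) ^ 2)⁻¹) ^ 2 := by positivity
      linarith
    rcases le_total x₀ y with hyx | hyx
    · refine (hdecay (y - x₀) ?_ (hr hyx)).trans (mul_le_mul_of_nonneg_left ?_ (sq_nonneg _))
      · rw [abs_of_nonneg hy0, abs_of_nonneg (sub_nonneg.2 hyx)]; linarith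
      have : 0 ≤ ((1 + y ^ 2)⁻¹) ^ 2 := by positivity
      linarith
    · refine (hsq 1 (hcf.trans ?_)).trans (mul_le_mul_of_nonneg_left ?_ (sq_nonneg _))
      · have h3 := hpoly 0 le_rfl (by rw [abs_of_nonneg hy0]; linarith)
        rw [add_zero, one_pow, mul_one] at h3
        calc _ ≤ K / T * (C * Q ^ k) := by gcongr
          _ ≤ K / T * (C * Q ^ k) * (1 + E) := le_mul_of_one_le_right (by positivity) (by linarith)
          _ = _ := by rw [hG]; ring
      · rw [indicator_of_mem (show y ∈ Icc 0 x₀ from ⟨hy0, hyx⟩), one_pow]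
        have : 0 ≤ ((1 + y ^ 2)⁻¹) ^ 2 + ((1 + (y - x₀) ^ 2)⁻¹) ^ 2 := by positivity
        linarith
  · rw [integral_sub_right_eq_self m, hmI]
  · have : x₀ + (I + I) ≤ (1 + 2 * I) * x₀ := by nlinarith
    calc T * ((G / T) ^ 2 * (x₀ + (I + I))) ≤ T * ((G / T) ^ 2 * ((1 + 2 * I) * x₀)) := by gcongr
      _ = _ := by field_simp

end

/-! ### Two-sided bounds on the cost -/

section

variable {D uM uP σ : ℝ} {F U φ₀ φ₁ : ℝ → ℝ} {T x₀ L₀ : ℝ}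

theorem BoundedAsymp.rescale {C₁ C₂ r k : ℝ} {J : ℝ → ℝ≥0∞} {r' : ℝ}
    (h : BoundedAsymp C₁ C₂ r J) (hr : r = k * r') : BoundedAsymp (C₁ * k) (C₂ * k) r' J := by
  simpa only [BoundedAsymp, mul_assoc, ← hr] using h

/-- Raising `A` to `A + 1` makes the energy inequality strict when `r > 0`, as passing to small `lc`
requires; for `r = 0` the displacement and the cost vanish. -/
theorem boundedAsymp_of_energy_le (hD : 0 < D) (hF : IsAdmissibleFlux F uM uP)
    (hU : IsWaveProfile D F uM uP U) (hφ : IsNoiseProfile φ₀ φ₁) (hσ : 0 < σ) (hT : 0 < T)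
    {C₁ A r : ℝ} (hr : 0 ≤ r) (hrx : r = 0 → x₀ = 0)
    (hlow : ∀ lc, 0 < lc → ENNReal.ofReal (C₁ * r) ≤
      displacementCost D F uM uP U (noiseKernel σ φ₀ φ₁ L₀ lc) T x₀) (hA0 : 0 ≤ A)
    (hA : ∫⁻ t in Icc 0 T, ∫⁻ x, ENNReal.ofReal
      (controlForcing D F uM uP U σ φ₀ L₀ T x₀ t x ^ 2) ≤ ENNReal.ofReal (A * r)) :
    BoundedAsymp C₁ (A + 1) r
      fun lc => displacementCost D F uM uP U (noiseKernel σ φ₀ φ₁ L₀ lc) T x₀ := by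
  have hup : ∀ᶠ lc in 𝓝[>] (0 : ℝ), displacementCost D F uM uP U (noiseKernel σ φ₀ φ₁ L₀ lc) T x₀ ≤
      ENNReal.ofReal ((A + 1) * r) := by
    rcases hr.eq_or_lt' with h0 | h0
    · refine .of_forall fun lc => ?_
      rw [hrx h0, displacementCost_zero_displacement hD hF hU hT]
      exact zero_le
    · refine eventually_displacementCost_le hD hF hU hφ hσ hT (hA.trans_lt ?_)
      exact (ENNReal.ofReal_lt_ofReal_iff (by positivity)).2 (by nlinarith)
  filter_upwards [hup, self_mem_nhdsWithin] with lc h1 h2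
  exact ⟨hlow lc h2, h1⟩

theorem exists_boundedAsymp_of_bounded (hD : 0 < D) (hF : IsAdmissibleFlux F uM uP)
    (hU : IsWaveProfile D F uM uP U) (hφ : IsNoiseProfile φ₀ φ₁) (hσ : 0 < σ) {Tm M : ℝ}
    (hTm : 0 < Tm) (hM : 0 ≤ M) :
    ∃ C₁ C₂ : ℝ, 0 < C₁ ∧ 0 < C₂ ∧ ∀ T x₀, 0 < T → T ≤ Tm → |x₀| ≤ M →
      0 ≤ x₀ + waveSpeed F uM uP * T → BoundedAsymp C₁ C₂ (x₀ ^ 2 / T) fun lc =>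
        displacementCost D F uM uP U
          (noiseKernel σ φ₀ φ₁ (waveSpeed F uM uP * T + x₀ + 1) lc) T x₀ := by
  obtain ⟨c, hc, hlow⟩ := exists_le_displacementCost (σ := σ) hD hF hU hφ
  obtain ⟨A, hA0, hA⟩ := exists_energy_le_of_bounded hD hF hU hφ hσ hTm M
  set γ := waveSpeed F uM uP
  -- For `T ≤ Tm` and `|x₀| ≤ M` the denominator is an upper bound for `L₀`.
  refine ⟨c / (|γ| * Tm + M + 1), A + 1, by positivity, by positivity,
    fun T x₀ hT hTm' hx₀ hx => boundedAsymp_of_energy_le hD hF hU hφ hσ hT (by positivity)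
      (fun h => ?_) (fun lc hlc => ?_) hA0 (hA T x₀ _ hT hTm' hx₀ (by linarith))⟩
  · simpa [hT.ne'] using h
  · have hL : 0 < γ * T + x₀ + 1 := by linarith
    refine le_trans (ENNReal.ofReal_le_ofReal ?_) (hlow T x₀ _ lc hT hL hlc)
    rw [div_mul_eq_mul_div, mul_div_assoc, div_div]
    refine mul_le_mul_of_nonneg_left (div_le_div_of_nonneg_left (sq_nonneg _) (by positivity)
      (mul_le_mul_of_nonneg_left ?_ hT.le)) hc.le
    have h1 : γ * T ≤ |γ| * Tm := (mul_le_mul_of_nonneg_right (le_abs_self γ) hT.le).trans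
      (mul_le_mul_of_nonneg_left hTm' (abs_nonneg _))
    linarith [(le_abs_self x₀).trans hx₀]

theorem exists_boundedAsymp_of_large (hD : 0 < D) (hF : IsAdmissibleFlux F uM uP)
    (hU : IsWaveProfile D F uM uP U) (hφ : IsNoiseProfile φ₀ φ₁) (hσ : 0 < σ) {Tm : ℝ}
    (hTm : 0 < Tm) :
    ∃ R C₁ C₂ : ℝ, 0 < R ∧ 0 < C₁ ∧ 0 < C₂ ∧ ∀ T x₀, 0 < T → T ≤ Tm → R < |x₀| →
      0 ≤ x₀ + waveSpeed F uM uP * T → BoundedAsymp C₁ C₂ (|x₀| / T) fun lc =>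
        displacementCost D F uM uP U
          (noiseKernel σ φ₀ φ₁ (waveSpeed F uM uP * T + x₀ + 1) lc) T x₀ := by
  obtain ⟨c, hc, hlow⟩ := exists_le_displacementCost (σ := σ) hD hF hU hφ
  obtain ⟨A, hA0, hA⟩ := exists_energy_le_of_large hD hF hU hφ hσ hTm
  set γ := waveSpeed F uM uP
  -- Beyond this radius a negative `x₀` would violate `x₀ + γT ≥ 0`, and `γT + 1 ≤ x₀` gives `L₀ ≤
  -- 2x₀`, whence the constant `c / 2`.
  refine ⟨1 + |γ| * Tm, c / 2, A + 1, by positivity, by positivity, by positivity,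
    fun T x₀ hT hTm' hx₀ hx => ?_⟩
  have h1 : |γ| * T ≤ |γ| * Tm := mul_le_mul_of_nonneg_left hTm' (abs_nonneg _)
  have h2 : γ * T ≤ |γ| * T := mul_le_mul_of_nonneg_right (le_abs_self γ) hT.le
  have h3 : -(|γ| * T) ≤ γ * T := by
    rw [← neg_mul]; exact mul_le_mul_of_nonneg_right (neg_abs_le γ) hT.le
  have h4 : 0 ≤ |γ| * Tm := by positivity
  have hx0 : 0 < x₀ := by
    by_contra! h
    rw [abs_of_nonpos h] at hx₀
    linarith
  rw [abs_of_pos hx0] at hx₀ ⊢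
  refine boundedAsymp_of_energy_le hD hF hU hφ hσ hT (by positivity) (fun h => ?_)
    (fun lc hlc => ?_) hA0 (hA T x₀ _ hT hTm' (by linarith) (by linarith) (by linarith))
  · exact absurd h (div_pos hx0 hT).ne'
  · have hL : 0 < γ * T + x₀ + 1 := by linarith
    refine le_trans (ENNReal.ofReal_le_ofReal ?_) (hlow T x₀ _ lc hT hL hlc)
    calc c / 2 * (x₀ / T) = c * (x₀ ^ 2 / (T * (2 * x₀))) := by field_simp
      _ ≤ _ := by gcongr; linarith

end

end WaveDisplacement

end

/-! ### The five regimes -/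

theorem mainTheorem1 (D : ℝ) (hD : 0 < D) (F : ℝ → ℝ) (uM uP : ℝ)
    (hF : WaveDisplacement.IsAdmissibleFlux F uM uP)
    (U : ℝ → ℝ) (hU : WaveDisplacement.IsWaveProfile D F uM uP U)
    (γ : ℝ) (hγ : γ = WaveDisplacement.waveSpeed F uM uP) :
    ∃ C₀ : ℝ, 0 < C₀ ∧
      ∀ (σ : ℝ) (φ₀ φ₁ : ℝ → ℝ), 0 < σ → WaveDisplacement.IsNoiseProfile φ₀ φ₁ →
      ∀ J : ℝ → ℝ → ℝ → ENNReal,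
      (∀ T x₀ lc, J T x₀ lc = WaveDisplacement.displacementCost D F uM uP U
        (WaveDisplacement.noiseKernel σ φ₀ φ₁ (γ * T + x₀ + C₀) lc) T x₀) →
      -- `|x₀|` small, `T` fixed
      (∀ T : ℝ, 0 < T → ∃ δ C₁ C₂ : ℝ, 0 < δ ∧ 0 < C₁ ∧ 0 < C₂ ∧
        ∀ x₀ : ℝ, |x₀| < δ → 0 ≤ x₀ + γ * T →
          WaveDisplacement.BoundedAsymp C₁ C₂ (x₀ ^ 2) (J T x₀)) ∧
      -- `|x₀|` small, `T` small
      (∃ δ τ C₁ C₂ : ℝ, 0 < δ ∧ 0 < τ ∧ 0 < C₁ ∧ 0 < C₂ ∧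
        ∀ T x₀ : ℝ, 0 < T → T < τ → |x₀| < δ → 0 ≤ x₀ + γ * T →
          WaveDisplacement.BoundedAsymp C₁ C₂ (x₀ ^ 2 / T) (J T x₀)) ∧
      -- `|x₀|` large, `T` fixed
      (∀ T : ℝ, 0 < T → ∃ R C₁ C₂ : ℝ, 0 < R ∧ 0 < C₁ ∧ 0 < C₂ ∧
        ∀ x₀ : ℝ, R < |x₀| → 0 ≤ x₀ + γ * T →
          WaveDisplacement.BoundedAsymp C₁ C₂ |x₀| (J T x₀)) ∧
      -- `|x₀|` large, `T` small
      (∃ R τ C₁ C₂ : ℝ, 0 < R ∧ 0 < τ ∧ 0 < C₁ ∧ 0 < C₂ ∧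
        ∀ T x₀ : ℝ, 0 < T → T < τ → R < |x₀| → 0 ≤ x₀ + γ * T →
          WaveDisplacement.BoundedAsymp C₁ C₂ (|x₀| / T) (J T x₀)) ∧
      -- `T` small, `x₀` fixed
      (∀ x₀ : ℝ, x₀ ≠ 0 → ∃ τ C₁ C₂ : ℝ, 0 < τ ∧ 0 < C₁ ∧ 0 < C₂ ∧
        ∀ T : ℝ, 0 < T → T < τ → 0 ≤ x₀ + γ * T →
          WaveDisplacement.BoundedAsymp C₁ C₂ (1 / T) (J T x₀)) := by
  subst hγ
  -- With `C₀ = 1` the condition `x₀ + γT ≥ 0` gives `L₀ ≥ 1`.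
  refine ⟨1, one_pos, fun σ φ₀ φ₁ hσ hφ J hJ => ?_⟩
  have hJ' : ∀ T x₀, J T x₀ = fun lc => WaveDisplacement.displacementCost D F uM uP U
      (WaveDisplacement.noiseKernel σ φ₀ φ₁
        (WaveDisplacement.waveSpeed F uM uP * T + x₀ + 1) lc) T x₀ :=
    fun T x₀ => funext (hJ T x₀)
  simp only [hJ']
  refine ⟨fun T hT => ?_, ?_, fun T hT => ?_, ?_, fun x₀ hx₀ => ?_⟩
  · obtain ⟨C₁, C₂, h₁, h₂, h⟩ := WaveDisplacement.exists_boundedAsymp_of_bounded hD hF hU hφ hσ hT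
      zero_le_one
    exact ⟨1, C₁ * T⁻¹, C₂ * T⁻¹, one_pos, by positivity, by positivity, fun x₀ hx hx' =>
      (h T x₀ hT le_rfl hx.le hx').rescale (by ring)⟩
  · obtain ⟨C₁, C₂, h₁, h₂, h⟩ := WaveDisplacement.exists_boundedAsymp_of_bounded hD hF hU hφ hσ
      one_pos zero_le_one
    exact ⟨1, 1, C₁, C₂, one_pos, one_pos, h₁, h₂, fun T x₀ hT hT' hx hx' =>
      h T x₀ hT hT'.le hx.le hx'⟩
  · obtain ⟨R, C₁, C₂, hR, h₁, h₂, h⟩ :=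
      WaveDisplacement.exists_boundedAsymp_of_large hD hF hU hφ hσ hT
    exact ⟨R, C₁ * T⁻¹, C₂ * T⁻¹, hR, by positivity, by positivity, fun x₀ hx hx' =>
      (h T x₀ hT le_rfl hx hx').rescale (by ring)⟩
  · obtain ⟨R, C₁, C₂, hR, h₁, h₂, h⟩ :=
      WaveDisplacement.exists_boundedAsymp_of_large hD hF hU hφ hσ one_pos
    exact ⟨R, 1, C₁, C₂, hR, one_pos, h₁, h₂, fun T x₀ hT hT' hx hx' => h T x₀ hT hT'.le hx hx'⟩
  -- For fixed `x₀` this is the bounded regime with `M = |x₀|`; the nonzero factor `x₀²` goes into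
  -- the constants.
  · obtain ⟨C₁, C₂, h₁, h₂, h⟩ := WaveDisplacement.exists_boundedAsymp_of_bounded hD hF hU hφ hσ
      one_pos (abs_nonneg x₀)
    exact ⟨1, C₁ * x₀ ^ 2, C₂ * x₀ ^ 2, one_pos, by positivity, by positivity, fun T hT hT' hx' =>
      (h T x₀ hT hT'.le le_rfl hx').rescale (by ring)⟩
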